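/- **Random walk amplitude estimation for the heat equation.** *Setting.* Let $L,T,\alpha>0$ and let $u$ be a solution of $\partial u/\partial t=\alpha\sum_{j=1}^d\partial^2u/\partial x_j^2$ on $[0,L]^d\times[0,T]$, with periodic boundary conditions in space, four times continuously differentiable in space, and with $u_0=u(\cdot,0)\ge 0$. Assume that for some $\zeta$, for all $j,k$ and everywhere on $[0,L]^d\times[0,T]$, $$\Big|\frac{\partial^4u}{\partial x_j^2\partial x_k^2}\Big|\le\frac{\zeta}{L^d},\qquad \Big|\frac{\partial^2u}{\partial x_j^2}\Big|\le\frac{\zeta}{L^{d-2}},\qquad \Big|\frac{\partial u}{\partial x_j}\Big|\le\frac{\zeta}{L^{d-3}}.$$ For an integer $n\ge1$ let $\Delta x=L/n$ and $\Delta t=\Delta x^2/(2d\alpha)$, and let $u_0$ be normalised so that $\sum_{x\in\{0,\dots,n-1\}^d}u_0(x\Delta x)=\Delta x^{-d}$. *Algorithms.* A quantum algorithm is one finite program. It reads a classical input, runs bounded loops and tests, and in them applies elementary gates to qubits that start in $|0\cdots0\rangle$: the Pauli gate $X$, the rotations $|0\rangle\mapsto\sqrt{1-a/b}\,|0\rangle+\sqrt{a/b}\,|1\rangle$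 and the phase shifts $|1\rangle\mapsto e^{2\pi i a/b}|1\rangle$ with integers $a,b$, all of them possibly controlled by other qubits. At the end it measures all qubits and computes its real output from the outcome by a fixed formula in the arithmetic operations, $\pi$ and $\sin$. Its access to $u_0$ reflects the assumption that sums of $u_0$ over discretised regions are known exactly at no cost: in one step it can apply (possibly controlled) the rotation $|0\rangle\mapsto\sqrt{1-\theta}\,|0\rangle+\sqrt{\theta}\,|1\rangle$, where, for a prefix $\beta$ held in qubits of the binary code of grid points, $\theta$ is the sum of $u_0$ over the grid points whose code starts with $\beta1$, divided by the sum over those whose code starts with $\beta$. Its time is the number of executed steps: gates, controls, loop iterations, tests, evaluations of integer expressions, bits read and arithmetic operations. *Theorem.* There are a single quantum algorithm and a constant $c_0>0$ such that for every $K$ there is a constant $C$ with the following property. Let $d,n,L,T,\alpha,\zeta,u$ be as above, $0<\epsilon<1$, $$X=L\sqrt{d\zeta(\alpha T+L^2)/\epsilon},\qquad c_0X\le n\le KX,\qquad X\ge2,\qquad T\alpha d^2\zeta(\alpha T+L^2)/\epsilon\ge1 .$$ Let $S=\prod_j[(a_j+\frac12)\Delta x,(b_j+\frac12)\Delta x]\subseteq[0,L]^d$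 with integers $0\le a_j\le b_j$, and let $t=i\Delta t\in[0,T]$ with an integer $i\ge0$. On the input $d,n,i,\lceil1/\epsilon\rceil,(a_j,b_j)_j$ and with the above access to $u_0$, the algorithm outputs with probability at least $0.99$ a number $\overline u(S)$ such that $$\Big|\overline u(S)-\int_Su(\mathbf x,t)\,d\mathbf x\Big|\le\epsilon,$$ in time at most $$C\,\frac{T\alpha d^3\zeta(\alpha T+L^2)}{\epsilon^2}\,\log\Big(L\sqrt{d\zeta(\alpha T+L^2)/\epsilon}\Big).$$ -/

import Mathlib

noncomputable section

namespace HeatQ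

/-! ### The heat equation with periodic boundary conditions -/

/-- The partial derivative of `f` in the `j`-th coordinate direction. -/
def pd {d : ℕ} (j : Fin d) (f : (Fin d → ℝ) → ℝ) : (Fin d → ℝ) → ℝ :=
  fun x => lineDeriv ℝ f x (Pi.single j 1)

/-- The cube `[0,L]^d`. -/
def cube (d : ℕ) (L : ℝ) : Set (Fin d → ℝ) := Set.Icc 0 (fun _ => L)

/-- `u x t` is a solution of `∂u/∂t = α (∂²u/∂x₁² + ⋯ + ∂²u/∂x_d²)` on `[0,L]^d × [0,T]`
with periodic boundary conditions in space (each `u · t` is extended `L`-periodically to `ℝ^d`) and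
nonnegative initial condition `u₀ = u · 0`.  At the ends of `[0,T]` the time derivative
is one-sided. -/
structure IsHeatSolution (d : ℕ) (L T α : ℝ) (u : (Fin d → ℝ) → ℝ → ℝ) : Prop where
  periodic : ∀ t ∈ Set.Icc 0 T, ∀ x, ∀ j, u (x + Pi.single j L) t = u x t
  smooth : ∀ t ∈ Set.Icc 0 T, ContDiff ℝ 4 (fun x => u x t)
  heat : ∀ t ∈ Set.Icc 0 T, ∀ x, HasDerivWithinAt (fun s => u x s)
    (α * ∑ j, pd j (pd j (fun y => u y t)) x) (Set.Icc 0 T) t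
  nonneg : ∀ x, 0 ≤ u x 0

/-- The smoothness bounds with parameter `ζ` on the derivatives of `u` on `[0,L]^d × [0,T]`. -/
structure HasSmoothnessBound (d : ℕ) (L T ζ : ℝ) (u : (Fin d → ℝ) → ℝ → ℝ) : Prop where
  fourth : ∀ t ∈ Set.Icc 0 T, ∀ x ∈ cube d L, ∀ j k,
    |pd j (pd j (pd k (pd k (fun y => u y t)))) x| ≤ ζ / L ^ d
  second : ∀ t ∈ Set.Icc 0 T, ∀ x ∈ cube d L, ∀ j,
    |pd j (pd j (fun y => u y t)) x| ≤ ζ / L ^ ((d : ℤ) - 2)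
  first : ∀ t ∈ Set.Icc 0 T, ∀ x ∈ cube d L, ∀ j,
    |pd j (fun y => u y t) x| ≤ ζ / L ^ ((d : ℤ) - 3)

/-! ### The grid -/

/-- The space step `Δx`, with `L = n Δx`. -/
def dx (L : ℝ) (n : ℕ) : ℝ := L / n

/-- The time step `Δt = Δx² / (2 d α)`. -/
def dt (d : ℕ) (L α : ℝ) (n : ℕ) : ℝ := dx L n ^ 2 / (2 * d * α)

/-- The values of the initial condition at the `n^d` grid points. -/
def gridInit {d : ℕ} (L : ℝ) (n : ℕ) (u : (Fin d → ℝ) → ℝ → ℝ) (x : Fin d → Fin n) : ℝ :=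
  u (fun j => ((x j : ℕ) : ℝ) * dx L n) 0

/-- The normalisation `∑ u₀ = Δx^{-d}`, the sum being over the grid. -/
def IsNormalised {d : ℕ} (L : ℝ) (n : ℕ) (u : (Fin d → ℝ) → ℝ → ℝ) : Prop :=
  ∑ x, gridInit L n u x = (dx L n ^ d)⁻¹

/-- The hyperrectangle with corners at integer multiples of `Δx` shifted by `Δx/2`:
the product of the intervals `[(a_j + 1/2) Δx, (b_j + 1/2) Δx]`. -/
def shiftedBox {d : ℕ} (L : ℝ) (n : ℕ) (a b : Fin d → ℕ) : Set (Fin d → ℝ) :=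
  Set.Icc (fun j => ((a j : ℝ) + 1 / 2) * dx L n) (fun j => ((b j : ℝ) + 1 / 2) * dx L n)

/-! ### Quantum circuits

A state of `N` qubits is a vector of amplitudes indexed by the `2^N` classical bit strings.
Every elementary operation acts on one target qubit by a `2 × 2` unitary matrix, if all its
control qubits are `1`. -/

/-- The `2 × 2` matrices that are available, with parameters of type `A`:
* `flip`: the Pauli matrix `X`;
* `rot a b`: the rotation taking `|0⟩` to `√(1-a/b) |0⟩ + √(a/b) |1⟩`;
* `phase a b`: the phase shift `|1⟩ ↦ exp(2πi a/b) |1⟩`;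
* `load r p`: access to the initial condition.  The qubits `r, r+1, …` are read as the binary code
  of a grid point.  The rotation takes `|0⟩` to `√(1-θ) |0⟩ + √θ |1⟩`, where `θ` is the fraction
  of the sum of the initial condition over the dyadic subregion selected by the first `p` code bits
  that lies in the half of that subregion where the next code bit is `1`. -/
inductive Op (A : Type) : Type
  | flip : Op A
  | rot (a b : A) : Op A
  | phase (a b : A) : Op A
  | load (r p : A) : Op A

/-- An elementary operation: `op` on the qubit `tgt`, controlled by the qubits `ctrls`. -/
structure Gate (A : Type) : Type where
  op : Op A
  ctrls : List A
  tgt : A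

def Op.map {A B : Type} (f : A → B) : Op A → Op B
  | .flip => .flip
  | .rot a b => .rot (f a) (f b)
  | .phase a b => .phase (f a) (f b)
  | .load r p => .load (f r) (f p)

def Gate.map {A B : Type} (f : A → B) (g : Gate A) : Gate B :=
  ⟨g.op.map f, g.ctrls.map f, f g.tgt⟩

/-- Bit number `l` of the code of a grid point `x ∈ {0,…,n-1}^d`: the coordinates are written one
after the other, each with `Nat.size n` binary digits, most significant digit first. -/
def codeBit {d n : ℕ} (x : Fin d → Fin n) (l : ℕ) : Bool :=
  if h : l / Nat.size n < d then
    (x ⟨l / Nat.size n, h⟩ : ℕ).testBit (Nat.size n - 1 - l % Nat.size n)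
  else false

/-- The sum of `v` over the grid points whose code starts with `β 0, …, β (p-1)`. -/
def regionSum {d n : ℕ} (v : (Fin d → Fin n) → ℝ) (β : ℕ → Bool) (p : ℕ) : ℝ :=
  open Classical in ∑ x, if ∀ l < p, codeBit x l = β l then v x else 0

/-- The rotation taking `|0⟩` to `√(1-θ) |0⟩ + √θ |1⟩` (`θ` is first truncated to `[0,1]`);
the row is the new value of the qubit, the column the old one. -/
def rotMatrix (θ : ℝ) : Matrix Bool Bool ℂ := fun o i =>
  let q : ℝ := max 0 (min 1 θ)
  if o = i then (√(1 - q) : ℝ) else if o then (√q : ℝ) else -(√q : ℝ)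

/-- The matrix of an operation; `β` is the list of the current bits, `v` the initial condition. -/
def Op.matrix {d n : ℕ} (v : (Fin d → Fin n) → ℝ) (β : ℕ → Bool) : Op ℕ → Matrix Bool Bool ℂ
  | .flip => fun o i => if o = i then 0 else 1
  | .rot a b => rotMatrix ((a : ℝ) / b)
  | .phase a b => fun o i =>
      if o = i then
        (if o then Complex.exp (2 * Real.pi * Complex.I * ((a : ℂ) / b)) else 1)
      else 0
  | .load r p =>
      let γ : ℕ → Bool := fun l => β (r + l)
      rotMatrix (regionSum v (Function.update γ p true) (p + 1) / regionSum v γ p)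

/-- The bit at address `k`; addresses outside the memory read as `0`. -/
def bit {N : ℕ} (s : Fin N → Bool) (k : ℕ) : Bool := if h : k < N then s ⟨k, h⟩ else false

/-- The action of an operation on a state.  Controls and data are read with the target qubit
replaced by `0`, so the matrix never depends on the target and the action is unitary; an
operation whose target lies outside the memory does nothing. -/
def Gate.apply {d n N : ℕ} (v : (Fin d → Fin n) → ℝ) (g : Gate ℕ)
    (ψ : (Fin N → Bool) → ℂ) : (Fin N → Bool) → ℂ := fun s =>
  if h : g.tgt < N then
    let s₀ := Function.update s ⟨g.tgt, h⟩ false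
    if ∀ c ∈ g.ctrls, bit s₀ c = true then
      ∑ o : Bool, g.op.matrix v (bit s₀) (s ⟨g.tgt, h⟩) o * ψ (Function.update s ⟨g.tgt, h⟩ o)
    else ψ s
  else ψ s

/-- The state reached from `|0…0⟩` by a list of operations, the head being performed first. -/
def finalState {d n : ℕ} (v : (Fin d → Fin n) → ℝ) (N : ℕ) (gs : List (Gate ℕ)) :
    (Fin N → Bool) → ℂ :=
  gs.foldl (fun ψ g => g.apply v ψ) (fun s => if s = fun _ => false then 1 else 0)

/-! ### Programs

A quantum algorithm is one finite program that reads its classical input from a read-only memory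
`mem`, executes elementary operations on qubits under the control of bounded loops, measures all
qubits and computes a real number from the outcome. -/

/-- Integer expressions.  `var k` is the counter of the `k`-th enclosing loop, counted from
the inside, and `mem e` is the input word at address `e`.  No operation increases the size of
integers more than polynomially, and programs have no other integer variables: all integers that
occur are bounded by a polynomial in the input words. -/
inductive Expr : Type
  | const (k : ℕ) : Expr
  | var (k : ℕ) : Expr
  | mem (e : Expr) : Expr
  | add (e f : Expr) : Expr
  | sub (e f : Expr) : Expr
  | mul (e f : Expr) : Expr
  | div (e f : Expr) : Expr
  | mod (e f : Expr) : Expr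
  | shr (e f : Expr) : Expr
  | log (e : Expr) : Expr
  | msb (e : Expr) : Expr

def Expr.eval (mem : ℕ → ℕ) (env : List ℕ) : Expr → ℕ
  | .const k => k
  | .var k => env.getD k 0
  | .mem e => mem (e.eval mem env)
  | .add e f => e.eval mem env + f.eval mem env
  | .sub e f => e.eval mem env - f.eval mem env
  | .mul e f => e.eval mem env * f.eval mem env
  | .div e f => e.eval mem env / f.eval mem env
  | .mod e f => e.eval mem env % f.eval mem env
  | .shr e f => e.eval mem env / 2 ^ f.eval mem env
  | .log e => Nat.log 2 (e.eval mem env)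
  | .msb e => if e.eval mem env = 0 then 0 else 2 ^ Nat.log 2 (e.eval mem env)

/-- The time for the evaluation of an expression: its number of nodes. -/
def Expr.time : Expr → ℕ
  | .const _ => 1
  | .var _ => 1
  | .mem e => e.time + 1
  | .add e f => e.time + f.time + 1
  | .sub e f => e.time + f.time + 1
  | .mul e f => e.time + f.time + 1
  | .div e f => e.time + f.time + 1
  | .mod e f => e.time + f.time + 1
  | .shr e f => e.time + f.time + 1
  | .log e => e.time + 1
  | .msb e => e.time + 1

def Op.exprTime : Op Expr → ℕ
  | .flip => 0
  | .rot a b => a.time + b.time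
  | .phase a b => a.time + b.time
  | .load r p => r.time + p.time

/-- Programs: `ite e P Q` runs `P` if `e ≠ 0` and `Q` otherwise; `loop e P` runs `P` with the
loop counter `0, 1, …, e - 1`. -/
inductive Prog : Type
  | skip : Prog
  | gate (g : Gate Expr) : Prog
  | seq (P Q : Prog) : Prog
  | ite (e : Expr) (P Q : Prog) : Prog
  | loop (e : Expr) (P : Prog) : Prog

/-- The sequence of elementary operations that a program performs. -/
def Prog.circuit (mem : ℕ → ℕ) : Prog → List ℕ → List (Gate ℕ)
  | .skip, _ => []
  | .gate g, env => [g.map (fun e => e.eval mem env)]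
  | .seq P Q, env => P.circuit mem env ++ Q.circuit mem env
  | .ite e P Q, env => if e.eval mem env ≠ 0 then P.circuit mem env else Q.circuit mem env
  | .loop e P, env => (List.range (e.eval mem env)).flatMap (fun k => P.circuit mem (k :: env))

/-- The number of steps of a program: an elementary quantum operation takes one step and one more
for each control; loops, tests and the evaluation of expressions are charged as well. -/
def Prog.time (mem : ℕ → ℕ) : Prog → List ℕ → ℕ
  | .skip, _ => 1
  | .gate g, _ => 1 + g.ctrls.length + g.op.exprTime + (g.ctrls.map Expr.time).sum + g.tgt.time
  | .seq P Q, env => P.time mem env + Q.time mem env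
  | .ite e P Q, env =>
      1 + e.time + if e.eval mem env ≠ 0 then P.time mem env else Q.time mem env
  | .loop e P, env =>
      1 + e.time + ∑ k ∈ Finset.range (e.eval mem env), (1 + P.time mem (k :: env))

/-- The real arithmetic on the measured bits.  `bits r k` is the integer with the `k` binary digits
that were measured on the qubits `r, …, r + k - 1`, least significant digit first. -/
inductive Readout : Type
  | int (e : Expr) : Readout
  | bits (r k : Expr) : Readout
  | pi : Readout
  | add (x y : Readout) : Readout
  | sub (x y : Readout) : Readout
  | mul (x y : Readout) : Readout
  | div (x y : Readout) : Readout
  | sin (x : Readout) : Readout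

def Readout.eval (mem : ℕ → ℕ) {N : ℕ} (s : Fin N → Bool) : Readout → ℝ
  | .int e => e.eval mem []
  | .bits r k => ∑ l ∈ Finset.range (k.eval mem []),
      if bit s (r.eval mem [] + l) then (2 : ℝ) ^ l else 0
  | .pi => Real.pi
  | .add x y => x.eval mem s + y.eval mem s
  | .sub x y => x.eval mem s - y.eval mem s
  | .mul x y => x.eval mem s * y.eval mem s
  | .div x y => x.eval mem s / y.eval mem s
  | .sin x => Real.sin (x.eval mem s)

def Readout.time (mem : ℕ → ℕ) : Readout → ℕ
  | .int e => e.time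
  | .bits r k => r.time + k.time + k.eval mem [] + 1
  | .pi => 1
  | .add x y => x.time mem + y.time mem + 1
  | .sub x y => x.time mem + y.time mem + 1
  | .mul x y => x.time mem + y.time mem + 1
  | .div x y => x.time mem + y.time mem + 1
  | .sin x => x.time mem + 1

/-- A quantum algorithm: the number of qubits, the program, and the final readout. -/
structure QAlgorithm : Type where
  qubits : Expr
  code : Prog
  out : Readout

/-- The running time of an algorithm on the input `mem`. -/
def QAlgorithm.time (Q : QAlgorithm) (mem : ℕ → ℕ) : ℕ :=
  Q.qubits.time + Q.code.time mem [] + Q.out.time mem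

/-- The probability that the output of the algorithm on the input `mem`, with access to the initial
condition `v`, satisfies `E`: the sum of the squared moduli of the amplitudes of the outcomes. -/
def QAlgorithm.prob {d n : ℕ} (Q : QAlgorithm) (mem : ℕ → ℕ) (v : (Fin d → Fin n) → ℝ)
    (E : ℝ → Prop) : ℝ :=
  open Classical in ∑ s : Fin (Q.qubits.eval mem []) → Bool,
    if E (Q.out.eval mem s) then
      ‖finalState v (Q.qubits.eval mem []) (Q.code.circuit mem []) s‖ ^ 2
    else 0

/-- The classical input: the dimension `d`, the grid size `n`, the number `i` of the time step, the
accuracy as an integer `e`, and `a₀, b₀, a₁, b₁, …, a_{d-1}, b_{d-1}`, the corners of the region. -/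
def inputMem (d n i e : ℕ) (a b : Fin d → ℕ) : ℕ → ℕ
  | 0 => d
  | 1 => n
  | 2 => i
  | 3 => e
  | k + 4 => if h : k / 2 < d then (if k % 2 = 0 then a ⟨k / 2, h⟩ else b ⟨k / 2, h⟩) else 0

/-- The quantity `L √(dζ(αT + L²)/ε)`, the order of magnitude of the grid size `n`. -/
def gridScale (d : ℕ) (L T α ζ ε : ℝ) : ℝ := L * √(d * ζ * (α * T + L ^ 2) / ε)

end HeatQ

end

/-! With `Δt = Δx²/(2dα)` the explicit Euler step with central differences replaces the value at a
grid point by the mean of its `2d` neighbours. So `i` time steps amount to `avg^[i]`, where `avg` is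
the transition operator of the simple random walk on the discrete torus. This operator is
self-adjoint, hence `Δx^d ∑ u(x,t) 1_S(x)` is close to `p = Δx^d ∑ u₀(x) avg^[i] 1_S(x)`. By the
normalisation `Δx^d u₀` is a probability distribution on the grid, and `p` is the probability that a
walk started from it ends in `S`. Each step costs `Δx⁴ζ/(6L^d)` per grid point
(`abs_sub_average_le`), by Taylor expansion in space and a maximum principle in time. The midpoint
rule on the cells around the grid points costs `Δx²dζL²/8`. Together the error is at most
`Δx²dζ(αT+L²)/3` (`abs_walk_sub_integral_le`), which is at most `ε/3` as soon as `n ≥ X`; hence `c₀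
= 1`.

The number `p` is found up to `ε/2` by amplitude estimation. The state preparation `A` applies one
controlled rotation per random bit: `2d` coins for each step of the walk, and the code bits of the
starting point by means of the access to `u₀`. A phase flip before each rotation turns it into a
symmetric involution, so `A⁻¹` consists of the same operations in the opposite order. The amplitudes
of `A|0⟩` are square roots of the probabilities of a classical sampling procedure whose expectations
are `expect` (`bwd_fwd_mul`, `sum_norm_sq_fwd`), and `expect_walkEnds` identifies the probability of
the good bit strings with `p`. Membership in `S` is decided by a reversible circuit of controlled
flips that writes every cell once and is undone by running it backwards (`computes_walkL`,
`acts_oracle`).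

One iteration marks the good strings, applies `A⁻¹`, marks the zero string and applies `A`. It
preserves the plane spanned by the good and the bad part of `A|0⟩` and, up to sign, rotates it by
`2θ`, where `p = sin²θ` (`amplification_step`, `ampCoeff_eq`). A register of `k` qubits controls the
number of iterations and is read out through an inverse Fourier transform. The outcome has the mean
of two phase estimation distributions (`ampCoeff_fourier`, `amplitude_estimation`), and each of them
puts at most `1/160` on the inaccurate outcomes (`sum_phaseProb_bad_le`, `estimation_accuracy`).

For the time, there are fewer than `2^k = O(1/ε)` iterations of `O(d (i+1) log n)` steps each
(`exists_time_le`), and `i ≤ T/Δt = 2dαTn²/L²` together with `n ≤ KX` gives the stated bound. -/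

noncomputable section

namespace HeatQ

/-! ### Controlled bit flips on a classical memory -/

/-- The bit flip at `t` controlled by `cs`. -/
def cx (cs : List ℕ) (t : ℕ) : Gate ℕ := ⟨.flip, cs, t⟩

/-- The action of a gate, read as a controlled bit flip, on a classical memory. -/
def exec (g : Gate ℕ) (m : ℕ → Bool) : ℕ → Bool :=
  if ∀ c ∈ g.ctrls, Function.update m g.tgt false c = true then
    Function.update m g.tgt (!m g.tgt) else m

/-- The action of a list of gates on a classical memory, the head being performed first. -/
def execs (gs : List (Gate ℕ)) (m : ℕ → Bool) : ℕ → Bool := gs.foldl (fun m g => exec g m) m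

theorem exec_of_ne (g : Gate ℕ) (m : ℕ → Bool) {a : ℕ} (h : a ≠ g.tgt) : exec g m a = m a := by
  unfold exec
  split_ifs <;> simp [h]

/-- Controls are read with the target set to `false`, so flipping the target does not change whether
the gate fires. This is why a circuit of flips is undone by its reversed list. -/
theorem exec_exec (g : Gate ℕ) (m : ℕ → Bool) : exec g (exec g m) = m := by
  by_cases h : ∀ c ∈ g.ctrls, Function.update m g.tgt false c = true
  · have h1 : exec g m = Function.update m g.tgt (!m g.tgt) := by rw [exec, if_pos h]
    rw [h1, exec, if_pos (by simpa using h)]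
    simp
  · have h1 : exec g m = m := by rw [exec, if_neg h]
    rw [h1, h1]

@[simp] theorem execs_nil (m : ℕ → Bool) : execs [] m = m := rfl

@[simp] theorem execs_cons (g : Gate ℕ) (gs : List (Gate ℕ)) (m : ℕ → Bool) :
    execs (g :: gs) m = execs gs (exec g m) := rfl

theorem execs_append (gs hs : List (Gate ℕ)) (m : ℕ → Bool) :
    execs (gs ++ hs) m = execs hs (execs gs m) := by
  simp [execs, List.foldl_append]

theorem execs_reverse_execs (gs : List (Gate ℕ)) (m : ℕ → Bool) :
    execs gs.reverse (execs gs m) = m := by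
  induction gs generalizing m with
  | nil => rfl
  | cons g gs ih => simp [execs_append, ih, exec_exec]

/-- `gs` is a list of bit flips on cells in `[lo, hi)` controlled by cells below `hi`. -/
def FlipsIn (gs : List (Gate ℕ)) (lo hi : ℕ) : Prop :=
  ∀ g ∈ gs, g.op = .flip ∧ lo ≤ g.tgt ∧ g.tgt < hi ∧ ∀ c ∈ g.ctrls, c < hi

theorem FlipsIn.mono {gs : List (Gate ℕ)} {lo hi lo' hi' : ℕ} (h : FlipsIn gs lo hi)
    (hlo : lo' ≤ lo) (hhi : hi ≤ hi') : FlipsIn gs lo' hi' := fun g hg =>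
  ⟨(h g hg).1, hlo.trans (h g hg).2.1, (h g hg).2.2.1.trans_le hhi,
    fun c hc => ((h g hg).2.2.2 c hc).trans_le hhi⟩

theorem FlipsIn.append {gs hs : List (Gate ℕ)} {lo hi : ℕ} (h : FlipsIn gs lo hi)
    (h' : FlipsIn hs lo hi) : FlipsIn (gs ++ hs) lo hi := fun g hg => by
  rcases List.mem_append.1 hg with h1 | h1
  exacts [h g h1, h' g h1]

theorem FlipsIn.execs_eq {gs : List (Gate ℕ)} {lo hi : ℕ} (h : FlipsIn gs lo hi)
    (m : ℕ → Bool) {a : ℕ} (ha : a < lo ∨ hi ≤ a) : execs gs m a = m a := by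
  induction gs generalizing m with
  | nil => rfl
  | cons g gs ih =>
    have hg := h g (by simp)
    rw [execs_cons, ih fun g' hg' => h g' (by simp [hg']), exec_of_ne]
    omega

/-- Cells from `hi` on are never read; later this makes the result of the walk independent of the
control register. -/
theorem FlipsIn.execs_congr {gs : List (Gate ℕ)} {lo hi : ℕ} (h : FlipsIn gs lo hi)
    {m m' : ℕ → Bool} (hm : ∀ a < hi, m a = m' a) : ∀ a < hi, execs gs m a = execs gs m' a := by
  induction gs generalizing m m' with
  | nil => exact hm
  | cons g gs ih =>
    have hg := h g (by simp)
    rw [execs_cons, execs_cons]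
    refine ih (fun g' hg' => h g' (by simp [hg'])) fun a ha => ?_
    have hu : ∀ c < hi, Function.update m g.tgt false c = Function.update m' g.tgt false c := by
      intro c hc
      by_cases hct : c = g.tgt
      · rw [hct]; simp
      · rw [Function.update_of_ne hct, Function.update_of_ne hct, hm c hc]
    have hiff : (∀ c ∈ g.ctrls, Function.update m g.tgt false c = true) ↔
        ∀ c ∈ g.ctrls, Function.update m' g.tgt false c = true :=
      forall₂_congr fun c hc => by rw [hu c (hg.2.2.2 c hc)]
    unfold exec
    simp only [hiff]
    split_ifs
    · by_cases hat : a = g.tgt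
      · rw [hat]; simp [hm g.tgt hg.2.2.1]
      · rw [Function.update_of_ne hat, Function.update_of_ne hat, hm a ha]
    · exact hm a ha

/-- `gs` writes the fresh cells `[lo, hi)` only, and whatever happens later above `hi`, the
memory satisfies `φ`. -/
def Computes (gs : List (Gate ℕ)) (lo hi : ℕ) (φ : (ℕ → Bool) → Prop) : Prop :=
  lo ≤ hi ∧ FlipsIn gs lo hi ∧ ∀ m : ℕ → Bool, (∀ a, lo ≤ a → a < hi → m a = false) →
    ∀ G : ℕ → Bool, (∀ a < hi, G a = execs gs m a) → φ G

theorem Computes.mono {gs : List (Gate ℕ)} {lo hi : ℕ} {φ ψ : (ℕ → Bool) → Prop}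
    (h : Computes gs lo hi φ) (hφ : ∀ G, φ G → ψ G) : Computes gs lo hi ψ :=
  ⟨h.1, h.2.1, fun m hm G hG => hφ G (h.2.2 m hm G hG)⟩

theorem Computes.nil {lo hi : ℕ} (h : lo ≤ hi) :
    Computes [] lo hi (fun G => ∀ a, lo ≤ a → a < hi → G a = false) :=
  ⟨h, by simp [FlipsIn], fun m hm G hG a h1 h2 => by rw [hG a h2]; exact hm a h1 h2⟩

/-- Later circuits write only above `mid`, so the postcondition of `gs` still holds for the final
memory `G`. Both postconditions thus speak of the same `G` and no intermediate memories have to be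
tracked. -/
theorem Computes.append {gs hs : List (Gate ℕ)} {lo mid hi : ℕ} {φ ψ : (ℕ → Bool) → Prop}
    (h : Computes gs lo mid φ) (h' : Computes hs mid hi ψ) :
    Computes (gs ++ hs) lo hi (fun G => φ G ∧ ψ G) := by
  refine ⟨h.1.trans h'.1, (h.2.1.mono le_rfl h'.1).append (h'.2.1.mono h.1 le_rfl),
    fun m hm G hG => ?_⟩
  have hlo := h.1
  have hhi := h'.1
  rw [execs_append] at hG
  refine ⟨h.2.2 m (fun a ha hb => hm a ha (hb.trans_le hhi)) G fun a ha => ?_,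
    h'.2.2 (execs gs m) (fun a ha hb => ?_) G fun a ha => hG a ha⟩
  · rw [hG a (by omega), h'.2.1.execs_eq _ (Or.inl ha)]
  · rw [h.2.1.execs_eq m (Or.inr ha)]
    exact hm a (hlo.trans ha) hb

theorem Computes.flatMap {f : ℕ → List (Gate ℕ)} {n lo B : ℕ} {φ : ℕ → (ℕ → Bool) → Prop}
    (h : ∀ k < n, Computes (f k) (lo + k * B) (lo + (k + 1) * B) (φ k)) :
    Computes ((List.range n).flatMap f) lo (lo + n * B) (fun G => ∀ k < n, φ k G) := by
  induction n with
  | zero => exact (Computes.nil (by simp)).mono (by simp)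
  | succ n ih =>
    rw [List.range_succ, List.flatMap_append, List.flatMap_singleton]
    refine ((ih fun k hk => h k (by omega)).append (h n (by omega))).mono fun G hG k hk => ?_
    rcases Nat.lt_succ_iff_lt_or_eq.1 hk with h1 | rfl
    exacts [hG.1 k h1, hG.2]

/-- The exclusive or of the conjunctions in the list `css`. -/
def xorAll (G : ℕ → Bool) (css : List (List ℕ)) : Bool :=
  css.foldr (fun cs b => xor (cs.all G) b) false

theorem xorAll_congr {G H : ℕ → Bool} {css : List (List ℕ)}
    (h : ∀ cs ∈ css, ∀ c ∈ cs, G c = H c) : xorAll G css = xorAll H css := by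
  induction css with
  | nil => rfl
  | cons ds css ih =>
    have h2 : ds.all G = ds.all H := by
      rw [Bool.eq_iff_iff, List.all_eq_true, List.all_eq_true]
      exact forall₂_congr fun c hc => by rw [h ds (by simp) c hc]
    have h3 := ih fun cs hcs => h cs (by simp [hcs])
    unfold xorAll at h3 ⊢
    rw [List.foldr_cons, List.foldr_cons, h2, h3]

theorem execs_map_cx (css : List (List ℕ)) (t : ℕ) (h : ∀ cs ∈ css, ∀ c ∈ cs, c < t)
    (m : ℕ → Bool) :
    execs (css.map (cx · t)) m = Function.update m t (xor (m t) (xorAll m css)) := by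
  induction css generalizing m with
  | nil => simp [xorAll]
  | cons cs css ih =>
    have hx : exec (cx cs t) m = Function.update m t (xor (m t) (cs.all m)) := by
      have h1 : (∀ c ∈ cs, Function.update m t false c = true) ↔ cs.all m = true := by
        rw [List.all_eq_true]
        refine forall₂_congr fun c hc => ?_
        rw [Function.update_of_ne (h cs (by simp) c hc).ne]
      unfold exec cx
      simp only [h1]
      split_ifs with h2
      · simp [h2]
      · simp [h2]
    have hy : ∀ b, xorAll (Function.update m t b) css = xorAll m css := fun b =>
      xorAll_congr fun ds hds c hc => Function.update_of_ne (h ds (by simp [hds]) c hc).ne _ _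
    rw [List.map_cons, execs_cons, hx, ih (fun cs hcs => h cs (by simp [hcs])), hy]
    simp [xorAll]

/-- The only primitive of the reversible circuits: a fresh cell receives an exclusive or of
conjunctions of earlier cells. Since the controls lie below `t`, the equation still holds in the
final memory. -/
theorem Computes.assign (css : List (List ℕ)) (t : ℕ) (h : ∀ cs ∈ css, ∀ c ∈ cs, c < t) :
    Computes (css.map (cx · t)) t (t + 1) (fun G => G t = xorAll G css) := by
  refine ⟨by omega, fun g hg => ?_, fun m hm G hG => ?_⟩
  · obtain ⟨cs, hcs, rfl⟩ := List.mem_map.1 hg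
    exact ⟨rfl, le_rfl, Nat.lt_succ_self t, fun c hc => (h cs hcs c hc).trans (Nat.lt_succ_self t)⟩
  rw [execs_map_cx css t h] at hG
  have h1 : xorAll G css = xorAll m css := xorAll_congr fun ds hds c hc => by
    have hc' := h ds hds c hc
    rw [hG c (by omega), Function.update_of_ne hc'.ne]
  show G t = xorAll G css
  rw [h1, hG t (by omega)]
  simp [hm t le_rfl (by omega)]

/-! ### Binary numbers -/

/-- The number with binary digits `b 0, …, b (w-1)`, least significant digit first. -/
def ofDigits (b : ℕ → Bool) : ℕ → ℕ
  | 0 => 0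
  | w + 1 => ofDigits b w + (b w).toNat * 2 ^ w

theorem ofDigits_lt (b : ℕ → Bool) (w : ℕ) : ofDigits b w < 2 ^ w := by
  induction w with
  | zero => simp [ofDigits]
  | succ w ih => rw [ofDigits, pow_succ]; cases b w <;> simp <;> omega

theorem ofDigits_testBit (n w : ℕ) : ofDigits n.testBit w = n % 2 ^ w := by
  induction w with
  | zero => simp [ofDigits, Nat.mod_one]
  | succ w ih => rw [ofDigits, ih, Nat.mod_pow_succ, Nat.toNat_testBit]; ring

theorem ofDigits_congr {b c : ℕ → Bool} {w : ℕ} (h : ∀ q < w, b q = c q) :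
    ofDigits b w = ofDigits c w := by
  induction w with
  | zero => rfl
  | succ w ih => rw [ofDigits, ofDigits, ih fun q hq => h q (by omega), h w (by omega)]

theorem testBit_ofDigits (b : ℕ → Bool) {w q : ℕ} (h : q < w) :
    (ofDigits b w).testBit q = b q := by
  induction w with
  | zero => omega
  | succ w ih =>
    rw [ofDigits]
    rcases Nat.lt_succ_iff_lt_or_eq.1 h with h1 | rfl
    · rw [← ih h1, mul_comm, add_comm, Nat.testBit_two_pow_mul_add _ (ofDigits_lt b w), if_pos h1]
    · rw [mul_comm, add_comm, Nat.testBit_two_pow_mul_add _ (ofDigits_lt b q),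
        if_neg (lt_irrefl _), Nat.sub_self]
      cases b q <;> rfl

theorem forall_eq_testBit_iff {b : ℕ → Bool} {w p : ℕ} (hp : p < 2 ^ w) :
    (∀ q < w, b q = p.testBit q) ↔ ofDigits b w = p := by
  constructor
  · intro h
    rw [ofDigits_congr h, ofDigits_testBit, Nat.mod_eq_of_lt hp]
  · rintro rfl q hq
    exact (testBit_ofDigits b hq).symm

/-- The cells `c 1, …, c w` tell if the digits agree with those of `p` so far. -/
theorem chain_eq {b c : ℕ → Bool} {w p : ℕ} (h : ∀ q < w, c (q + 1) = (c q && b q == p.testBit q)) :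
    ∀ q ≤ w, c q = (c 0 && decide (∀ r < q, b r = p.testBit r)) := by
  intro q
  induction q with
  | zero => simp
  | succ q ih =>
    intro hq
    rw [h q hq, ih (by omega), Bool.eq_iff_iff]
    simp only [Bool.and_eq_true, decide_eq_true_eq, beq_iff_eq, and_assoc, and_congr_right_iff]
    intro _
    constructor
    · rintro ⟨h1, h2⟩ r hr
      rcases Nat.lt_succ_iff_lt_or_eq.1 hr with h3 | rfl
      exacts [h1 r h3, h2]
    · exact fun h1 => ⟨fun r hr => h1 r (by omega), h1 q (by omega)⟩

theorem chain_end {b c : ℕ → Bool} {w p : ℕ} (hp : p < 2 ^ w)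
    (h : ∀ q < w, c (q + 1) = (c q && b q == p.testBit q)) :
    c w = (c 0 && decide (ofDigits b w = p)) := by
  rw [chain_eq h w le_rfl]
  simp only [forall_eq_testBit_iff hp]

theorem increment_digits {b c : ℕ → Bool} {w : ℕ} (h : ∀ q < w, c (q + 1) = (c q && b q)) :
    ofDigits (fun q => xor (b q) (c q)) w + (c w).toNat * 2 ^ w
      = ofDigits b w + (c 0).toNat := by
  induction w with
  | zero => simp [ofDigits]
  | succ w ih =>
    have h1 := ih fun q hq => h q (by omega)
    simp only [ofDigits, h w (by omega), pow_succ]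
    generalize ofDigits (fun q => xor (b q) (c q)) w = A at *
    cases b w <;> cases hc : c w <;> rw [hc] at h1 <;> simp at h1 ⊢ <;> omega

theorem decrement_digits {b c : ℕ → Bool} {w : ℕ} (h : ∀ q < w, c (q + 1) = (c q && !b q)) :
    ofDigits (fun q => xor (b q) (c q)) w + (c 0).toNat
      = ofDigits b w + (c w).toNat * 2 ^ w := by
  induction w with
  | zero => simp [ofDigits]
  | succ w ih =>
    have h1 := ih fun q hq => h q (by omega)
    simp only [ofDigits, h w (by omega), pow_succ]
    generalize ofDigits (fun q => xor (b q) (c q)) w = A at *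
    cases b w <;> cases hc : c w <;> rw [hc] at h1 <;> simp at h1 ⊢ <;> omega

/-- From low to high, `c q` compares the numbers formed by the lower `q` digits: a differing higher
digit overrules the comparison so far, an equal one keeps it. -/
theorem compare_digits {b c : ℕ → Bool} {w p : ℕ} (hp : p < 2 ^ w) (h0 : c 0 = false)
    (h : ∀ q < w, c (q + 1) = if p.testBit q then b q && c q else b q || c q) :
    c w = decide (p < ofDigits b w) := by
  have key : ∀ q ≤ w, c q = decide (ofDigits p.testBit q < ofDigits b q) := by
    intro q
    induction q with
    | zero => simp [ofDigits, h0]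
    | succ q ih =>
      intro hq
      rw [h q hq, ih (by omega), ofDigits, ofDigits]
      have h1 := ofDigits_lt p.testBit q
      have h2 := ofDigits_lt b q
      cases p.testBit q <;> cases b q <;> simp <;> omega
  rw [key w le_rfl, ofDigits_testBit, Nat.mod_eq_of_lt hp]

/-- Adding `s` modulo `n`: carries `c`, wrap-around test `e`. -/
theorem succ_mod_digits {b c e z : ℕ → Bool} {w n : ℕ} (hn : n < 2 ^ w) (hb : ofDigits b w < n)
    (hc : ∀ q < w, c (q + 1) = (c q && b q == (2 ^ w - 1).testBit q)) (he0 : e 0 = c 0)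
    (he : ∀ q < w, e (q + 1) = (e q && b q == (n - 1).testBit q))
    (hz : ∀ q < w, z q = xor (xor (b q) (c q)) (e w && n.testBit q)) :
    ofDigits z w = (ofDigits b w + (c 0).toNat) % n := by
  have h1 : ∀ q < w, c (q + 1) = (c q && b q) := by
    intro q hq
    rw [hc q hq, Nat.testBit_two_pow_sub_one]
    simp [hq]
  have h2 := increment_digits h1
  have h3 := chain_end (by omega) he
  rw [he0] at h3
  -- No carry leaves the top digit, because `ofDigits b w + 1 ≤ n < 2 ^ w`.
  have h5 : c w = false := by
    have := Bool.toNat_le (c 0)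
    by_contra h6
    simp only [Bool.not_eq_false] at h6
    rw [h6] at h2
    simp at h2
    omega
  rw [h5] at h2
  simp only [Bool.toNat_false, zero_mul, add_zero] at h2
  by_cases h4 : e w = true
  · rw [h4] at h3
    simp only [Bool.true_eq, Bool.and_eq_true, decide_eq_true_eq] at h3
    rw [h3.1] at h2 ⊢
    have h6 : ofDigits b w + true.toNat = n := by simp; omega
    rw [h6, Nat.mod_self]
    rw [h6] at h2
    -- At the wrap-around the incremented digits are those of `n`, so the exclusive or with the
    -- digits of `n` yields zero.
    have h7 := (forall_eq_testBit_iff hn).2 h2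
    rw [ofDigits_congr (c := (0 : ℕ).testBit), ofDigits_testBit, Nat.zero_mod]
    intro q hq
    rw [hz q hq, h7 q hq, h4]
    simp
  · simp only [Bool.not_eq_true] at h4
    rw [ofDigits_congr (c := fun q => xor (b q) (c q)), h2, Nat.mod_eq_of_lt]
    · rw [h4] at h3
      cases h6 : c 0
      · simpa using hb
      · rw [h6] at h3
        simp at h3 ⊢
        omega
    · intro q hq
      rw [hz q hq, h4]
      simp

/-- Subtracting `s` modulo `n`: borrows `c`, wrap-around test `e`. -/
theorem pred_mod_digits {b c e z : ℕ → Bool} {w n : ℕ} (hn : n < 2 ^ w) (hb : ofDigits b w < n)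
    (hc : ∀ q < w, c (q + 1) = (c q && b q == (0 : ℕ).testBit q)) (he0 : e 0 = c 0)
    (he : ∀ q < w, e (q + 1) = (e q && b q == (0 : ℕ).testBit q))
    (hz : ∀ q < w, z q = xor (xor (b q) (c q)) (e w && (2 ^ w - n).testBit q)) :
    ofDigits z w = (ofDigits b w + (n - 1) * (c 0).toNat) % n := by
  have h1 : ∀ q < w, c (q + 1) = (c q && !b q) := by
    intro q hq
    rw [hc q hq, Nat.zero_testBit]
    simp
  have h2 := decrement_digits h1
  have h3 := chain_end (Nat.two_pow_pos w) he
  have h3' := chain_end (Nat.two_pow_pos w) hc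
  rw [he0, ← h3'] at h3
  rw [h3] at hz
  by_cases h4 : c w = true
  · rw [h4] at h3' h2
    simp only [Bool.true_eq, Bool.and_eq_true, decide_eq_true_eq] at h3'
    rw [h3'.1, h3'.2] at h2 ⊢
    simp only [Bool.toNat_true, zero_add, one_mul, mul_one] at h2 ⊢
    -- When the borrow leaves the top digit, the decrement of `0` has produced only ones.
    have h6 : ofDigits (fun q => xor (b q) (c q)) w = 2 ^ w - 1 := by omega
    have h7 := (forall_eq_testBit_iff (by omega)).2 h6
    rw [Nat.mod_eq_of_lt (by omega), ← forall_eq_testBit_iff (by omega)]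
    intro q hq
    -- The digits of `2 ^ w - n` are the complement of those of `n - 1`, so the exclusive or with
    -- all ones yields `n - 1`.
    have h8 : 2 ^ w - n = 2 ^ w - ((n - 1) + 1) := by omega
    rw [hz q hq, h7 q hq, h4, Nat.testBit_two_pow_sub_one, h8,
      Nat.testBit_two_pow_sub_succ (by omega)]
    simp [hq]
  · simp only [Bool.not_eq_true] at h4
    rw [ofDigits_congr (c := fun q => xor (b q) (c q))]
    · rw [h4] at h2 h3'
      cases h6 : c 0
      · rw [h6] at h2
        simp at h2 ⊢
        rw [h2, Nat.mod_eq_of_lt hb]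
      · rw [h6] at h3' h2
        simp at h3' h2 ⊢
        have : ofDigits b w + (n - 1) = (ofDigits b w - 1) + n := by omega
        rw [this, Nat.add_mod_right, Nat.mod_eq_of_lt (by omega)]
        omega
    · intro q hq
      rw [hz q hq, h4]
      simp

/-! ### The reversible circuit for the walk and the membership test -/

/-- Cells `dst+1, …, dst+len` receive the conjunctions of `dst` with the tests that the bits
`src 0, src 1, …` agree with the binary digits of `pat`. -/
def chainL (len : ℕ) (src : ℕ → ℕ) (dst pat : ℕ) : List (Gate ℕ) :=
  (List.range len).flatMap fun q =>
    cx [dst + q, src q] (dst + q + 1) ::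
      (if pat / 2 ^ q % 2 ≠ 0 then [] else [cx [dst + q] (dst + q + 1)])

/-- Cells `dst+1, …, dst+len` receive the comparisons of the lower digits at `src` with those
of `p`. -/
def compareL (len : ℕ) (src : ℕ → ℕ) (dst p : ℕ) : List (Gate ℕ) :=
  (List.range len).flatMap fun q =>
    cx [src q, dst + q] (dst + q + 1) ::
      (if p / 2 ^ q % 2 ≠ 0 then [] else
        [cx [src q] (dst + q + 1), cx [dst + q] (dst + q + 1)])

/-- Cells `dst, …, dst+len-1` receive the exclusive or of the bits `src q`, `b+q` and, if digit `q`
of `Y` is one, `e`. -/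
def sumL (len : ℕ) (src : ℕ → ℕ) (b e dst Y : ℕ) : List (Gate ℕ) :=
  (List.range len).flatMap fun q =>
    cx [src q] (dst + q) :: cx [b + q] (dst + q) ::
      (if Y / 2 ^ q % 2 ≠ 0 then [cx [e] (dst + q)] else [])

/-- A move by one modulo `n`, if the cell `base` is set; see `succ_mod_digits`,
`pred_mod_digits`. -/
def moveL (w : ℕ) (src : ℕ → ℕ) (base pC pE Y : ℕ) : List (Gate ℕ) :=
  chainL w src base pC ++ ([cx [base] (base + w + 1)] ++ (chainL w src (base + w + 1) pE ++
    sumL w src base (base + w + 1 + w) (base + w + 1 + w + 1) Y))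

theorem testBit_iff_div_mod (p q : ℕ) : p / 2 ^ q % 2 ≠ 0 ↔ p.testBit q = true := by
  rw [Nat.testBit_eq_decide_div_mod_eq, decide_eq_true_eq]; omega

theorem computes_chainL {len : ℕ} {src : ℕ → ℕ} {dst : ℕ} (pat : ℕ)
    (h : ∀ q < len, src q < dst + 1) :
    Computes (chainL len src dst pat) (dst + 1) (dst + 1 + len)
      (fun G => ∀ q < len, G (dst + (q + 1)) = (G (dst + q) && G (src q) == pat.testBit q)) := by
  have key := Computes.flatMap (lo := dst + 1) (B := 1) (n := len) (f := fun q =>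
    cx [dst + q, src q] (dst + q + 1) ::
      (if pat / 2 ^ q % 2 ≠ 0 then [] else [cx [dst + q] (dst + q + 1)]))
    (φ := fun q G => G (dst + (q + 1)) = (G (dst + q) && G (src q) == pat.testBit q)) ?_
  · rw [mul_one] at key
    exact key
  · intro q hq
    have hs := h q hq
    rw [mul_one, mul_one, show dst + 1 + q = dst + q + 1 by ring,
      show dst + 1 + (q + 1) = dst + q + 1 + 1 by ring]
    by_cases hb : pat / 2 ^ q % 2 ≠ 0
    · rw [if_pos hb]
      refine (Computes.assign [[dst + q, src q]] _ ?_).mono fun G hG => ?_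
      · simp; omega
      · rw [← add_assoc, hG, (testBit_iff_div_mod _ _).1 hb]
        simp [xorAll]
    · rw [if_neg hb]
      refine (Computes.assign [[dst + q, src q], [dst + q]] _ ?_).mono fun G hG => ?_
      · simp; omega
      · rw [testBit_iff_div_mod, Bool.not_eq_true] at hb
        rw [← add_assoc, hG, hb]
        simp [xorAll]
        cases G (dst + q) <;> cases G (src q) <;> rfl

theorem computes_compareL {len : ℕ} {src : ℕ → ℕ} {dst : ℕ} (p : ℕ)
    (h : ∀ q < len, src q < dst) :
    Computes (compareL len src dst p) dst (dst + 1 + len)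
      (fun G => G dst = false ∧ ∀ q < len, G (dst + (q + 1)) =
        if p.testBit q then G (src q) && G (dst + q) else G (src q) || G (dst + q)) := by
  have key := Computes.flatMap (lo := dst + 1) (B := 1) (n := len) (f := fun q =>
    cx [src q, dst + q] (dst + q + 1) ::
      (if p / 2 ^ q % 2 ≠ 0 then [] else
        [cx [src q] (dst + q + 1), cx [dst + q] (dst + q + 1)]))
    (φ := fun q G => G (dst + (q + 1)) =
        if p.testBit q then G (src q) && G (dst + q) else G (src q) || G (dst + q)) ?_
  · rw [mul_one] at key
    have h0 := (Computes.nil (show dst ≤ dst + 1 by omega)).append key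
    exact h0.mono fun G hG => ⟨hG.1 dst le_rfl (by omega), hG.2⟩
  · intro q hq
    have hs := h q hq
    rw [mul_one, mul_one, show dst + 1 + q = dst + q + 1 by ring,
      show dst + 1 + (q + 1) = dst + q + 1 + 1 by ring]
    by_cases hb : p / 2 ^ q % 2 ≠ 0
    · rw [if_pos hb]
      refine (Computes.assign [[src q, dst + q]] _ ?_).mono fun G hG => ?_
      · simp; omega
      · rw [← add_assoc, hG, (testBit_iff_div_mod _ _).1 hb]
        simp [xorAll]
    · rw [if_neg hb]
      refine (Computes.assign [[src q, dst + q], [src q], [dst + q]] _ ?_).mono fun G hG => ?_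
      · simp; omega
      · rw [testBit_iff_div_mod, Bool.not_eq_true] at hb
        rw [← add_assoc, hG, hb]
        simp [xorAll]
        cases G (dst + q) <;> cases G (src q) <;> rfl

theorem computes_sumL {len : ℕ} {src : ℕ → ℕ} {b e dst : ℕ} (Y : ℕ)
    (h : ∀ q < len, src q < dst) (hb : b + len ≤ dst) (he : e < dst) :
    Computes (sumL len src b e dst Y) dst (dst + len)
      (fun G => ∀ q < len, G (dst + q) = xor (xor (G (src q)) (G (b + q)))
        (G e && Y.testBit q)) := by
  have key := Computes.flatMap (lo := dst) (B := 1) (n := len) (f := fun q =>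
    cx [src q] (dst + q) :: cx [b + q] (dst + q) ::
      (if Y / 2 ^ q % 2 ≠ 0 then [cx [e] (dst + q)] else []))
    (φ := fun q G => G (dst + q) = xor (xor (G (src q)) (G (b + q)))
        (G e && Y.testBit q)) ?_
  · rw [mul_one] at key
    exact key
  · intro q hq
    have hs := h q hq
    rw [mul_one, mul_one, ← add_assoc]
    by_cases hY : Y / 2 ^ q % 2 ≠ 0
    · rw [if_pos hY]
      refine (Computes.assign [[src q], [b + q], [e]] _ ?_).mono fun G hG => ?_
      · simp; omega
      · rw [hG, (testBit_iff_div_mod _ _).1 hY]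
        simp [xorAll]
    · rw [if_neg hY]
      refine (Computes.assign [[src q], [b + q]] _ ?_).mono fun G hG => ?_
      · simp; omega
      · rw [testBit_iff_div_mod, Bool.not_eq_true] at hY
        rw [hG, hY]
        simp [xorAll]

theorem computes_moveL {w : ℕ} {src : ℕ → ℕ} {base : ℕ} (pC pE Y : ℕ)
    (h : ∀ q < w, src q < base) :
    Computes (moveL w src base pC pE Y) (base + 1) (base + (3 * w + 2)) (fun G =>
      (∀ q < w, G (base + (q + 1)) = (G (base + q) && G (src q) == pC.testBit q)) ∧
      G (base + w + 1) = G base ∧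
      (∀ q < w, G (base + w + 1 + (q + 1)) =
        (G (base + w + 1 + q) && G (src q) == pE.testBit q)) ∧
      (∀ q < w, G (base + w + 1 + w + 1 + q) = xor (xor (G (src q)) (G (base + q)))
        (G (base + w + 1 + w) && Y.testBit q))) := by
  have h1 := computes_chainL (len := w) (src := src) (dst := base) pC
    fun q hq => (h q hq).trans (by omega)
  have h2 := Computes.assign [[base]] (base + w + 1) (by simp)
  have h3 := computes_chainL (len := w) (src := src) (dst := base + w + 1) pE
    fun q hq => (h q hq).trans (by omega)
  have h4 := computes_sumL (len := w) (src := src) (b := base) (e := base + w + 1 + w)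
    (dst := base + w + 1 + w + 1) Y (fun q hq => (h q hq).trans (by omega)) (by omega) (by omega)
  rw [show base + 1 + w = base + w + 1 by ring] at h1
  rw [show base + w + 1 + 1 + w = base + w + 1 + w + 1 by ring] at h3
  have h5 := h1.append (h2.append (h3.append h4))
  rw [show base + w + 1 + w + 1 + w = base + (3 * w + 2) by ring] at h5
  refine h5.mono fun G hG => ⟨hG.1, ?_, hG.2.2.1, hG.2.2.2⟩
  have := hG.2.1
  simpa [xorAll] using this

/-- The bits that select a move: coin `μ` continues the search for a move, and the first coin
that does not, makes the choice. -/
def sel (d : ℕ) (G : ℕ → Bool) (μ : ℕ) : Bool :=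
  xor (if μ % (2 * d) = 0 then true else G (μ - 1)) (G μ)

/-- The number of random bits: the coins and the code of the starting point. -/
def numRandom (d i w : ℕ) : ℕ := 2 * d * i + d * w

/-- The first cell of block `b`. -/
def blockBase (d i w b : ℕ) : ℕ := numRandom d i w + b * (6 * w + 4)

/-- The cell of digit `q` of the output of block `b`. -/
def blockOut (d i w b q : ℕ) : ℕ := blockBase d i w b + (5 * w + 4) + q

/-- Copies of the coordinates of the starting point. -/
def initL (d i w : ℕ) : List (Gate ℕ) :=
  (List.range d).flatMap fun b => (List.range w).flatMap fun q =>
    [cx [2 * d * i + b * w + (w - 1 - q)] (blockOut d i w b q)]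

/-- The two moves in one coordinate direction. -/
def stepL (d n i w β : ℕ) : List (Gate ℕ) :=
  ((if β % d ≠ 0 then [cx [2 * β - 1] (blockBase d i w (β + d))]
    else [cx [] (blockBase d i w (β + d))]) ++ [cx [2 * β] (blockBase d i w (β + d))]) ++
  (moveL w (blockOut d i w β) (blockBase d i w (β + d)) (2 ^ w - 1) (n - 1) n ++
  ([cx [2 * β] (blockBase d i w (β + d) + (3 * w + 2)),
    cx [2 * β + 1] (blockBase d i w (β + d) + (3 * w + 2))] ++
  moveL w (fun q => blockBase d i w (β + d) + w + 1 + w + 1 + q)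
    (blockBase d i w (β + d) + (3 * w + 2)) 0 0 (2 ^ w - n)))

/-- The cell that tells if the first `j` coordinates pass the membership test. -/
def flagCell (d i w j : ℕ) : ℕ := blockBase d i w (d + d * i) + j * (2 * w + 3)

/-- The membership test. -/
def flagL (d i w : ℕ) (a b : ℕ → ℕ) : List (Gate ℕ) :=
  [cx [] (flagCell d i w 0)] ++ (List.range d).flatMap fun j =>
    compareL w (blockOut d i w (d * i + j)) (flagCell d i w j + 1) (a j) ++
    (compareL w (blockOut d i w (d * i + j)) (flagCell d i w j + (w + 2)) (b j) ++
    [cx [flagCell d i w j, flagCell d i w j + 1 + w] (flagCell d i w (j + 1)),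
     cx [flagCell d i w j, flagCell d i w j + (w + 2) + w] (flagCell d i w (j + 1))])

/-- The circuit for the walk and the membership test. -/
def walkL (d n i w : ℕ) (a b : ℕ → ℕ) : List (Gate ℕ) :=
  initL d i w ++ ((List.range (d * i)).flatMap (stepL d n i w) ++ flagL d i w a b)

theorem computes_initL (d i w : ℕ) :
    Computes (initL d i w) (blockBase d i w 0) (blockBase d i w d) (fun G =>
      ∀ b < d, ∀ q < w, G (blockOut d i w b q) = G (2 * d * i + b * w + (w - 1 - q))) := by
  have h1 : blockBase d i w d = blockBase d i w 0 + d * (6 * w + 4) := by simp [blockBase]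
  rw [h1]
  refine Computes.flatMap fun b hb => ?_
  have h2 : blockBase d i w 0 + b * (6 * w + 4) = blockBase d i w b := by simp [blockBase]
  have h3 : blockBase d i w 0 + (b + 1) * (6 * w + 4) = blockBase d i w b + (5 * w + 4) + w := by
    simp [blockBase]; ring
  rw [h2, h3]
  have h4 := (Computes.nil (show blockBase d i w b ≤ blockBase d i w b + (5 * w + 4) by omega)).append
    (Computes.flatMap (lo := blockBase d i w b + (5 * w + 4)) (B := 1) (n := w)
      (f := fun q => [cx [2 * d * i + b * w + (w - 1 - q)] (blockOut d i w b q)])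
      (φ := fun q G => G (blockOut d i w b q) = G (2 * d * i + b * w + (w - 1 - q))) ?_)
  · rw [mul_one] at h4
    exact h4.mono fun G hG => hG.2
  · intro q hq
    rw [mul_one, mul_one, ← add_assoc]
    refine (Computes.assign [[2 * d * i + b * w + (w - 1 - q)]] _ ?_).mono fun G hG => ?_
    · simp only [List.mem_singleton, forall_eq]
      have : b * w + w ≤ d * w := by nlinarith
      unfold blockOut blockBase numRandom
      omega
    · show G (blockOut d i w b q) = _
      rw [hG]
      simp [xorAll]

theorem blockOut_lt {d i w b c q : ℕ} (h : b < c) (hq : q < w) :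
    blockOut d i w b q < blockBase d i w c := by
  unfold blockOut blockBase
  have : (b + 1) * (6 * w + 4) ≤ c * (6 * w + 4) := Nat.mul_le_mul_right _ h
  have h2 : (b + 1) * (6 * w + 4) = b * (6 * w + 4) + (6 * w + 4) := by ring
  omega

theorem coin_lt_blockBase {d i w β c : ℕ} (h : β < d * i) : 2 * β + 1 < blockBase d i w c := by
  unfold blockBase numRandom
  have : 2 * d * i = 2 * (d * i) := by ring
  omega

/-- Block `β + d` treats the same coordinate as block `β`, one time step later. Its first half adds
the bit `sel d G (2 * β)` modulo `n`, its second half subtracts the bit `sel d G (2 * β + 1)`. -/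
theorem computes_stepL {d n i w β : ℕ} (hβ : β < d * i) (hn0 : 0 < n) (hn : n < 2 ^ w) :
    Computes (stepL d n i w β) (blockBase d i w (β + d)) (blockBase d i w (β + 1 + d)) (fun G =>
      ofDigits (fun q => G (blockOut d i w β q)) w < n →
      ofDigits (fun q => G (blockOut d i w (β + d) q)) w =
        ((ofDigits (fun q => G (blockOut d i w β q)) w + (sel d G (2 * β)).toNat) % n
          + (n - 1) * (sel d G (2 * β + 1)).toNat) % n) := by
  have hd : 0 < d := by
    rcases Nat.eq_zero_or_pos d with rfl | h
    · simp at hβ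
    · exact h
  have hcoin := coin_lt_blockBase (w := w) (c := β + d) hβ
  have hout : ∀ q < w, blockOut d i w β q < blockBase d i w (β + d) := fun q hq =>
    blockOut_lt (by omega) hq
  set B := blockBase d i w (β + d) with hB
  have hB' : blockBase d i w (β + 1 + d) = B + (3 * w + 2) + (3 * w + 2) := by
    rw [hB]; unfold blockBase; ring
  have hO : ∀ q, blockOut d i w (β + d) q = B + (3 * w + 2) + w + 1 + w + 1 + q := by
    intro q; unfold blockOut; rw [← hB]; ring
  have hm1 : (2 * β) % (2 * d) = 2 * (β % d) := Nat.mul_mod_mul_left _ _ _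
  -- A coin with odd number is never the first of its time step, so its selection bit always
  -- involves the preceding coin.
  have hm2 : (2 * β + 1) % (2 * d) ≠ 0 := by
    intro h
    have := Nat.dvd_of_mod_eq_zero h
    have h2 : 2 ∣ 2 * β + 1 := (Dvd.intro _ rfl).trans this
    omega
  have h1 : Computes ((if β % d ≠ 0 then [cx [2 * β - 1] B] else [cx [] B]) ++ [cx [2 * β] B])
      B (B + 1) (fun G => G B = sel d G (2 * β)) := by
    by_cases hj : β % d ≠ 0
    · rw [if_pos hj]
      refine (Computes.assign [[2 * β - 1], [2 * β]] B ?_).mono fun G hG => ?_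
      · simp; omega
      · rw [hG]; simp [xorAll, sel, hm1, hj]
    · rw [if_neg hj]
      refine (Computes.assign [[], [2 * β]] B ?_).mono fun G hG => ?_
      · simp; omega
      · rw [hG]; push Not at hj; simp [xorAll, sel, hm1, hj]
  have h2 := computes_moveL (2 ^ w - 1) (n - 1) n hout
  have h3 := Computes.assign [[2 * β], [2 * β + 1]] (B + (3 * w + 2)) (by simp; omega)
  have h4 := computes_moveL (w := w) (src := fun q => B + w + 1 + w + 1 + q)
    (base := B + (3 * w + 2)) 0 0 (2 ^ w - n) (fun q hq => by omega)
  have h5 := h1.append (h2.append (h3.append h4))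
  rw [← hB'] at h5
  refine h5.mono fun G hG hlt => ?_
  obtain ⟨g1, ⟨g2, g3, g4, g5⟩, g6, g7, g8, g9, g10⟩ := hG
  have e1 := succ_mod_digits (b := fun q => G (blockOut d i w β q)) (c := fun q => G (B + q))
    (e := fun q => G (B + w + 1 + q)) (z := fun q => G (B + w + 1 + w + 1 + q))
    hn hlt g2 g3 g4 g5
  have hlt2 : ofDigits (fun q => G (B + w + 1 + w + 1 + q)) w < n := by
    rw [e1]; exact Nat.mod_lt _ hn0
  have e2 := pred_mod_digits (b := fun q => G (B + w + 1 + w + 1 + q))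
    (c := fun q => G (B + (3 * w + 2) + q)) (e := fun q => G (B + (3 * w + 2) + w + 1 + q))
    (z := fun q => G (B + (3 * w + 2) + w + 1 + w + 1 + q)) hn hlt2 g7 g8 g9 g10
  have g6' : G (B + (3 * w + 2)) = sel d G (2 * β + 1) := by
    have := g6
    simp only [xorAll, List.foldr_cons, List.foldr_nil, List.all_cons, List.all_nil,
      Bool.and_true, Bool.xor_false] at this
    rw [this, sel, if_neg hm2]
    simp
  simp only [hO]
  rw [e2, e1]
  simp only [add_zero]
  rw [g6', g1]

/-- As `a j ≤ b j`, the test `b j < v` implies `a j < v`. Hence the exclusive or of the two tests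
means `a j < v ≤ b j`, and two flips controlled by the previous flag suffice for each coordinate. -/
theorem computes_flagL (d i w : ℕ) (a b : ℕ → ℕ) (ha : ∀ j < d, a j < 2 ^ w)
    (hb : ∀ j < d, b j < 2 ^ w) (hab : ∀ j < d, a j ≤ b j) :
    Computes (flagL d i w a b) (flagCell d i w 0) (flagCell d i w d + 1) (fun G =>
      (G (flagCell d i w d) = true ↔ ∀ j < d,
        a j < ofDigits (fun q => G (blockOut d i w (d * i + j) q)) w ∧
        ofDigits (fun q => G (blockOut d i w (d * i + j) q)) w ≤ b j)) := by
  have h1 := Computes.assign [[]] (flagCell d i w 0) (by simp)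
  have h2 := Computes.flatMap (lo := flagCell d i w 0 + 1) (B := 2 * w + 3) (n := d) (f := fun j =>
      compareL w (blockOut d i w (d * i + j)) (flagCell d i w j + 1) (a j) ++
      (compareL w (blockOut d i w (d * i + j)) (flagCell d i w j + (w + 2)) (b j) ++
      [cx [flagCell d i w j, flagCell d i w j + 1 + w] (flagCell d i w (j + 1)),
       cx [flagCell d i w j, flagCell d i w j + (w + 2) + w] (flagCell d i w (j + 1))]))
    (φ := fun j G => G (flagCell d i w (j + 1)) = (G (flagCell d i w j) &&
      decide (a j < ofDigits (fun q => G (blockOut d i w (d * i + j) q)) w ∧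
        ofDigits (fun q => G (blockOut d i w (d * i + j) q)) w ≤ b j))) ?_
  · have h3 := h1.append h2
    rw [show flagCell d i w 0 + 1 + d * (2 * w + 3) = flagCell d i w d + 1 by
      unfold flagCell; ring] at h3
    refine h3.mono fun G hG => ?_
    obtain ⟨g1, g2⟩ := hG
    have g1' : G (flagCell d i w 0) = true := by rw [g1]; simp [xorAll]
    have key : ∀ k ≤ d, (G (flagCell d i w k) = true ↔ ∀ j < k,
        a j < ofDigits (fun q => G (blockOut d i w (d * i + j) q)) w ∧
        ofDigits (fun q => G (blockOut d i w (d * i + j) q)) w ≤ b j) := by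
      intro k
      induction k with
      | zero => simp [g1']
      | succ k ih =>
        intro hk
        rw [g2 k (by omega), Bool.and_eq_true, ih (by omega), decide_eq_true_eq]
        constructor
        · rintro ⟨h4, h5⟩ j hj
          rcases Nat.lt_succ_iff_lt_or_eq.1 hj with h6 | rfl
          exacts [h4 j h6, h5]
        · exact fun h4 => ⟨fun j hj => h4 j (by omega), h4 k (by omega)⟩
    exact key d le_rfl
  · intro j hj
    have hs : ∀ q < w, blockOut d i w (d * i + j) q < flagCell d i w j := fun q hq => by
      refine (blockOut_lt (c := d + d * i) (by omega) hq).trans_le ?_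
      unfold flagCell
      omega
    have e1 : flagCell d i w 0 + 1 + j * (2 * w + 3) = flagCell d i w j + 1 := by
      unfold flagCell; ring
    have e2 : flagCell d i w 0 + 1 + (j + 1) * (2 * w + 3) = flagCell d i w (j + 1) + 1 := by
      unfold flagCell; ring
    have e3 : flagCell d i w j + (w + 2) + 1 + w = flagCell d i w (j + 1) := by
      unfold flagCell; ring
    rw [e1, e2]
    have g1 := computes_compareL (len := w) (dst := flagCell d i w j + 1) (a j)
      (src := blockOut d i w (d * i + j)) fun q hq => by have := hs q hq; omega
    have g2 := computes_compareL (len := w) (dst := flagCell d i w j + (w + 2)) (b j)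
      (src := blockOut d i w (d * i + j)) fun q hq => by have := hs q hq; omega
    rw [show flagCell d i w j + 1 + 1 + w = flagCell d i w j + (w + 2) by ring] at g1
    rw [e3] at g2
    have g3 := Computes.assign [[flagCell d i w j, flagCell d i w j + 1 + w],
      [flagCell d i w j, flagCell d i w j + (w + 2) + w]] (flagCell d i w (j + 1))
      (by simp; omega)
    refine (g1.append (g2.append g3)).mono fun G hG => ?_
    obtain ⟨⟨k1, k2⟩, ⟨k3, k4⟩, k5⟩ := hG
    have c1 := compare_digits (b := fun q => G (blockOut d i w (d * i + j) q))
      (c := fun q => G (flagCell d i w j + 1 + q)) (ha j hj) k1 k2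
    have c2 := compare_digits (b := fun q => G (blockOut d i w (d * i + j) q))
      (c := fun q => G (flagCell d i w j + (w + 2) + q)) (hb j hj) k3 k4
    have hab' := hab j hj
    rw [k5]
    simp only [xorAll, List.foldr_cons, List.foldr_nil, List.all_cons, List.all_nil,
      Bool.and_true, Bool.xor_false]
    rw [c1, c2]
    cases G (flagCell d i w j)
    · simp
    · generalize ofDigits (fun q => G (blockOut d i w (d * i + j) q)) w = v
      by_cases h1 : a j < v <;> by_cases h2 : b j < v
      · simp [h1, h2]
      · simp [h1, h2, not_lt.1 h2]
      · omega
      · simp [h1, h2]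

/-- The position of the walk in direction `j` after `s` steps, modulo `n`, for the start `x`. -/
def walkPos (d n j : ℕ) (G : ℕ → Bool) (x : ℕ) : ℕ → ℕ
  | 0 => x
  | s + 1 => ((walkPos d n j G x s + (sel d G (2 * (s * d + j))).toNat) % n
          + (n - 1) * (sel d G (2 * (s * d + j) + 1)).toNat) % n

theorem walkPos_lt {d n j : ℕ} {G : ℕ → Bool} {x : ℕ} (hx : x < n) (s : ℕ) :
    walkPos d n j G x s < n := by
  cases s with
  | zero => exact hx
  | succ s => exact Nat.mod_lt _ (by omega)

/-- Coordinate `j` of the point whose code is stored. -/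
def codeVal (d i w : ℕ) (G : ℕ → Bool) (j : ℕ) : ℕ :=
  ofDigits (fun q => G (2 * d * i + j * w + (w - 1 - q))) w

theorem computes_walkL (d n i w : ℕ) (a b : ℕ → ℕ) (hn0 : 0 < n) (hn : n < 2 ^ w)
    (ha : ∀ j < d, a j < 2 ^ w) (hb : ∀ j < d, b j < 2 ^ w) (hab : ∀ j < d, a j ≤ b j) :
    Computes (walkL d n i w a b) (numRandom d i w) (flagCell d i w d + 1) (fun G =>
      (∀ j < d, codeVal d i w G j < n) → (G (flagCell d i w d) = true ↔ ∀ j < d,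
        a j < walkPos d n j G (codeVal d i w G j) i ∧
        walkPos d n j G (codeVal d i w G j) i ≤ b j)) := by
  have h1 := computes_initL d i w
  have h2 := Computes.flatMap (n := d * i) (lo := blockBase d i w d) (B := 6 * w + 4)
    (f := stepL d n i w) (φ := fun β G =>
      ofDigits (fun q => G (blockOut d i w β q)) w < n →
      ofDigits (fun q => G (blockOut d i w (β + d) q)) w =
        ((ofDigits (fun q => G (blockOut d i w β q)) w + (sel d G (2 * β)).toNat) % n
          + (n - 1) * (sel d G (2 * β + 1)).toNat) % n) (fun β hβ => by
    have := computes_stepL hβ hn0 hn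
    rw [show blockBase d i w (β + d) = blockBase d i w d + β * (6 * w + 4) by
      unfold blockBase; ring, show blockBase d i w (β + 1 + d) =
        blockBase d i w d + (β + 1) * (6 * w + 4) by unfold blockBase; ring] at this
    exact this)
  have h3 := computes_flagL d i w a b ha hb hab
  rw [show blockBase d i w d + d * i * (6 * w + 4) = flagCell d i w 0 by
    unfold flagCell blockBase; ring] at h2
  have h4 := h1.append (h2.append h3)
  rw [show blockBase d i w 0 = numRandom d i w by unfold blockBase; ring] at h4
  refine h4.mono fun G hG hx => ?_
  obtain ⟨g1, g2, g3⟩ := hG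
  -- Block `s * d + j` holds coordinate `j` of the walk after `s` steps. Staying below `n`, which
  -- `computes_stepL` requires, is part of the induction through `walkPos_lt`.
  have key : ∀ s ≤ i, ∀ j < d, ofDigits (fun q => G (blockOut d i w (s * d + j) q)) w
      = walkPos d n j G (codeVal d i w G j) s := by
    intro s
    induction s with
    | zero =>
      intro _ j hj
      rw [zero_mul, zero_add]
      exact ofDigits_congr fun q hq => g1 j hj q hq
    | succ s ih =>
      intro hs j hj
      have hlt : s * d + j < d * i := by
        have : (s + 1) * d ≤ i * d := Nat.mul_le_mul_right _ hs
        nlinarith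
      have h5 := ih (by omega) j hj
      have h6 := g2 (s * d + j) hlt (by rw [h5]; exact walkPos_lt (hx j hj) s)
      rw [show (s + 1) * d + j = s * d + j + d by ring, h6, h5]
      rfl
  rw [g3]
  refine forall₂_congr fun j hj => ?_
  rw [mul_comm d i, key i le_rfl j hj]

/-- The test that the first `R` bits vanish; the result is in cell `E + R`. -/
def zeroL (R E : ℕ) : List (Gate ℕ) := [cx [] E] ++ chainL R (fun q => q) E 0

theorem computes_zeroL {R E : ℕ} (h : R ≤ E) :
    Computes (zeroL R E) E (E + 1 + R) (fun G =>
      (G (E + R) = true ↔ ∀ q < R, G q = false)) := by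
  have h1 := Computes.assign [[]] E (by simp)
  have h2 := computes_chainL (len := R) (src := fun q => q) (dst := E) 0 fun q hq => by omega
  refine (h1.append h2).mono fun G hG => ?_
  have h3 := chain_eq (b := G) (c := fun q => G (E + q)) hG.2 R le_rfl
  have h4 : G E = true := by rw [hG.1]; simp [xorAll]
  simp only [add_zero, h4, Bool.true_and, Nat.zero_testBit] at h3
  rw [h3, decide_eq_true_eq]

/-! ### Quantum gates on amplitudes indexed by infinite memories -/

/-- The action of a gate on amplitudes indexed by infinite memories. -/
def act {d n : ℕ} (v : (Fin d → Fin n) → ℝ) (g : Gate ℕ) (Ψ : (ℕ → Bool) → ℂ) :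
    (ℕ → Bool) → ℂ := fun m =>
  if ∀ c ∈ g.ctrls, Function.update m g.tgt false c = true then
    ∑ o : Bool, g.op.matrix v (Function.update m g.tgt false) (m g.tgt) o *
      Ψ (Function.update m g.tgt o)
  else Ψ m

/-- The action of a list of gates, the head being performed first. -/
def acts {d n : ℕ} (v : (Fin d → Fin n) → ℝ) (gs : List (Gate ℕ)) (Ψ : (ℕ → Bool) → ℂ) :
    (ℕ → Bool) → ℂ := gs.foldl (fun Ψ g => act v g Ψ) Ψ

section
variable {d n : ℕ} (v : (Fin d → Fin n) → ℝ)

@[simp] theorem acts_nil (Ψ : (ℕ → Bool) → ℂ) : acts v [] Ψ = Ψ := rfl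

@[simp] theorem acts_cons (g : Gate ℕ) (gs : List (Gate ℕ)) (Ψ : (ℕ → Bool) → ℂ) :
    acts v (g :: gs) Ψ = acts v gs (act v g Ψ) := rfl

theorem acts_append (gs hs : List (Gate ℕ)) (Ψ : (ℕ → Bool) → ℂ) :
    acts v (gs ++ hs) Ψ = acts v hs (acts v gs Ψ) := by
  simp [acts, List.foldl_append]

theorem bit_update {N t : ℕ} (h : t < N) (s : Fin N → Bool) (b : Bool) :
    bit (Function.update s ⟨t, h⟩ b) = Function.update (bit s) t b := by
  funext a
  unfold bit
  by_cases ha : a = t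
  · subst ha; simp [h]
  · rw [Function.update_of_ne ha]
    split_ifs with h1
    · rw [Function.update_of_ne]
      simpa [Fin.ext_iff] using ha
    · rfl

/-- Amplitudes on infinite memories `ℕ → Bool` free the analysis of circuits from address bounds. If
all targets lie below `N`, the restriction along `bit` commutes with every gate. -/
theorem foldl_apply_eq_acts {N : ℕ} (gs : List (Gate ℕ)) (hgs : ∀ g ∈ gs, g.tgt < N)
    (ψ : (Fin N → Bool) → ℂ) (Ψ : (ℕ → Bool) → ℂ) (h : ∀ s, ψ s = Ψ (bit s))
    (s : Fin N → Bool) :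
    gs.foldl (fun ψ g => g.apply v ψ) ψ s = acts v gs Ψ (bit s) := by
  induction gs generalizing ψ Ψ with
  | nil => exact h s
  | cons g gs ih =>
    refine ih (fun g' hg' => hgs g' (by simp [hg'])) _ _ fun s => ?_
    have ht := hgs g (by simp)
    have hb : s ⟨g.tgt, ht⟩ = bit s g.tgt := by simp [bit, ht]
    simp only [Gate.apply, dif_pos ht, act, bit_update, h, hb]

theorem finalState_eq_acts {N : ℕ} (gs : List (Gate ℕ)) (hgs : ∀ g ∈ gs, g.tgt < N)
    (s : Fin N → Bool) :
    finalState v N gs s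
      = acts v gs (fun m => open Classical in if m = fun _ => false then 1 else 0) (bit s) := by
  refine foldl_apply_eq_acts v gs hgs _ _ (fun s => ?_) s
  have : s = (fun _ => false) ↔ bit s = fun _ => false := by
    constructor
    · rintro rfl
      funext a
      simp [bit]
    · intro h
      funext a
      have := congrFun h a
      simpa [bit] using this
  by_cases h : s = fun _ => false
  · rw [if_pos h, if_pos (this.1 h)]
  · rw [if_neg h, if_neg fun h' => h (this.2 h')]

theorem act_cx (g : Gate ℕ) (hg : g.op = .flip) (Ψ : (ℕ → Bool) → ℂ) (m : ℕ → Bool) :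
    act v g Ψ m = Ψ (exec g m) := by
  unfold act exec
  split_ifs with h
  · rw [Fintype.sum_bool, hg]
    cases m g.tgt <;> simp [Op.matrix]
  · rfl

/-- A flip moves basis states, so amplitudes are pulled back along its inverse; this accounts for
the reversed list. -/
theorem acts_flips (gs : List (Gate ℕ)) (hgs : ∀ g ∈ gs, g.op = .flip) (Ψ : (ℕ → Bool) → ℂ)
    (m : ℕ → Bool) : acts v gs Ψ m = Ψ (execs gs.reverse m) := by
  induction gs generalizing Ψ m with
  | nil => rfl
  | cons g gs ih =>
    rw [acts_cons, ih (fun g' hg' => hgs g' (by simp [hg'])), List.reverse_cons, execs_append,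
      act_cx v g (hgs g (by simp))]
    rfl

theorem act_phase_half (cs : List ℕ) (t : ℕ) (Ψ : (ℕ → Bool) → ℂ) (m : ℕ → Bool) :
    act v ⟨.phase 1 2, cs, t⟩ Ψ m
      = (if (∀ c ∈ cs, Function.update m t false c = true) ∧ m t = true then -1 else 1) * Ψ m := by
  unfold act
  have he : Complex.exp (2 * Real.pi * Complex.I * (((1 : ℕ) : ℂ) / (2 : ℕ))) = -1 := by
    rw [← Complex.exp_pi_mul_I]
    congr 1
    push_cast
    ring
  by_cases h : ∀ c ∈ cs, Function.update m t false c = true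
  · rw [if_pos h, Fintype.sum_bool]
    cases hm : m t
    · have e : Function.update m t false = m := by rw [← hm, Function.update_eq_self]
      simp [Op.matrix, e]
    · have e : Function.update m t true = m := by rw [← hm, Function.update_eq_self]
      rw [if_pos ⟨h, rfl⟩]
      simp only [Op.matrix, he, e]
      simp
  · rw [if_neg h]
    simp [h]

/-- Compute, flip the phase if the result is set, uncompute: only the sign survives. The conjugating
flips need no control, because they cancel when the phase gate is not triggered. -/
theorem acts_oracle (V : List (Gate ℕ)) (hV : ∀ g ∈ V, g.op = .flip) {c o : ℕ} (hco : c ≠ o)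
    (Ψ : (ℕ → Bool) → ℂ) (m : ℕ → Bool) :
    acts v (V ++ (⟨.phase 1 2, [c], o⟩ :: V.reverse)) Ψ m
      = (if execs V m c = true ∧ execs V m o = true then -1 else 1) * Ψ m := by
  rw [acts_append, acts_cons, acts_flips v V.reverse (by simpa using hV), List.reverse_reverse,
    act_phase_half, acts_flips v V hV, execs_reverse_execs]
  simp [Function.update_of_ne hco]

/-! ### Controlled reflections -/

/-- The operation on bit `t` by the matrix with rows `√(1-q), √q` and `√q, -√(1-q)`, controlled
by `c`. -/
def refl (t : ℕ) (c : (ℕ → Bool) → Bool) (q : (ℕ → Bool) → ℝ) (Ψ : (ℕ → Bool) → ℂ) :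
    (ℕ → Bool) → ℂ := fun m =>
  if c (Function.update m t false) then
    if m t then
      (√(q (Function.update m t false)) : ℝ) * Ψ (Function.update m t false)
        - (√(1 - q (Function.update m t false)) : ℝ) * Ψ (Function.update m t true)
    else (√(1 - q (Function.update m t false)) : ℝ) * Ψ (Function.update m t false)
        + (√(q (Function.update m t false)) : ℝ) * Ψ (Function.update m t true)
  else Ψ m

/-- A phase flip followed by a rotation. -/
def unitL (op : Op ℕ) (cs : List ℕ) (t : ℕ) : List (Gate ℕ) :=
  [⟨.phase 1 2, cs, t⟩, ⟨op, cs, t⟩]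

/-- The rotation is not symmetric, but its product with the preceding phase flip is symmetric and
orthogonal, hence an involution (`refl_refl`). No separate gates for inverses are needed. -/
theorem acts_unitL (op : Op ℕ) (ϑ : (ℕ → Bool) → ℝ) (h : ∀ β, op.matrix v β = rotMatrix (ϑ β))
    (cs : List ℕ) (t : ℕ) :
    acts v (unitL op cs t) = refl t (fun m => cs.all m) (fun m => max 0 (min 1 (ϑ m))) := by
  funext Ψ m
  simp only [unitL, acts_cons, acts_nil]
  have key := act_phase_half v cs t Ψ
  generalize act v ⟨.phase 1 2, cs, t⟩ Ψ = Φ at *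
  unfold act refl
  by_cases hc : (cs.all (Function.update m t false)) = true
  · have hc' := List.all_eq_true.1 hc
    rw [if_pos hc, if_pos hc']
    simp only [Fintype.sum_bool, key, h, Function.update_idem, Function.update_self]
    cases hm : m t
    · simp [rotMatrix]
      rw [if_pos hc']
      ring
    · simp [rotMatrix]
      rw [if_pos hc']
      ring
  · have hc' : ¬ ∀ c ∈ cs, Function.update m t false c = true := by
      rwa [List.all_eq_true] at hc
    rw [if_neg hc, if_neg hc', key]
    rw [if_neg fun h => hc' h.1, one_mul]

end

section
variable {t : ℕ} {c : (ℕ → Bool) → Bool} {q : (ℕ → Bool) → ℝ}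

theorem refl_refl (h0 : ∀ m, 0 ≤ q m) (h1 : ∀ m, q m ≤ 1) (Ψ : (ℕ → Bool) → ℂ) :
    refl t c q (refl t c q Ψ) = Ψ := by
  funext m
  have e0 := h0 (Function.update m t false)
  have e1 := h1 (Function.update m t false)
  have s0 : ((√(q (Function.update m t false)) : ℝ) : ℂ) * (√(q (Function.update m t false)) : ℝ)
      = (q (Function.update m t false) : ℂ) := by
    rw [← Complex.ofReal_mul, Real.mul_self_sqrt e0]
  have s1 : ((√(1 - q (Function.update m t false)) : ℝ) : ℂ)
      * (√(1 - q (Function.update m t false)) : ℝ) = 1 - (q (Function.update m t false) : ℂ) := by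
    rw [← Complex.ofReal_mul, Real.mul_self_sqrt (by linarith)]
    push_cast
    ring
  unfold refl
  by_cases hc : c (Function.update m t false) = true
  · simp only [hc, Function.update_idem, Function.update_self, if_true]
    generalize ((√(q (Function.update m t false)) : ℝ) : ℂ) = A at *
    generalize ((√(1 - q (Function.update m t false)) : ℝ) : ℂ) = B at *
    generalize (q (Function.update m t false) : ℂ) = Q at *
    cases hm : m t
    · have : Function.update m t false = m := by rw [← hm, Function.update_eq_self]
      simp only [this, if_false, Bool.false_eq_true]
      linear_combination Ψ m * s0 + Ψ m * s1
    · have : Function.update m t true = m := by rw [← hm, Function.update_eq_self]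
      simp only [this, if_false, Bool.false_eq_true, if_true]
      linear_combination Ψ m * s0 + Ψ m * s1
  · simp only [hc, if_false, Bool.false_eq_true]

theorem refl_add (Ψ Φ : (ℕ → Bool) → ℂ) :
    refl t c q (fun m => Ψ m + Φ m) = fun m => refl t c q Ψ m + refl t c q Φ m := by
  funext m
  unfold refl
  split_ifs <;> ring

theorem refl_mul (h : (ℕ → Bool) → ℂ) (hh : ∀ m b, h (Function.update m t b) = h m)
    (Ψ : (ℕ → Bool) → ℂ) :
    refl t c q (fun m => h m * Ψ m) = fun m => h m * refl t c q Ψ m := by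
  funext m
  unfold refl
  simp only [hh]
  split_ifs <;> ring

theorem refl_congr {Ψ Φ : (ℕ → Bool) → ℂ} {m : ℕ → Bool}
    (h : ∀ b, Ψ (Function.update m t b) = Φ (Function.update m t b)) :
    refl t c q Ψ m = refl t c q Φ m := by
  have hm : Ψ m = Φ m := by have := h (m t); rwa [Function.update_eq_self] at this
  unfold refl
  simp only [h, hm]

/-- The probability that a fresh bit `t` becomes one. -/
def prob1 (t : ℕ) (c : (ℕ → Bool) → Bool) (q : (ℕ → Bool) → ℝ) (m : ℕ → Bool) : ℝ :=
  if c (Function.update m t false) then q (Function.update m t false) else 0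

theorem prob1_nonneg (h0 : ∀ m, 0 ≤ q m) (m : ℕ → Bool) : 0 ≤ prob1 t c q m := by
  unfold prob1; split_ifs; exacts [h0 _, le_rfl]

theorem prob1_le_one (h1 : ∀ m, q m ≤ 1) (m : ℕ → Bool) : prob1 t c q m ≤ 1 := by
  unfold prob1; split_ifs; exacts [h1 _, zero_le_one]

theorem refl_of_false {m : ℕ → Bool} (hm : m t = false) (Ψ : (ℕ → Bool) → ℂ) :
    refl t c q Ψ m = (√(1 - prob1 t c q m) : ℝ) * Ψ m
      + (√(prob1 t c q m) : ℝ) * Ψ (Function.update m t true) := by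
  have : Function.update m t false = m := by rw [← hm, Function.update_eq_self]
  unfold refl prob1
  rw [this]
  split_ifs with h
  · simp [hm] at *
  · rfl
  · simp

theorem refl_of_true {m : ℕ → Bool} (hm : m t = true) {Ψ : (ℕ → Bool) → ℂ} (hΨ : Ψ m = 0) :
    refl t c q Ψ m = (√(prob1 t c q m) : ℝ) * Ψ (Function.update m t false) := by
  have : Function.update m t true = m := by rw [← hm, Function.update_eq_self]
  unfold refl prob1
  rw [this]
  split_ifs <;> simp [hΨ]

end

/-! ### Sequences of controlled reflections -/

/-- The bits `0, …, k-1` are reflected in this order. -/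
def fwd (c : ℕ → (ℕ → Bool) → Bool) (q : ℕ → (ℕ → Bool) → ℝ) :
    ℕ → ((ℕ → Bool) → ℂ) → (ℕ → Bool) → ℂ
  | 0, Ψ => Ψ
  | k + 1, Ψ => refl k (c k) (q k) (fwd c q k Ψ)

/-- The bits `k-1, …, 0` are reflected in this order. -/
def bwd (c : ℕ → (ℕ → Bool) → Bool) (q : ℕ → (ℕ → Bool) → ℝ) :
    ℕ → ((ℕ → Bool) → ℂ) → (ℕ → Bool) → ℂ
  | 0, Ψ => Ψ
  | k + 1, Ψ => bwd c q k (refl k (c k) (q k) Ψ)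

/-- The conditional expectation of `f` if the bits `0, …, k-1` are sampled in this order. -/
def expect (c : ℕ → (ℕ → Bool) → Bool) (q : ℕ → (ℕ → Bool) → ℝ) :
    ℕ → ((ℕ → Bool) → ℝ) → (ℕ → Bool) → ℝ
  | 0, f => f
  | k + 1, f => expect c q k fun m =>
      (1 - prob1 k (c k) (q k) m) * f (Function.update m k false)
        + prob1 k (c k) (q k) m * f (Function.update m k true)

section
variable {c : ℕ → (ℕ → Bool) → Bool} {q : ℕ → (ℕ → Bool) → ℝ}

theorem fwd_bwd (h0 : ∀ k m, 0 ≤ q k m) (h1 : ∀ k m, q k m ≤ 1) (k : ℕ) (Ψ : (ℕ → Bool) → ℂ) :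
    fwd c q k (bwd c q k Ψ) = Ψ := by
  induction k generalizing Ψ with
  | zero => rfl
  | succ k ih => rw [bwd, fwd, ih, refl_refl (h0 k) (h1 k)]

theorem fwd_add (k : ℕ) (Ψ Φ : (ℕ → Bool) → ℂ) :
    fwd c q k (fun m => Ψ m + Φ m) = fun m => fwd c q k Ψ m + fwd c q k Φ m := by
  induction k with
  | zero => rfl
  | succ k ih => simp only [fwd, ih, refl_add]

theorem bwd_add (k : ℕ) (Ψ Φ : (ℕ → Bool) → ℂ) :
    bwd c q k (fun m => Ψ m + Φ m) = fun m => bwd c q k Ψ m + bwd c q k Φ m := by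
  induction k generalizing Ψ Φ with
  | zero => rfl
  | succ k ih => simp only [bwd, refl_add, ih]

theorem fwd_mul (k : ℕ) (h : (ℕ → Bool) → ℂ)
    (hh : ∀ t < k, ∀ m b, h (Function.update m t b) = h m) (Ψ : (ℕ → Bool) → ℂ) :
    fwd c q k (fun m => h m * Ψ m) = fun m => h m * fwd c q k Ψ m := by
  induction k with
  | zero => rfl
  | succ k ih =>
    simp only [fwd, ih fun t ht => hh t (by omega), refl_mul h (hh k (by omega))]

theorem bwd_mul (k : ℕ) (h : (ℕ → Bool) → ℂ)
    (hh : ∀ t < k, ∀ m b, h (Function.update m t b) = h m) (Ψ : (ℕ → Bool) → ℂ) :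
    bwd c q k (fun m => h m * Ψ m) = fun m => h m * bwd c q k Ψ m := by
  induction k generalizing Ψ with
  | zero => rfl
  | succ k ih =>
    simp only [bwd, refl_mul h (hh k (by omega)), ih fun t ht => hh t (by omega)]

theorem expect_mul (k : ℕ) (h : (ℕ → Bool) → ℝ)
    (hh : ∀ t < k, ∀ m b, h (Function.update m t b) = h m) (f : (ℕ → Bool) → ℝ) :
    expect c q k (fun m => h m * f m) = fun m => h m * expect c q k f m := by
  induction k generalizing f with
  | zero => rfl
  | succ k ih =>
    simp only [expect]
    rw [← ih fun t ht => hh t (by omega)]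
    congr 1
    funext m
    rw [hh k (by omega), hh k (by omega)]
    ring

theorem bwd_congr (k : ℕ) {Ψ Φ : (ℕ → Bool) → ℂ} {m : ℕ → Bool}
    (h : ∀ m' : ℕ → Bool, (∀ a, k ≤ a → m' a = m a) → Ψ m' = Φ m') :
    bwd c q k Ψ m = bwd c q k Φ m := by
  induction k generalizing Ψ Φ with
  | zero => exact h m fun _ _ => rfl
  | succ k ih =>
    refine ih fun m' hm' => refl_congr fun b => h _ fun a ha => ?_
    rw [Function.update_of_ne (by omega), hm' a (by omega)]

theorem expect_congr (k : ℕ) {f g : (ℕ → Bool) → ℝ} {m : ℕ → Bool}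
    (h : ∀ m' : ℕ → Bool, (∀ a, k ≤ a → m' a = m a) → f m' = g m') :
    expect c q k f m = expect c q k g m := by
  induction k generalizing f g with
  | zero => exact h m fun _ _ => rfl
  | succ k ih =>
    refine ih fun m' hm' => ?_
    have : ∀ b, f (Function.update m' k b) = g (Function.update m' k b) := fun b =>
      h _ fun a ha => by rw [Function.update_of_ne (by omega), hm' a (by omega)]
    rw [this, this]

theorem fwd_eq_zero {δ : (ℕ → Bool) → ℂ} {a : ℕ} (hδ : ∀ m : ℕ → Bool, m a = true → δ m = 0)
    (k : ℕ) (hk : k ≤ a) {m : ℕ → Bool} (hm : m a = true) : fwd c q k δ m = 0 := by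
  induction k generalizing m with
  | zero => exact hδ m hm
  | succ k ih =>
    have h1 : ∀ b, fwd c q k δ (Function.update m k b) = 0 := fun b =>
      ih (by omega) (by rw [Function.update_of_ne (by omega), hm])
    rw [fwd, refl_congr (Φ := fun _ => 0) h1]
    unfold refl
    simp

theorem bwd_eq_zero {δ : (ℕ → Bool) → ℂ} {a : ℕ} (hδ : ∀ m : ℕ → Bool, m a = true → δ m = 0)
    (k : ℕ) (hk : k ≤ a) {m : ℕ → Bool} (hm : m a = true) : bwd c q k δ m = 0 := by
  rw [bwd_congr (Φ := fun m => 0 * δ m), bwd_mul k (fun _ => 0) (fun _ _ _ _ => rfl)]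
  · simp
  · intro m' hm'
    rw [hδ m' (by rw [hm' a hk, hm]), mul_zero]

/-- On a bit that is still `0` the reflection acts as a coin toss: the amplitude is multiplied by
the square root of the conditional probability of the new value. -/
theorem fwd_succ_apply {δ : (ℕ → Bool) → ℂ} (k : ℕ)
    (hδ : ∀ m : ℕ → Bool, m k = true → δ m = 0) (m : ℕ → Bool) :
    fwd c q (k + 1) δ m = (√(if m k then prob1 k (c k) (q k) m else 1 - prob1 k (c k) (q k) m) : ℝ)
      * fwd c q k δ (Function.update m k false) := by
  cases hm : m k
  · rw [fwd, refl_of_false hm, fwd_eq_zero hδ k le_rfl (m := Function.update m k true) (by simp)]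
    have : Function.update m k false = m := by rw [← hm, Function.update_eq_self]
    simp [this]
  · rw [fwd, refl_of_true hm (fwd_eq_zero hδ k le_rfl hm)]
    simp

theorem prob1_update (t : ℕ) (c : (ℕ → Bool) → Bool) (q : (ℕ → Bool) → ℝ) (m : ℕ → Bool)
    (b : Bool) : prob1 t c q (Function.update m t b) = prob1 t c q m := by
  simp [prob1]

/-- This is `⟨0| A⁻¹ f A |0⟩ = E f`. At each bit the two square roots from `fwd` and `bwd` multiply
to a conditional probability. -/
theorem bwd_fwd_mul (h0 : ∀ k m, 0 ≤ q k m) (h1 : ∀ k m, q k m ≤ 1) {δ : (ℕ → Bool) → ℂ} (k : ℕ)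
    (hδ : ∀ a < k, ∀ m : ℕ → Bool, m a = true → δ m = 0) (f : (ℕ → Bool) → ℝ) {m : ℕ → Bool}
    (hm : ∀ a < k, m a = false) :
    bwd c q k (fun m => fwd c q k δ m * f m) m = δ m * expect c q k f m := by
  induction k generalizing f with
  | zero => rfl
  | succ k ih =>
    rw [bwd, expect, ← ih (fun a ha => hδ a (by omega)) _ (fun a ha => hm a (by omega))]
    refine bwd_congr k fun m' hm' => ?_
    have hk : m' k = false := by rw [hm' k le_rfl, hm k (by omega)]
    have hk' : Function.update m' k false = m' := by rw [← hk, Function.update_eq_self]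
    have e0 := prob1_nonneg (t := k) (c := c k) (h0 k) m'
    have e1 := prob1_le_one (t := k) (c := c k) (h1 k) m'
    have s0 : ((√(prob1 k (c k) (q k) m') : ℝ) : ℂ) * (√(prob1 k (c k) (q k) m') : ℝ)
        = (prob1 k (c k) (q k) m' : ℂ) := by
      rw [← Complex.ofReal_mul, Real.mul_self_sqrt e0]
    have s1 : ((√(1 - prob1 k (c k) (q k) m') : ℝ) : ℂ) * (√(1 - prob1 k (c k) (q k) m') : ℝ)
        = (1 - prob1 k (c k) (q k) m' : ℂ) := by
      rw [← Complex.ofReal_mul, Real.mul_self_sqrt (by linarith)]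
      push_cast
      ring
    rw [refl_of_false hk, fwd_succ_apply k (hδ k (by omega)),
      fwd_succ_apply k (hδ k (by omega)), prob1_update]
    simp only [hk, hk', Function.update_self, Function.update_idem, if_true, if_false,
      Bool.false_eq_true]
    push_cast
    linear_combination (fwd c q k δ m' * f m') * s1
      + (fwd c q k δ m' * f (Function.update m' k true)) * s0

theorem sum_bit_split {N k : ℕ} (hk : k < N) (F : (ℕ → Bool) → ℝ) :
    ∑ s : Fin N → Bool, F (bit s) = ∑ s : Fin N → Bool, if bit s k then 0 else
      F (bit s) + F (Function.update (bit s) k true) := by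
  have h1 : ∑ s : Fin N → Bool, F (bit s) = (∑ s : Fin N → Bool, if bit s k then 0 else F (bit s))
      + ∑ s : Fin N → Bool, if bit s k then F (bit s) else 0 := by
    rw [← Finset.sum_add_distrib]
    exact Finset.sum_congr rfl fun s _ => by split_ifs <;> simp
  have h2 : (∑ s : Fin N → Bool, if bit s k then F (bit s) else 0)
      = ∑ s : Fin N → Bool, if bit s k then 0 else F (Function.update (bit s) k true) := by
    have hinv : Function.Involutive
        fun s : Fin N → Bool => Function.update s ⟨k, hk⟩ (!s ⟨k, hk⟩) := fun s => by simp
    refine Fintype.sum_equiv hinv.toPerm _ _ fun s => ?_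
    · simp only [Function.Involutive.coe_toPerm, bit_update]
      have : s ⟨k, hk⟩ = bit s k := by simp [bit, hk]
      rw [this]
      cases hb : bit s k
      · simp
      · simp only [Function.update_self, Function.update_idem]
        rw [← hb, Function.update_eq_self]
        simp [hb]
  rw [h1, h2, ← Finset.sum_add_distrib]
  exact Finset.sum_congr rfl fun s _ => by split_ifs <;> simp

/-- Measuring the prepared bits gives the classical sampling distribution, conditionally on the bits
that were not prepared. -/
theorem sum_norm_sq_fwd (h0 : ∀ k m, 0 ≤ q k m) (h1 : ∀ k m, q k m ≤ 1) {δ : (ℕ → Bool) → ℂ}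
    {N : ℕ} (k : ℕ) (hk : k ≤ N) (hδ : ∀ a < k, ∀ m : ℕ → Bool, m a = true → δ m = 0)
    (f : (ℕ → Bool) → ℝ) :
    ∑ s : Fin N → Bool, ‖fwd c q k δ (bit s)‖ ^ 2 * f (bit s)
      = ∑ s : Fin N → Bool, ‖δ (bit s)‖ ^ 2 * expect c q k f (bit s) := by
  induction k generalizing f with
  | zero => rfl
  | succ k ih =>
    rw [expect, ← ih (by omega) (fun a ha => hδ a (by omega)),
      sum_bit_split (show k < N by omega) fun m => ‖fwd c q (k + 1) δ m‖ ^ 2 * f m]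
    refine Finset.sum_congr rfl fun s _ => ?_
    cases hs : bit s k
    · have hk' : Function.update (bit s) k false = bit s := by
        rw [← hs, Function.update_eq_self]
      have e0 := prob1_nonneg (t := k) (c := c k) (h0 k) (bit s)
      have e1 := prob1_le_one (t := k) (c := c k) (h1 k) (bit s)
      rw [fwd_succ_apply k (hδ k (by omega)), fwd_succ_apply k (hδ k (by omega)), prob1_update]
      simp only [hs, hk', Function.update_self, Function.update_idem, if_true, if_false,
        Bool.false_eq_true, norm_mul, mul_pow, Complex.norm_real, Real.norm_eq_abs, sq_abs]
      rw [Real.sq_sqrt e0, Real.sq_sqrt (by linarith)]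
      ring
    · rw [fwd_eq_zero (hδ k (by omega)) k le_rfl hs]
      simp

end

/-! ### Amplitude amplification -/

/-- All bits outside the control register `[r, r+k)` vanish from address `R` on. -/
def Clean (R r k : ℕ) (m : ℕ → Bool) : Prop :=
  ∀ a, R ≤ a → ¬(r ≤ a ∧ a < r + k) → m a = false

/-- The indicator function of the memories with vanishing bits outside the control register. -/
def indClean (r k : ℕ) (m : ℕ → Bool) : ℂ := open Classical in if Clean 0 r k m then 1 else 0

/-- A phase flip if the bit `a` and the predicate `ρ` hold. -/
def phaseFlip (a : ℕ) (ρ : (ℕ → Bool) → Bool) (Φ : (ℕ → Bool) → ℂ) : (ℕ → Bool) → ℂ := fun m =>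
  (if m a = true ∧ ρ m = true then -1 else 1) * Φ m

theorem indClean_congr {r k r' k' : ℕ} {m m' : ℕ → Bool}
    (h : Clean 0 r k m ↔ Clean 0 r' k' m') : indClean r k m = indClean r' k' m' := by
  unfold indClean
  by_cases h' : Clean 0 r k m
  · rw [if_pos h', if_pos (h.1 h')]
  · rw [if_neg h', if_neg fun h2 => h' (h.2 h2)]

theorem indClean_eq_zero {r k a : ℕ} (ha : ¬(r ≤ a ∧ a < r + k)) (m : ℕ → Bool)
    (hm : m a = true) : indClean r k m = 0 := by
  unfold indClean
  rw [if_neg]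
  intro h
  rw [h a (Nat.zero_le _) ha] at hm
  exact Bool.false_ne_true hm

/-- The indicator function of a predicate. -/
def ind (χ : (ℕ → Bool) → Bool) (m : ℕ → Bool) : ℝ := if χ m then 1 else 0

section
variable {c : ℕ → (ℕ → Bool) → Bool} {q : ℕ → (ℕ → Bool) → ℝ}

theorem expect_one_sub (k : ℕ) (f : (ℕ → Bool) → ℝ) (m : ℕ → Bool) :
    expect c q k (fun m => 1 - f m) m = 1 - expect c q k f m := by
  induction k generalizing f with
  | zero => rfl
  | succ k ih =>
    rw [expect, expect, ← ih]
    congr 1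
    funext m
    ring

theorem expect_add (k : ℕ) (f g : (ℕ → Bool) → ℝ) (m : ℕ → Bool) :
    expect c q k (fun m => f m + g m) m = expect c q k f m + expect c q k g m := by
  induction k generalizing f g with
  | zero => rfl
  | succ k ih =>
    rw [expect, expect, expect, ← ih]
    congr 1
    funext m
    ring

variable {R r k : ℕ} {χ ζ : (ℕ → Bool) → Bool} {p : ℝ}

/-- After `A⁻¹` the amplitude still vanishes unless all cells outside the random bits and the
control register are `0`. So the zero test, which is reliable only on such memories, singles out the
component along the initial state, whose coefficient is the expectation `p`. -/
theorem ind_mul_bwd (h0 : ∀ k m, 0 ≤ q k m) (h1 : ∀ k m, q k m ≤ 1) (hRr : R ≤ r)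
    (hζ : ∀ m, Clean R r k m → (ζ m = true ↔ ∀ a < R, m a = false))
    (f : (ℕ → Bool) → ℝ) (hf : ∀ m, Clean 0 r k m → expect c q R f m = p) (m : ℕ → Bool) :
    (ind ζ m : ℂ) * bwd c q R (fun m => fwd c q R (indClean r k) m * f m) m
      = p * indClean r k m := by
  have hδ : ∀ a < R, ∀ m : ℕ → Bool, m a = true → indClean r k m = 0 := fun a ha m hm =>
    indClean_eq_zero (by omega) m hm
  by_cases hc : Clean R r k m
  · by_cases hz : ζ m = true
    · have hz' := (hζ m hc).1 hz
      have hc0 : Clean 0 r k m := fun a _ ha => by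
        by_cases h : a < R
        exacts [hz' a h, hc a (by omega) ha]
      rw [bwd_fwd_mul h0 h1 R hδ f hz', hf m hc0, ind, if_pos hz]
      push_cast
      ring
    · have hz' : ¬ ∀ a < R, m a = false := fun h => hz ((hζ m hc).2 h)
      push Not at hz'
      obtain ⟨a, ha, hma⟩ := hz'
      rw [indClean_eq_zero (a := a) (by omega) m (by simpa using hma), ind, if_neg hz]
      simp
  · unfold Clean at hc
    push Not at hc
    obtain ⟨a, ha, hna, hma⟩ := hc
    have hma' : m a = true := by simpa using hma
    have hna' : ¬(r ≤ a ∧ a < r + k) := fun h => by have := hna h.1; omega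
    rw [indClean_eq_zero hna' m hma', bwd_eq_zero _ R ha hma']
    · simp
    · intro m' hm'
      rw [fwd_eq_zero (fun m hm => indClean_eq_zero hna' m hm) R ha hm', zero_mul]

/-- The flip by `ζ` between `A⁻¹` and `A` is the reflection `1 - 2 A|0⟩⟨0|A⁻¹`, so the plane of good
and bad part is preserved. The coefficients `hα`, `hβ` may depend on the control register but not on
the random bits; therefore they commute with `A` and `A⁻¹`. If control bit `a` is `0`, both flips
are trivial and `A`, `A⁻¹` cancel. -/
theorem amplification_step (h0 : ∀ k m, 0 ≤ q k m) (h1 : ∀ k m, q k m ≤ 1) (hRr : R ≤ r)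
    (hζ : ∀ m, Clean R r k m → (ζ m = true ↔ ∀ a < R, m a = false))
    (hχ : ∀ m, Clean 0 r k m → expect c q R (ind χ) m = p) {a : ℕ} (ha : R ≤ a)
    (hα hβ : (ℕ → Bool) → ℂ) (hhα : ∀ t < R, ∀ m b, hα (Function.update m t b) = hα m)
    (hhβ : ∀ t < R, ∀ m b, hβ (Function.update m t b) = hβ m) :
    fwd c q R (phaseFlip a ζ (bwd c q R (phaseFlip a χ fun m =>
        hα m * (fwd c q R (indClean r k) m * ind χ m)
          + hβ m * (fwd c q R (indClean r k) m * (1 - ind χ m : ℝ)))))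
      = fun m =>
        (if m a then -hα m - 2 * (-hα m * p + hβ m * (1 - p)) else hα m)
          * (fwd c q R (indClean r k) m * ind χ m)
        + (if m a then hβ m - 2 * (-hα m * p + hβ m * (1 - p)) else hβ m)
          * (fwd c q R (indClean r k) m * (1 - ind χ m : ℝ)) := by
  have hupd : ∀ t < R, ∀ (m : ℕ → Bool) b, Function.update m t b a = m a := fun t ht m b =>
    Function.update_of_ne (by omega) _ _
  set Ψ := fwd c q R (indClean r k) with hΨ
  set hα1 : (ℕ → Bool) → ℂ := fun m => if m a then -hα m else hα m with hα1_def
  have hhα1 : ∀ t < R, ∀ m b, hα1 (Function.update m t b) = hα1 m := fun t ht m b => by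
    simp only [hα1_def, hupd t ht, hhα t ht]
  have e1 : (phaseFlip a χ fun m => hα m * (Ψ m * ind χ m) + hβ m * (Ψ m * (1 - ind χ m : ℝ)))
      = fun m => hα1 m * (Ψ m * ind χ m) + hβ m * (Ψ m * (1 - ind χ m : ℝ)) := by
    funext m
    unfold phaseFlip ind
    simp only [hα1_def]
    cases m a <;> cases χ m <;> simp
  rw [e1]
  have e2 := bwd_add (c := c) (q := q) R (fun m => hα1 m * (Ψ m * ind χ m))
    (fun m => hβ m * (Ψ m * (1 - ind χ m : ℝ)))
  rw [bwd_mul R hα1 hhα1, bwd_mul R hβ hhβ] at e2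
  have k1 := ind_mul_bwd h0 h1 hRr hζ (ind χ) hχ
  have k2 := ind_mul_bwd (p := 1 - p) h0 h1 hRr hζ (fun m => 1 - ind χ m) fun m hm => by
    rw [expect_one_sub, hχ m hm]
  rw [← hΨ] at k1 k2
  set g : (ℕ → Bool) → ℂ := fun m =>
    if m a then -2 * (hα1 m * p + hβ m * (1 - p)) else 0 with hg
  have hhg : ∀ t < R, ∀ m b, g (Function.update m t b) = g m := fun t ht m b => by
    simp only [hg, hupd t ht, hhα1 t ht, hhβ t ht]
  have e3 : phaseFlip a ζ (bwd c q R fun m =>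
        hα1 m * (Ψ m * ind χ m) + hβ m * (Ψ m * (1 - ind χ m : ℝ)))
      = fun m => (bwd c q R fun m =>
        hα1 m * (Ψ m * ind χ m) + hβ m * (Ψ m * (1 - ind χ m : ℝ))) m
          + g m * indClean r k m := by
    funext m
    have k1m := k1 m
    have k2m := k2 m
    rw [e2]
    unfold phaseFlip
    simp only [hg]
    cases ham : m a
    · simp
    · cases hz : ζ m
      · simp only [ind, hz] at k1m k2m
        simp only [Bool.false_eq_true, if_false, and_false, if_true]
        push_cast at k1m k2m
        linear_combination (-2 * hα1 m) * k1m + (-2 * hβ m) * k2m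
      · simp only [ind, hz] at k1m k2m
        simp only [if_true, and_self]
        push_cast at k1m k2m ⊢
        simp only [one_mul, ind] at k1m k2m ⊢
        linear_combination (-2 * hα1 m) * k1m + (-2 * hβ m) * k2m
  rw [e3, fwd_add, fwd_bwd h0 h1, fwd_mul R g hhg, ← hΨ]
  funext m
  simp only [hg, hα1_def]
  cases m a
  · simp
  · push_cast
    simp only [if_true]
    ring

/-- The coefficients of the good and the bad part of the state after `j` iterations. -/
def ampCoeff (p : ℝ) : ℕ → ℝ × ℝ
  | 0 => (1, 1)
  | j + 1 =>
    (-(ampCoeff p j).1 - 2 * (-(ampCoeff p j).1 * p + (ampCoeff p j).2 * (1 - p)),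
     (ampCoeff p j).2 - 2 * (-(ampCoeff p j).1 * p + (ampCoeff p j).2 * (1 - p)))

/-- Each iteration adds `2θ` to the angle. The factor `(-1)^j` appears because the second reflection
has the opposite sign to the one in Grover's iteration; in the end it shifts the measured phase by
`π/2`. -/
theorem ampCoeff_eq {p θ : ℝ} (hp : p = Real.sin θ ^ 2) (j : ℕ) :
    (ampCoeff p j).1 * Real.sin θ = (-1) ^ j * Real.sin ((2 * j + 1) * θ) ∧
    (ampCoeff p j).2 * Real.cos θ = (-1) ^ j * Real.cos ((2 * j + 1) * θ) := by
  subst hp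
  induction j with
  | zero => simp [ampCoeff]
  | succ j ih =>
    obtain ⟨h1, h2⟩ := ih
    have e : (2 * ((j + 1 : ℕ) : ℝ) + 1) * θ = (2 * j + 1) * θ + 2 * θ := by push_cast; ring
    have hcs := Real.sin_sq_add_cos_sq θ
    have hp' : 1 - Real.sin θ ^ 2 = Real.cos θ ^ 2 := by linarith
    rw [e, Real.sin_add, Real.cos_add, Real.sin_two_mul, Real.cos_two_mul', pow_succ (-1 : ℝ) j]
    simp only [ampCoeff, hp']
    generalize (ampCoeff (Real.sin θ ^ 2) j).1 = A at *
    generalize (ampCoeff (Real.sin θ ^ 2) j).2 = B at *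
    constructor
    · linear_combination (-(Real.cos θ ^ 2 - Real.sin θ ^ 2)) * h1
        + (-2 * Real.sin θ * Real.cos θ) * h2 + A * Real.sin θ * hcs
    · linear_combination (2 * Real.sin θ * Real.cos θ) * h1
        - (Real.cos θ ^ 2 - Real.sin θ ^ 2) * h2 - B * Real.cos θ * hcs

/-- The number of iterations `y < Y` whose control bit is set. -/
def iterCount (r k : ℕ) (m : ℕ → Bool) (Y : ℕ) : ℕ :=
  ∑ y ∈ Finset.range Y, (m (r + (k - 1 - Nat.log 2 (y + 1)))).toNat

/-- There are `2^l` numbers `y` with `Nat.log 2 (y + 1) = l`. So a single loop of length `2^k - 1`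
controls `2^l` iterations by the qubit of weight `2^l`. -/
theorem sum_range_log (f : ℕ → ℕ) (k : ℕ) :
    ∑ y ∈ Finset.range (2 ^ k - 1), f (Nat.log 2 (y + 1)) = ∑ l ∈ Finset.range k, f l * 2 ^ l := by
  induction k with
  | zero => simp
  | succ k ih =>
    have h2 := Nat.two_pow_pos k
    have h1 : 2 ^ (k + 1) - 1 = (2 ^ k - 1) + 2 ^ k := by rw [pow_succ]; omega
    rw [h1, Finset.sum_range_add, ih, Finset.sum_range_succ]
    congr 1
    rw [Finset.sum_congr rfl (g := fun _ => f k)]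
    · simp [mul_comm]
    · intro y hy
      rw [Finset.mem_range] at hy
      congr 1
      rw [Nat.log_eq_iff (Or.inr ⟨by norm_num, by omega⟩), pow_succ]
      omega

theorem ofDigits_eq_sum (b : ℕ → Bool) (w : ℕ) :
    ofDigits b w = ∑ l ∈ Finset.range w, (b l).toNat * 2 ^ l := by
  induction w with
  | zero => rfl
  | succ w ih => rw [ofDigits, ih, Finset.sum_range_succ]

theorem iterCount_eq (r k : ℕ) (m : ℕ → Bool) :
    iterCount r k m (2 ^ k - 1) = ofDigits (fun l => m (r + (k - 1 - l))) k := by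
  rw [iterCount, sum_range_log fun l => (m (r + (k - 1 - l))).toNat, ofDigits_eq_sum]

/-- On the branch where the control register selects `J` iterations the coefficients are those of
`ampCoeff p J`: an iteration whose control bit is `0` leaves them alone and does not count. -/
theorem amplification_iterate (h0 : ∀ k m, 0 ≤ q k m) (h1 : ∀ k m, q k m ≤ 1) (hRr : R ≤ r)
    (hζ : ∀ m, Clean R r k m → (ζ m = true ↔ ∀ a < R, m a = false))
    (hχ : ∀ m, Clean 0 r k m → expect c q R (ind χ) m = p) (z : ℂ) {d n : ℕ}
    (v : (Fin d → Fin n) → ℝ) (G : ℕ → List (Gate ℕ)) (Y : ℕ)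
    (hG : ∀ y < Y, ∀ Φ, acts v (G y) Φ = fwd c q R (phaseFlip (r + (k - 1 - Nat.log 2 (y + 1))) ζ
      (bwd c q R (phaseFlip (r + (k - 1 - Nat.log 2 (y + 1))) χ Φ)))) :
    acts v ((List.range Y).flatMap G) (fun m => z * fwd c q R (indClean r k) m) = fun m =>
      z * ((ampCoeff p (iterCount r k m Y)).1 : ℂ) * (fwd c q R (indClean r k) m * ind χ m)
      + z * ((ampCoeff p (iterCount r k m Y)).2 : ℂ)
        * (fwd c q R (indClean r k) m * (1 - ind χ m : ℝ)) := by
  induction Y with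
  | zero =>
    funext m
    simp only [List.range_zero, List.flatMap_nil, acts_nil, iterCount, Finset.range_zero,
      Finset.sum_empty, ampCoeff]
    push_cast
    ring
  | succ Y ih =>
    have hinv : ∀ t < R, ∀ (m : ℕ → Bool) b,
        iterCount r k (Function.update m t b) Y = iterCount r k m Y := fun t ht m b => by
      unfold iterCount
      exact Finset.sum_congr rfl fun y _ => by rw [Function.update_of_ne (by omega)]
    rw [List.range_succ, List.flatMap_append, List.flatMap_singleton, acts_append,
      ih fun y hy => hG y (by omega), hG Y (by omega),
      amplification_step h0 h1 hRr hζ hχ (by omega)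
      (fun m => z * ((ampCoeff p (iterCount r k m Y)).1 : ℂ))
      (fun m => z * ((ampCoeff p (iterCount r k m Y)).2 : ℂ))
      (fun t ht m b => by rw [hinv t ht]) (fun t ht m b => by rw [hinv t ht])]
    funext m
    have hc : iterCount r k m (Y + 1) = iterCount r k m Y
        + (m (r + (k - 1 - Nat.log 2 (Y + 1)))).toNat := by
      rw [iterCount, Finset.sum_range_succ, iterCount]
    rw [hc]
    cases m (r + (k - 1 - Nat.log 2 (Y + 1)))
    · simp
    · simp only [if_true, Bool.toNat_true, ampCoeff]
      push_cast
      ring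

end

/-! ### The Fourier transform -/

section
variable {d n : ℕ} (v : (Fin d → Fin n) → ℝ)

/-- The amplitude `√(1/2)`. -/
def invSqrtTwo : ℂ := (√(1 / 2) : ℝ)

theorem invSqrtTwo_mul_self : invSqrtTwo * invSqrtTwo = 1 / 2 := by
  unfold invSqrtTwo
  rw [← Complex.ofReal_mul, Real.mul_self_sqrt (by norm_num)]
  norm_num

theorem acts_hadamard (t : ℕ) (Ψ : (ℕ → Bool) → ℂ) (m : ℕ → Bool) :
    acts v (unitL (.rot 1 2) [] t) Ψ m = invSqrtTwo * (Ψ (Function.update m t false)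
      + (if m t then -1 else 1) * Ψ (Function.update m t true)) := by
  rw [acts_unitL v (.rot 1 2) (fun _ => ((1 : ℕ) : ℝ) / (2 : ℕ)) (fun _ => rfl)]
  have h1 : (max 0 (min 1 (((1 : ℕ) : ℝ) / (2 : ℕ)))) = 1 / 2 := by norm_num
  have h2 : (1 : ℝ) - 1 / 2 = 1 / 2 := by norm_num
  unfold refl
  simp only [List.all_nil, if_true, h1, h2, invSqrtTwo]
  cases m t
  · simp only [Bool.false_eq_true, if_false]
    ring
  · simp only [if_true]
    ring

theorem acts_hadamards (r k : ℕ) :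
    acts v ((List.range k).flatMap fun t => unitL (.rot 1 2) [] (r + t))
      (fun m => open Classical in if m = fun _ => false then 1 else 0)
      = fun m => invSqrtTwo ^ k * indClean r k m := by
  induction k with
  | zero =>
    funext m
    simp only [List.range_zero, List.flatMap_nil, acts_nil, pow_zero, one_mul]
    have : (m = fun _ => false) ↔ Clean 0 r 0 m :=
      ⟨fun h a _ _ => by rw [h], fun h => funext fun a => h a (Nat.zero_le _) (by omega)⟩
    unfold indClean
    by_cases h : m = fun _ => false
    · rw [if_pos h, if_pos (this.1 h)]
    · rw [if_neg h, if_neg fun h' => h (this.2 h')]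
  | succ k ih =>
    rw [List.range_succ, List.flatMap_append, List.flatMap_singleton, acts_append, ih]
    funext m
    rw [acts_hadamard, indClean_eq_zero (a := r + k) (by omega) (Function.update m _ true) (by simp)]
    have : Clean 0 r k (Function.update m (r + k) false) ↔ Clean 0 r (k + 1) m := by
      constructor
      · intro h a _ ha
        have := h a (Nat.zero_le _) (by omega)
        rwa [Function.update_of_ne (by omega)] at this
      · intro h a _ ha
        by_cases h1 : a = r + k
        · rw [h1, Function.update_self]
        · rw [Function.update_of_ne h1]
          exact h a (Nat.zero_le _) (by omega)
    rw [indClean_congr this]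
    ring

theorem act_phase (a b : ℕ) (cs : List ℕ) (t : ℕ) (Ψ : (ℕ → Bool) → ℂ) (m : ℕ → Bool) :
    act v ⟨.phase a b, cs, t⟩ Ψ m
      = (if cs.all (Function.update m t false) = true ∧ m t = true then
          Complex.exp (2 * Real.pi * Complex.I * ((a : ℂ) / b)) else 1) * Ψ m := by
  simp only [List.all_eq_true]
  unfold act
  by_cases h : ∀ c ∈ cs, Function.update m t false c = true
  · rw [if_pos h, Fintype.sum_bool]
    cases hm : m t
    · have e : Function.update m t false = m := by rw [← hm, Function.update_eq_self]
      simp [Op.matrix, e]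
    · have e : Function.update m t true = m := by rw [← hm, Function.update_eq_self]
      rw [if_pos ⟨h, rfl⟩]
      simp only [Op.matrix, e]
      simp
  · rw [if_neg h, if_neg fun h' => h h'.1, one_mul]

/-- Stage `t` of the inverse Fourier transform on the qubits `r, …, r+k-1`. -/
def fourierStageL (r k t : ℕ) : List (Gate ℕ) :=
  -- Loop bounds in the program must not depend on counters, so `s` runs over all of `k` and
  -- truncated subtraction selects `s < t`. With natural parameters the phase `-1/b`, where `b =
  -- 2^(t+1-s)`, is written as `(b-1)/b`.
  ((List.range k).flatMap fun s => if t - s ≠ 0 then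
    [⟨.phase (2 ^ k / 2 ^ (k - (t + 1) + s) - 1) (2 ^ k / 2 ^ (k - (t + 1) + s)),
      [r + s], r + t⟩] else []) ++ unitL (.rot 1 2) [] (r + t)

theorem exp_complement {b : ℕ} (hb : 0 < b) :
    Complex.exp (2 * Real.pi * Complex.I * (((b - 1 : ℕ) : ℂ) / b))
      = Complex.exp (-(2 * Real.pi * Complex.I) / b) := by
  have hb' : (b : ℂ) ≠ 0 := by exact_mod_cast hb.ne'
  rw [Nat.cast_sub hb, ← mul_one (Complex.exp (-(2 * Real.pi * Complex.I) / b)),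
    ← Complex.exp_two_pi_mul_I, ← Complex.exp_add]
  congr 1
  field_simp
  push_cast
  ring

theorem acts_fourier_phases {r k t : ℕ} (ht : t < k) (S : ℕ) (hS : S ≤ k) (Ψ : (ℕ → Bool) → ℂ)
    (m : ℕ → Bool) :
    acts v ((List.range S).flatMap fun s => if t - s ≠ 0 then
    [(⟨.phase (2 ^ k / 2 ^ (k - (t + 1) + s) - 1) (2 ^ k / 2 ^ (k - (t + 1) + s)),
      [r + s], r + t⟩ : Gate ℕ)] else []) Ψ m
      = (if m (r + t) then Complex.exp (-(2 * Real.pi * Complex.I)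
          * (ofDigits (fun l => m (r + l)) (min S t) : ℕ) / 2 ^ (t + 1)) else 1) * Ψ m := by
  induction S with
  | zero => simp [ofDigits]
  | succ S ih =>
    rw [List.range_succ, List.flatMap_append, List.flatMap_singleton, acts_append]
    by_cases hs : t - S ≠ 0
    · have hpow : 2 ^ k / 2 ^ (k - (t + 1) + S) = 2 ^ (t + 1 - S) := by
        rw [Nat.pow_div (by omega) (by norm_num)]
        congr 1
        omega
      rw [if_pos hs, acts_cons, acts_nil, act_phase, ih (by omega), hpow,
        exp_complement (Nat.two_pow_pos _), min_eq_left (by omega), min_eq_left (by omega)]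
      have e : (2 : ℂ) ^ (t + 1) = 2 ^ (t + 1 - S) * 2 ^ S := by
        rw [← pow_add]
        congr 1
        omega
      have h2 : (2 : ℂ) ^ (t + 1 - S) ≠ 0 := pow_ne_zero _ two_ne_zero
      have h3 : (2 : ℂ) ^ S ≠ 0 := pow_ne_zero _ two_ne_zero
      simp only [List.all_cons, List.all_nil, Bool.and_true,
        Function.update_of_ne (show r + S ≠ r + t by omega), ofDigits]
      rw [← mul_assoc]
      congr 1
      cases hmt : m (r + t)
      · simp
      · cases hms : m (r + S)
        · simp
        · simp only [and_self, if_true, Bool.toNat_true, one_mul]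
          rw [← Complex.exp_add]
          congr 1
          rw [e]
          push_cast
          field_simp
          ring
    · rw [if_neg hs, acts_nil, ih (by omega), min_eq_right (by omega), min_eq_right (by omega)]

theorem acts_fourierStageL {r k t : ℕ} (ht : t < k) (Ψ : (ℕ → Bool) → ℂ) (m : ℕ → Bool) :
    acts v (fourierStageL r k t) Ψ m = invSqrtTwo * (Ψ (Function.update m (r + t) false)
      + Complex.exp (-(2 * Real.pi * Complex.I) * (ofDigits (fun l => m (r + l)) (t + 1) : ℕ)
          / 2 ^ (t + 1)) * Ψ (Function.update m (r + t) true)) := by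
  rw [fourierStageL, acts_append, acts_hadamard, acts_fourier_phases v ht k le_rfl,
    acts_fourier_phases v ht k le_rfl, min_eq_right ht.le]
  have e : ∀ b, ofDigits (fun l => Function.update m (r + t) b (r + l)) t
      = ofDigits (fun l => m (r + l)) t := fun b =>
    ofDigits_congr fun q hq => Function.update_of_ne (by omega) _ _
  simp only [Function.update_self, e, if_true, Bool.false_eq_true, if_false, one_mul, ofDigits]
  rw [← mul_assoc]
  congr 3
  cases m (r + t)
  · simp
  · simp only [if_true, Bool.toNat_true, one_mul]
    have h2 : (2 : ℂ) ^ t ≠ 0 := pow_ne_zero _ two_ne_zero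
    rw [← Complex.exp_pi_mul_I, ← Complex.exp_add]
    push_cast
    have key : -(2 * (Real.pi : ℂ) * Complex.I)
        * ((ofDigits (fun l => m (r + l)) t : ℕ) + 2 ^ t) / 2 ^ (t + 1)
        = (Real.pi * Complex.I + -(2 * Real.pi * Complex.I)
          * (ofDigits (fun l => m (r + l)) t : ℕ) / 2 ^ (t + 1)) - 2 * Real.pi * Complex.I := by
      rw [pow_succ]
      field_simp
      ring
    rw [key, Complex.exp_sub, Complex.exp_two_pi_mul_I, div_one]

theorem sum_range_two_mul {M : Type*} [AddCommMonoid M] (f : ℕ → M) (N : ℕ) :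
    ∑ j ∈ Finset.range (2 * N), f j = ∑ j ∈ Finset.range N, (f (2 * j) + f (2 * j + 1)) := by
  induction N with
  | zero => simp
  | succ N ih =>
    rw [show 2 * (N + 1) = 2 * N + 1 + 1 by ring, Finset.sum_range_succ, Finset.sum_range_succ, ih,
      Finset.sum_range_succ, add_assoc]

/-- The index is stored with its most significant bit in qubit `r`, so no final swaps are needed.
After `T` stages the top `T` bits of the index have been summed out, and the same qubits hold the
`T` lowest bits of the frequency. The next stage splits the sum over `J` into even and odd terms. -/
theorem acts_fourier {r k : ℕ} (F : ℕ → (ℕ → Bool) → ℂ)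
    (hF : ∀ j, ∀ t < k, ∀ m b, F j (Function.update m (r + t) b) = F j m) (T : ℕ) (hT : T ≤ k)
    (m : ℕ → Bool) :
    acts v ((List.range T).flatMap (fourierStageL r k))
      (fun m => F (ofDigits (fun l => m (r + (k - 1 - l))) k) m) m
      = invSqrtTwo ^ T * ∑ J ∈ Finset.range (2 ^ T),
        Complex.exp (-(2 * Real.pi * Complex.I) * (J * (ofDigits (fun l => m (r + l)) T : ℕ))
          / 2 ^ T) * F (J * 2 ^ (k - T) + ofDigits (fun l => m (r + (k - 1 - l))) (k - T)) m := by
  induction T generalizing m with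
  | zero => simp
  | succ T ih =>
    rw [List.range_succ, List.flatMap_append, List.flatMap_singleton, acts_append,
      acts_fourierStageL v (by omega), ih (by omega), ih (by omega), pow_succ (2 : ℕ) T, mul_comm (2 ^ T) 2,
      sum_range_two_mul, pow_succ invSqrtTwo T]
    have e1 : ∀ b, ofDigits (fun l => Function.update m (r + T) b (r + l)) T
      = ofDigits (fun l => m (r + l)) T := fun b =>
      ofDigits_congr fun q hq => Function.update_of_ne (by omega) _ _
    have e2 : ∀ b, ofDigits (fun l => Function.update m (r + T) b (r + (k - 1 - l))) (k - T)
        = ofDigits (fun l => m (r + (k - 1 - l))) (k - (T + 1)) + b.toNat * 2 ^ (k - (T + 1)) := by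
      intro b
      rw [show k - T = k - (T + 1) + 1 by omega, ofDigits]
      congr 1
      · exact ofDigits_congr fun q hq => Function.update_of_ne (by omega) _ _
      · rw [show r + (k - 1 - (k - (T + 1))) = r + T by omega, Function.update_self]
    simp only [e1, e2, hF _ T (by omega)]
    have e3 : 2 ^ (k - T) = 2 * 2 ^ (k - (T + 1)) := by
      rw [← pow_succ']
      congr 1
      omega
    have h2 : (2 : ℂ) ^ T ≠ 0 := pow_ne_zero _ two_ne_zero
    have key : ∀ J : ℕ, Complex.exp (-(2 * Real.pi * Complex.I)
        * (J * (ofDigits (fun l => m (r + l)) (T + 1) : ℕ)) / 2 ^ T)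
        = Complex.exp (-(2 * Real.pi * Complex.I)
        * (J * (ofDigits (fun l => m (r + l)) T : ℕ)) / 2 ^ T) := by
      intro J
      rw [ofDigits, Complex.exp_eq_exp_iff_exists_int]
      refine ⟨-(J * (m (r + T)).toNat), ?_⟩
      push_cast
      field_simp
      ring
    generalize -(2 * (Real.pi : ℂ) * Complex.I) = P at *
    have hA : ∀ J : ℕ, Complex.exp (P * (J * (ofDigits (fun l => m (r + l)) T : ℕ)) / 2 ^ T)
        * F (J * 2 ^ (k - T) + (ofDigits (fun l => m (r + (k - 1 - l))) (k - (T + 1))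
          + false.toNat * 2 ^ (k - (T + 1)))) m
        = Complex.exp (P * ((2 * J : ℕ) * (ofDigits (fun l => m (r + l)) (T + 1) : ℕ))
          / 2 ^ (T + 1)) * F (2 * J * 2 ^ (k - (T + 1))
            + ofDigits (fun l => m (r + (k - 1 - l))) (k - (T + 1))) m := by
      intro J
      rw [← key J]
      congr 1
      · congr 1
        rw [pow_succ]
        push_cast
        field_simp
      · congr 1
        rw [e3]
        simp
        ring
    have hB : ∀ J : ℕ, Complex.exp (P * (ofDigits (fun l => m (r + l)) (T + 1) : ℕ) / 2 ^ (T + 1))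
        * (Complex.exp (P * (J * (ofDigits (fun l => m (r + l)) T : ℕ)) / 2 ^ T)
        * F (J * 2 ^ (k - T) + (ofDigits (fun l => m (r + (k - 1 - l))) (k - (T + 1))
          + true.toNat * 2 ^ (k - (T + 1)))) m)
        = Complex.exp (P * ((2 * J + 1 : ℕ) * (ofDigits (fun l => m (r + l)) (T + 1) : ℕ))
          / 2 ^ (T + 1)) * F ((2 * J + 1) * 2 ^ (k - (T + 1))
            + ofDigits (fun l => m (r + (k - 1 - l))) (k - (T + 1))) m := by
      intro J
      rw [← key J, ← mul_assoc, ← Complex.exp_add]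
      congr 1
      · congr 1
        rw [pow_succ]
        push_cast
        field_simp
        ring
      · congr 1
        rw [e3]
        simp
        ring
    simp only [Finset.sum_add_distrib, ← hA, ← hB, ← Finset.mul_sum]
    ring

end

theorem sum_indClean {N r k : ℕ} (hN : r + k ≤ N) (g : ℕ → ℝ) :
    ∑ s : Fin N → Bool, ‖indClean r k (bit s)‖ ^ 2 * g (ofDigits (fun l => bit s (r + l)) k)
      = ∑ y ∈ Finset.range (2 ^ k), g y := by
  induction k generalizing g with
  | zero =>
    rw [Finset.sum_eq_single fun _ => false]
    · have : Clean 0 r 0 (bit fun _ : Fin N => false) := fun a _ _ => by simp [bit]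
      simp [indClean, this, ofDigits]
    · intro s _ hs
      have : ¬ Clean 0 r 0 (bit s) := fun h => hs (funext fun a => by
        have := h a (Nat.zero_le _) (by omega)
        simpa [bit] using this)
      simp [indClean, this]
    · simp
  | succ k ih =>
    rw [sum_bit_split (show r + k < N by omega) fun m =>
      ‖indClean r (k + 1) m‖ ^ 2 * g (ofDigits (fun l => m (r + l)) (k + 1)), pow_succ, mul_two,
      Finset.sum_range_add, ← ih (by omega) g, ← ih (by omega) fun y => g (2 ^ k + y),
      ← Finset.sum_add_distrib]
    refine Finset.sum_congr rfl fun s _ => ?_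
    cases hs : bit s (r + k)
    · have h1 : Clean 0 r (k + 1) (bit s) ↔ Clean 0 r k (bit s) := by
        refine ⟨fun h a _ ha => ?_, fun h a _ ha => h a (Nat.zero_le _) (by omega)⟩
        by_cases h' : a = r + k
        · rw [h', hs]
        · exact h a (Nat.zero_le _) (by omega)
      have h2 : Clean 0 r (k + 1) (Function.update (bit s) (r + k) true) ↔
          Clean 0 r k (bit s) := by
        rw [← h1]
        refine forall₃_congr fun a _ ha => ?_
        rw [Function.update_of_ne (by omega)]
      have e1 : ofDigits (fun l => Function.update (bit s) (r + k) true (r + l)) k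
          = ofDigits (fun l => bit s (r + l)) k :=
        ofDigits_congr fun q hq => Function.update_of_ne (by omega) _ _
      simp only [indClean_congr h1, indClean_congr h2, ofDigits, hs, Function.update_self, e1, Bool.toNat_true,
        Bool.toNat_false, if_false, Bool.false_eq_true]
      rw [one_mul, zero_mul, add_zero, add_comm (2 ^ k)]
    · rw [indClean_eq_zero (r := r) (k := k) (a := r + k) (by omega) _ hs]
      simp

/-! ### The distribution of the outcome of phase estimation -/

/-- The probability of the outcome `y` of phase estimation with `M` values for the phase `φ / π`. -/
def phaseProb (M : ℕ) (φ : ℝ) (y : ℕ) : ℝ :=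
  ‖(1 / M : ℂ) * ∑ J ∈ Finset.range M,
    Complex.exp (Complex.I * (2 * (φ - Real.pi * y / M) : ℝ)) ^ J‖ ^ 2

theorem phaseProb_nonneg (M : ℕ) (φ : ℝ) (y : ℕ) : 0 ≤ phaseProb M φ y := by
  unfold phaseProb; positivity

/-- Parseval's identity: summation over `y` of powers of a primitive `M`-th root of unity leaves
only the diagonal terms `J = J'`. -/
theorem sum_phaseProb {M : ℕ} (hM : 0 < M) (φ : ℝ) :
    ∑ y ∈ Finset.range M, phaseProb M φ y = 1 := by
  have hM' : (M : ℂ) ≠ 0 := by exact_mod_cast hM.ne'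
  set a := Complex.exp (Complex.I * (2 * φ : ℝ)) with ha
  set ζ := Complex.exp (-(2 * Real.pi * Complex.I / M)) with hζ
  have hprim : IsPrimitiveRoot ζ M := by
    rw [hζ, Complex.exp_neg]
    exact (Complex.isPrimitiveRoot_exp M hM.ne').inv
  have ha0 : a ≠ 0 := Complex.exp_ne_zero _
  have hζ0 : ζ ≠ 0 := Complex.exp_ne_zero _
  have hw : ∀ y : ℕ, Complex.exp (Complex.I * (2 * (φ - Real.pi * y / M) : ℝ)) = a * ζ ^ y := by
    intro y
    rw [ha, hζ, ← Complex.exp_nat_mul, ← Complex.exp_add]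
    congr 1
    push_cast
    field_simp
    ring
  have hconj : ∀ y : ℕ, (starRingEnd ℂ) (a * ζ ^ y) = a⁻¹ * (ζ⁻¹) ^ y := by
    intro y
    rw [← hw, ← Complex.exp_conj, inv_pow, ← mul_inv, ← hw, ← Complex.exp_neg]
    congr 1
    rw [map_mul, Complex.conj_I, Complex.conj_ofReal, neg_mul]
  have hgeom : ∀ J ∈ Finset.range M, ∀ J' ∈ Finset.range M,
      ∑ y ∈ Finset.range M, (a * ζ ^ y) ^ J * (a⁻¹ * ζ⁻¹ ^ y) ^ J' = if J = J' then (M : ℂ) else 0 := by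
    intro J hJ J' hJ'
    rw [Finset.mem_range] at hJ hJ'
    have e : ∀ y, (a * ζ ^ y) ^ J * (a⁻¹ * ζ⁻¹ ^ y) ^ J' = (a ^ J * a⁻¹ ^ J') * (ζ ^ J * ζ⁻¹ ^ J') ^ y := by
      intro y
      rw [mul_pow, mul_pow, mul_pow]
      rw [← pow_mul, ← pow_mul, ← pow_mul, ← pow_mul, mul_comm y, mul_comm y]
      ring
    simp only [e, ← Finset.mul_sum]
    split_ifs with h
    · subst h
      rw [← mul_pow, ← mul_pow, mul_inv_cancel₀ ha0, mul_inv_cancel₀ hζ0]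
      simp
    · have hx : ζ ^ J * ζ⁻¹ ^ J' ≠ 1 := by
        intro hx
        rw [inv_pow, mul_inv_eq_one₀ (pow_ne_zero _ hζ0)] at hx
        exact h (hprim.pow_inj hJ hJ' hx)
      have h2 := mul_geom_sum (ζ ^ J * ζ⁻¹ ^ J') M
      have h3 : (ζ ^ J * ζ⁻¹ ^ J') ^ M = 1 := by
        rw [mul_pow, ← pow_mul, ← pow_mul, mul_comm J, mul_comm J', pow_mul, pow_mul, inv_pow,
          hprim.pow_eq_one]
        simp
      rw [h3, sub_self] at h2
      rw [(mul_eq_zero.1 h2).resolve_left (sub_ne_zero.2 hx), mul_zero]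
  have key : ((∑ y ∈ Finset.range M, phaseProb M φ y : ℝ) : ℂ) = 1 := by
    have e : ∀ y : ℕ, ((phaseProb M φ y : ℝ) : ℂ) = (1 / M : ℂ) ^ 2 *
        ∑ J ∈ Finset.range M, ∑ J' ∈ Finset.range M, (a * ζ ^ y) ^ J * (a⁻¹ * ζ⁻¹ ^ y) ^ J' := by
      intro y
      rw [phaseProb, Complex.ofReal_pow, ← Complex.mul_conj', hw, map_mul, map_sum]
      simp only [map_pow, hconj]
      rw [← Finset.sum_mul_sum]
      simp only [map_div₀, map_one, Complex.conj_natCast]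
      ring
    rw [Complex.ofReal_sum, Finset.sum_congr rfl fun y _ => e y, ← Finset.mul_sum, Finset.sum_comm]
    rw [Finset.sum_congr rfl fun J hJ => by
      rw [Finset.sum_comm, Finset.sum_congr rfl fun J' hJ' => hgeom J hJ J' hJ',
        Finset.sum_ite_eq, if_pos hJ]]
    rw [Finset.sum_const, Finset.card_range, nsmul_eq_mul]
    field_simp
  exact_mod_cast key

/-- The sum is geometric with ratio `w` on the unit circle: the numerator has norm at most `2`, and
`‖w - 1‖ = 2 |sin x|`. -/
theorem phaseProb_le {M : ℕ} (φ : ℝ) (y : ℕ) (h : Real.sin (φ - Real.pi * y / M) ≠ 0) :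
    phaseProb M φ y ≤ 1 / (M ^ 2 * Real.sin (φ - Real.pi * y / M) ^ 2) := by
  set x := φ - Real.pi * y / M with hx
  set w := Complex.exp (Complex.I * (2 * x : ℝ)) with hw
  have h1 : ‖w - 1‖ = 2 * |Real.sin x| := by
    rw [hw, Complex.norm_exp_I_mul_ofReal_sub_one]
    rw [mul_div_cancel_left₀ x two_ne_zero, Real.norm_eq_abs, abs_mul, abs_two]
  have h2 : 0 < |Real.sin x| := abs_pos.2 h
  have h3 : ‖∑ J ∈ Finset.range M, w ^ J‖ ≤ 1 / |Real.sin x| := by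
    have h4 := mul_geom_sum w M
    have h5 : ‖w ^ M - 1‖ ≤ 2 := by
      refine (norm_sub_le _ _).trans ?_
      rw [norm_pow, hw, Complex.norm_exp_I_mul_ofReal]
      norm_num
    rw [← h4, norm_mul, h1] at h5
    rw [le_div_iff₀ h2]
    nlinarith
  unfold phaseProb
  rw [norm_mul, mul_pow]
  have h6 : ‖(1 / M : ℂ)‖ ^ 2 = 1 / (M : ℝ) ^ 2 := by simp
  rw [h6]
  calc 1 / (M : ℝ) ^ 2 * ‖∑ J ∈ Finset.range M, w ^ J‖ ^ 2
      ≤ 1 / (M : ℝ) ^ 2 * (1 / |Real.sin x|) ^ 2 := by gcongr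
    _ = _ := by rw [div_pow, sq_abs, one_pow, div_mul_div_comm, one_mul]

/-- The inverse squares from `81` on. -/
def invSq (i : ℕ) : ℝ := if 81 ≤ i then 1 / (i : ℝ) ^ 2 else 0

theorem invSq_nonneg (i : ℕ) : 0 ≤ invSq i := by
  unfold invSq; split_ifs; exacts [by positivity, le_rfl]

theorem sum_invSq_le (M : ℕ) : ∑ i ∈ Finset.range M, invSq i ≤ 1 / 80 := by
  have key : ∀ M, 81 ≤ M → ∑ i ∈ Finset.range M, invSq i ≤ 1 / 80 - 1 / ((M : ℝ) - 1) := by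
    intro M hM
    induction M, hM using Nat.le_induction with
    | base =>
      rw [Finset.sum_eq_zero]
      · norm_num
      · intro i hi
        rw [Finset.mem_range] at hi
        exact if_neg (by omega)
    | succ M hM ih =>
      rw [Finset.sum_range_succ, invSq, if_pos hM]
      have h1 : (81 : ℝ) ≤ M := by exact_mod_cast hM
      have h2 : 1 / (M : ℝ) ^ 2 ≤ 1 / ((M : ℝ) - 1) - 1 / (M : ℝ) := by
        rw [div_sub_div _ _ (by linarith) (by linarith), div_le_div_iff₀ (by positivity)
          (mul_pos (by linarith) (by linarith))]
        nlinarith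
      push_cast
      rw [add_sub_cancel_right]
      linarith
  by_cases hM : 81 ≤ M
  · have h1 : (81 : ℝ) ≤ M := by exact_mod_cast hM
    have : 0 ≤ 1 / ((M : ℝ) - 1) := by apply div_nonneg <;> linarith
    linarith [key M hM]
  · rw [Finset.sum_eq_zero]
    · norm_num
    · intro i hi
      rw [Finset.mem_range] at hi
      exact if_neg (by omega)

theorem two_mul_min_le_sin {u : ℝ} (h0 : 0 ≤ u) (h1 : u ≤ 1) :
    2 * min u (1 - u) ≤ Real.sin (Real.pi * u) := by
  have hpi := Real.pi_pos
  rcases le_total u (1 / 2) with h | h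
  · have := Real.mul_le_sin (x := Real.pi * u) (by positivity) (by nlinarith)
    have e : 2 / Real.pi * (Real.pi * u) = 2 * u := by field_simp
    rw [e] at this
    exact (mul_le_mul_of_nonneg_left (min_le_left _ _) (by norm_num)).trans this
  · have := Real.mul_le_sin (x := Real.pi * (1 - u)) (by nlinarith) (by nlinarith)
    have e : 2 / Real.pi * (Real.pi * (1 - u)) = 2 * (1 - u) := by field_simp
    rw [e, show Real.pi * (1 - u) = Real.pi - Real.pi * u by ring, Real.sin_pi_sub] at this
    exact (mul_le_mul_of_nonneg_left (min_le_right _ _) (by norm_num)).trans this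

/-- The condition on the sine forces the cyclic distance to the peak above `256/π > 81` on both
sides. Concavity gives `sin (π u) ≥ 2 min u (1 - u)`, and dropping `f` from the two distances leaves
the integers `j - 1` and `M - j`. -/
theorem inv_sin_sq_le {M : ℕ} {f τ : ℝ} (hτ : 256 ≤ M * τ) (hf0 : 0 ≤ f) (hf1 : f < 1) {j : ℕ}
    (hj : j < M) (hs : τ < |Real.sin (Real.pi * ((j - f) / M))|) :
    1 / (M ^ 2 * Real.sin (Real.pi * ((j - f) / M)) ^ 2)
      ≤ 1 / 4 * (invSq (j - 1) + invSq (M - j)) := by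
  have hpi := Real.pi_pos
  have hpi4 := Real.pi_lt_d2
  have hM : (0 : ℝ) < M := by exact_mod_cast (show 0 < M by omega)
  have hjM : (j : ℝ) + 1 ≤ M := by exact_mod_cast hj
  have a1 : 81 < |(j : ℝ) - f| := by
    have := hs.trans_le (Real.abs_sin_le_abs (x := Real.pi * ((j - f) / M)))
    rw [abs_mul, abs_div, abs_of_pos hpi, abs_of_pos hM] at this
    rw [← mul_div_assoc, lt_div_iff₀ hM] at this
    nlinarith [abs_nonneg ((j : ℝ) - f)]
  have a2 : 81 < (j : ℝ) - f := by
    rcases lt_abs.1 a1 with h | h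
    · exact h
    · have : (0 : ℝ) ≤ j := Nat.cast_nonneg j
      linarith
  have a3 : 81 < (M : ℝ) - j + f := by
    have e : Real.sin (Real.pi * ((j - f) / M)) = Real.sin (Real.pi * ((M - j + f) / M)) := by
      rw [← Real.sin_pi_sub]
      congr 1
      field_simp
      ring
    rw [e] at hs
    have := hs.trans_le (Real.abs_sin_le_abs (x := Real.pi * ((M - j + f) / M)))
    rw [abs_mul, abs_div, abs_of_pos hpi, abs_of_pos hM, abs_of_pos (by linarith)] at this
    rw [← mul_div_assoc, lt_div_iff₀ hM] at this
    nlinarith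
  have b1 : 82 ≤ j := by
    have : (81 : ℝ) < j := by linarith
    exact_mod_cast this
  have b2 : 81 ≤ M - j := by
    have h : (80 : ℝ) < (M : ℝ) - j := by linarith
    rw [← Nat.cast_sub hj.le] at h
    exact_mod_cast h
  have hu0 : 0 ≤ (j - f) / (M : ℝ) := div_nonneg (by linarith) hM.le
  have hu1 : (j - f) / (M : ℝ) ≤ 1 := by rw [div_le_one hM]; linarith
  have hsin := two_mul_min_le_sin hu0 hu1
  have c1 : ((j - 1 : ℕ) : ℝ) = j - 1 := by rw [Nat.cast_sub (by omega)]; simp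
  have c2 : ((M - j : ℕ) : ℝ) = M - j := by rw [Nat.cast_sub hj.le]
  have hpos1 : (0 : ℝ) < j - 1 := by linarith
  have hpos2 : (0 : ℝ) < M - j := by linarith
  have e2 : 1 - (j - f) / (M : ℝ) = (M - j + f) / M := by field_simp; ring
  rw [e2] at hsin
  unfold invSq
  rw [if_pos (by omega), if_pos b2, c1, c2, ← mul_pow]
  rcases min_choice ((j - f) / (M : ℝ)) ((M - j + f) / M) with h | h
  · rw [h] at hsin
    have h5 : 2 * (j - 1) ≤ M * Real.sin (Real.pi * ((j - f) / M)) := by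
      have := mul_le_mul_of_nonneg_left hsin hM.le
      have e3 : (M : ℝ) * (2 * ((j - f) / M)) = 2 * (j - f) := by field_simp
      linarith
    have h6 : 1 / (M * Real.sin (Real.pi * ((j - f) / M))) ^ 2 ≤ 1 / (2 * ((j : ℝ) - 1)) ^ 2 := by
      gcongr
    have h7 : 1 / (2 * ((j : ℝ) - 1)) ^ 2 = 1 / 4 * (1 / ((j : ℝ) - 1) ^ 2) := by field_simp; norm_num
    have h8 : 0 ≤ 1 / ((M : ℝ) - j) ^ 2 := by positivity
    linarith
  · rw [h] at hsin
    have h5 : 2 * (M - j) ≤ M * Real.sin (Real.pi * ((j - f) / M)) := by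
      have := mul_le_mul_of_nonneg_left hsin hM.le
      have e3 : (M : ℝ) * (2 * ((M - j + f) / M)) = 2 * (M - j + f) := by field_simp
      linarith
    have h6 : 1 / (M * Real.sin (Real.pi * ((j - f) / M))) ^ 2 ≤ 1 / (2 * ((M : ℝ) - j)) ^ 2 := by
      gcongr
    have h7 : 1 / (2 * ((M : ℝ) - j)) ^ 2 = 1 / 4 * (1 / ((M : ℝ) - j) ^ 2) := by field_simp; norm_num
    have h8 : 0 ≤ 1 / ((j : ℝ) - 1) ^ 2 := by positivity
    linarith

theorem sum_range_emod {M : ℕ} (hM : 0 < M) (z : ℤ) (g : ℕ → ℝ) :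
    ∑ y ∈ Finset.range M, g (((y : ℤ) - z) % M).toNat = ∑ j ∈ Finset.range M, g j := by
  have hM' : (M : ℤ) ≠ 0 := by omega
  have hb : ∀ a : ℤ, 0 ≤ a % M ∧ a % M < M := fun a =>
    ⟨Int.emod_nonneg _ hM', Int.emod_lt_of_pos _ (by omega)⟩
  refine Finset.sum_nbij' (fun y => (((y : ℤ) - z) % M).toNat) (fun j => (((j : ℤ) + z) % M).toNat)
    ?_ ?_ ?_ ?_ ?_
  · intro y _
    have := hb (y - z)
    simp only [Finset.mem_range]
    omega
  · intro y _
    have := hb (y + z)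
    simp only [Finset.mem_range]
    omega
  · intro y hy
    rw [Finset.mem_range] at hy
    rw [Int.toNat_of_nonneg (hb _).1, Int.emod_add_emod, sub_add_cancel,
      Int.emod_eq_of_lt (by omega) (by omega)]
    simp
  · intro y hy
    rw [Finset.mem_range] at hy
    rw [Int.toNat_of_nonneg (hb _).1, Int.emod_sub_emod, add_sub_cancel_right,
      Int.emod_eq_of_lt (by omega) (by omega)]
    simp
  · intro y _
    rfl

theorem sum_phaseProb_bad_le {M : ℕ} (hM : 0 < M) {τ : ℝ} (hτ0 : 0 < τ) (hτ : 256 ≤ M * τ) (φ : ℝ) :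
    ∑ y ∈ Finset.range M, (if τ < |Real.sin (φ - Real.pi * y / M)| then phaseProb M φ y else 0)
      ≤ 1 / 160 := by
  have hpi := Real.pi_pos
  have hMr : (M : ℝ) ≠ 0 := by exact_mod_cast hM.ne'
  have hM' : (M : ℤ) ≠ 0 := by omega
  -- The distribution peaks at `x` modulo `M`. The residue `j` of `y - ⌊x⌋` measures the distance
  -- from the peak, and shifting by multiples of `M` changes the sine only in sign.
  set x := M * φ / Real.pi with hx
  set z := ⌊x⌋ with hz
  set f := Int.fract x with hf
  have hxz : x = z + f := (Int.floor_add_fract x).symm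
  calc ∑ y ∈ Finset.range M,
        (if τ < |Real.sin (φ - Real.pi * y / M)| then phaseProb M φ y else 0)
      ≤ ∑ y ∈ Finset.range M, (fun j : ℕ => 1 / 4 * (invSq (j - 1) + invSq (M - j)))
          (((y : ℤ) - z) % M).toNat := by
        refine Finset.sum_le_sum fun y hy => ?_
        set j := (((y : ℤ) - z) % M).toNat with hj
        have hj1 : (j : ℤ) = ((y : ℤ) - z) % M := by
          rw [hj, Int.toNat_of_nonneg (Int.emod_nonneg _ hM')]
        have hjM : j < M := by
          have := Int.emod_lt_of_pos ((y : ℤ) - z) (show (0 : ℤ) < M by omega)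
          omega
        have h1 := Int.emod_add_mul_ediv ((y : ℤ) - z) M
        rw [← hj1] at h1
        set t := ((y : ℤ) - z) / M with ht
        have h2 : (j : ℝ) + M * t = y - z := by exact_mod_cast h1
        have e : φ - Real.pi * y / M = -(Real.pi * ((j - f) / M)) - t * Real.pi := by
          have : φ = Real.pi * x / M := by rw [hx]; field_simp
          rw [this, hxz]
          have h3 : (y : ℝ) = j + M * t + z := by linarith
          rw [h3]
          field_simp
          ring
        have e2 : |Real.sin (φ - Real.pi * y / M)| = |Real.sin (Real.pi * ((j - f) / M))| := by
          rw [e, Real.sin_sub_int_mul_pi, Real.sin_neg, abs_mul, abs_neg, abs_zpow, abs_neg, abs_one,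
            one_zpow, one_mul]
        have e3 : Real.sin (φ - Real.pi * y / M) ^ 2 = Real.sin (Real.pi * ((j - f) / M)) ^ 2 := by
          rw [← sq_abs, e2, sq_abs]
        simp only
        split_ifs with h
        · have hne : Real.sin (φ - Real.pi * y / M) ≠ 0 := by
            intro h0
            rw [h0, abs_zero] at h
            linarith
          refine (phaseProb_le φ y hne).trans ?_
          rw [e3]
          exact inv_sin_sq_le hτ (Int.fract_nonneg x) (Int.fract_lt_one x) hjM (e2 ▸ h)
        · have := invSq_nonneg (j - 1)
          have := invSq_nonneg (M - j)
          linarith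
    _ = ∑ j ∈ Finset.range M, 1 / 4 * (invSq (j - 1) + invSq (M - j)) := sum_range_emod hM z fun j : ℕ => 1 / 4 * (invSq (j - 1) + invSq (M - j))
    _ ≤ 1 / 160 := by
        rw [← Finset.mul_sum, Finset.sum_add_distrib]
        have s1 : ∑ j ∈ Finset.range M, invSq (j - 1) ≤ 1 / 80 := by
          obtain ⟨M', rfl⟩ : ∃ M', M = M' + 1 := ⟨M - 1, by omega⟩
          rw [Finset.sum_range_succ']
          simp only [Nat.add_sub_cancel]
          have : invSq (0 - 1) = 0 := if_neg (by omega)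
          rw [this, add_zero]
          exact sum_invSq_le M'
        have s2 : ∑ j ∈ Finset.range M, invSq (M - j) ≤ 1 / 80 := by
          rw [← Finset.sum_range_reflect]
          have : ∑ j ∈ Finset.range M, invSq (M - (M - 1 - j))
              = ∑ j ∈ Finset.range M, invSq (j + 1) := by
            refine Finset.sum_congr rfl fun j hj => ?_
            rw [Finset.mem_range] at hj
            congr 1
            omega
          rw [this]
          have h3 := sum_invSq_le (M + 1)
          rw [Finset.sum_range_succ'] at h3
          linarith [invSq_nonneg 0]
        linarith

/-! ### Amplitude estimation -/

section
variable {c : ℕ → (ℕ → Bool) → Bool} {q : ℕ → (ℕ → Bool) → ℝ} {R r k : ℕ}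
  {χ ζ : (ℕ → Bool) → Bool} {p : ℝ}

/-- The prepared state does not depend on the control register, so it is a constant factor for the
Fourier transform. -/
theorem fwd_update {a : ℕ} (ha : R ≤ a) (hc : ∀ j < R, ∀ m b, c j (Function.update m a b) = c j m)
    (hq : ∀ j < R, ∀ m b, q j (Function.update m a b) = q j m) {δ : (ℕ → Bool) → ℂ}
    (hδ : ∀ m b, δ (Function.update m a b) = δ m) (m : ℕ → Bool) (b : Bool) :
    fwd c q R δ (Function.update m a b) = fwd c q R δ m := by
  induction R generalizing m with
  | zero => exact hδ m b
  | succ R ih =>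
    have hcomm : ∀ x, Function.update (Function.update m a b) R x
        = Function.update (Function.update m R x) a b := fun x =>
      Function.update_comm (by omega) _ _ _
    have ih' := ih (by omega) (fun j hj => hc j (by omega)) (fun j hj => hq j (by omega))
    rw [fwd]
    unfold refl
    rw [hcomm, hcomm, hc R (by omega), hq R (by omega), ih', ih', ih',
      Function.update_of_ne (by omega)]

theorem indClean_update {t : ℕ} (ht : t < k) (m : ℕ → Bool) (b : Bool) :
    indClean r k (Function.update m (r + t) b) = indClean r k m := by
  refine indClean_congr (forall₃_congr fun a _ ha => ?_)
  rw [Function.update_of_ne (by omega)]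

theorem exp_mul_neg_one_pow (y : ℝ) (θ : ℝ) (J : ℕ) :
    Complex.exp (Complex.I * (2 * (θ + Real.pi / 2 - y) : ℝ)) ^ J
      = Complex.exp (-(2 * Complex.I * y) * J) * ((-1) ^ J * Complex.exp (2 * J * θ * Complex.I)) := by
  have : (-1 : ℂ) ^ J = Complex.exp (J * (Real.pi * Complex.I)) := by
    rw [Complex.exp_nat_mul, Complex.exp_pi_mul_I]
  rw [this, ← Complex.exp_nat_mul, ← Complex.exp_add, ← Complex.exp_add]
  congr 1
  push_cast
  ring

/-- Sine and cosine are half the difference and half the sum of two exponentials. The parallelogram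
law removes the interference of the two eigenphases once the good and the bad part are added. -/
theorem norm_sq_half_add_sub (z w : ℂ) :
    ‖(z - w) / (2 * Complex.I)‖ ^ 2 + ‖(z + w) / 2‖ ^ 2 = (‖z‖ ^ 2 + ‖w‖ ^ 2) / 2 := by
  simp only [norm_div, norm_mul, Complex.norm_I, Complex.norm_ofNat, mul_one, div_pow]
  have := parallelogram_law_with_norm ℝ z w
  linarith

/-- The two amplitudes of the outcome `y` contribute the distributions of phase estimation for
the two eigenphases. -/
theorem ampCoeff_fourier {θ : ℝ} (hp : p = Real.sin θ ^ 2) (M y : ℕ) :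
    ‖(1 / M : ℂ) * ∑ J ∈ Finset.range M, Complex.exp (-(2 * Real.pi * Complex.I) * (J * y) / M)
        * ((ampCoeff p J).1 : ℂ)‖ ^ 2 * p
      + ‖(1 / M : ℂ) * ∑ J ∈ Finset.range M, Complex.exp (-(2 * Real.pi * Complex.I) * (J * y) / M)
        * ((ampCoeff p J).2 : ℂ)‖ ^ 2 * (1 - p)
      = (phaseProb M (θ + Real.pi / 2) y + phaseProb M (-θ + Real.pi / 2) y) / 2 := by
  have hp' : 1 - p = Real.cos θ ^ 2 := by rw [hp, Real.cos_sq']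
  have hamp := ampCoeff_eq hp
  -- The weights `p` and `1 - p` enter the norms as `sin θ` and `cos θ`; this form also covers the
  -- cases in which one of them vanishes.
  have n1 : ∀ Z : ℂ, ‖Z‖ ^ 2 * p = ‖Z * (Real.sin θ : ℂ)‖ ^ 2 := fun Z => by
    rw [norm_mul, mul_pow, Complex.norm_real, Real.norm_eq_abs, sq_abs, hp]
  have n2 : ∀ Z : ℂ, ‖Z‖ ^ 2 * (1 - p) = ‖Z * (Real.cos θ : ℂ)‖ ^ 2 := fun Z => by
    rw [norm_mul, mul_pow, Complex.norm_real, Real.norm_eq_abs, sq_abs, hp']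
  rw [n1, n2]
  set E : ℕ → ℂ := fun J => Complex.exp (-(2 * Real.pi * Complex.I) * (J * y) / M) with hE
  have hEe : ∀ J : ℕ, E J = Complex.exp (-(2 * Complex.I * (Real.pi * y / M : ℝ)) * J) := by
    intro J
    simp only [hE]
    congr 1
    push_cast
    ring
  set z : ℂ := (1 / M : ℂ) * ∑ J ∈ Finset.range M, E J
    * ((-1) ^ J * Complex.exp (2 * J * θ * Complex.I)) with hz
  set w : ℂ := (1 / M : ℂ) * ∑ J ∈ Finset.range M, E J
    * ((-1) ^ J * Complex.exp (2 * J * (-θ : ℝ) * Complex.I)) with hw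
  have pz : phaseProb M (θ + Real.pi / 2) y = ‖Complex.exp (θ * Complex.I) * z‖ ^ 2 := by
    rw [norm_mul, Complex.norm_exp_ofReal_mul_I, one_mul, phaseProb, hz]
    simp only [exp_mul_neg_one_pow, hEe]
  have pw : phaseProb M (-θ + Real.pi / 2) y = ‖Complex.exp (-θ * Complex.I) * w‖ ^ 2 := by
    rw [norm_mul, ← Complex.ofReal_neg, Complex.norm_exp_ofReal_mul_I, one_mul, phaseProb, hw]
    simp only [exp_mul_neg_one_pow, hEe]
  rw [pz, pw, ← norm_sq_half_add_sub]
  have hsum : ∀ J : ℕ, Complex.exp (θ * Complex.I) * Complex.exp (2 * J * θ * Complex.I)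
      = Complex.exp (((2 * J + 1) * θ : ℝ) * Complex.I) := fun J => by
    rw [← Complex.exp_add]; congr 1; push_cast; ring
  have hsum' : ∀ J : ℕ, Complex.exp (-θ * Complex.I) * Complex.exp (2 * J * (-θ : ℝ) * Complex.I)
      = Complex.exp (-((2 * J + 1) * θ : ℝ) * Complex.I) := fun J => by
    rw [← Complex.exp_add]; congr 1; push_cast; ring
  congr 3
  · rw [hz, hw]
    simp only [Finset.mul_sum, Finset.sum_mul, ← Finset.sum_sub_distrib, Finset.sum_div]
    refine Finset.sum_congr rfl fun J _ => ?_
    change 1 / (M : ℂ) * (E J * _) * _ = _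
    have h1 : ((ampCoeff p J).1 : ℂ) * (Real.sin θ : ℝ)
        = (-1) ^ J * (Real.sin ((2 * J + 1) * θ) : ℝ) := by
      rw [← Complex.ofReal_mul, (hamp J).1]; push_cast; rfl
    rw [mul_assoc, mul_assoc (E J), h1, Complex.ofReal_sin, Complex.sin]
    have h2 : Complex.exp (θ * Complex.I) * ((1 / M : ℂ) * (E J * ((-1) ^ J * Complex.exp (2 * J * θ * Complex.I))))
        = (1 / M : ℂ) * (E J) * ((-1) ^ J * Complex.exp (((2 * J + 1) * θ : ℝ) * Complex.I)) := by
      rw [← hsum]; ring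
    have h3 : Complex.exp (-θ * Complex.I) * ((1 / M : ℂ) * (E J * ((-1) ^ J * Complex.exp (2 * J * (-θ : ℝ) * Complex.I))))
        = (1 / M : ℂ) * (E J) * ((-1) ^ J * Complex.exp (-((2 * J + 1) * θ : ℝ) * Complex.I)) := by
      rw [← hsum']; ring
    rw [h2, h3]
    have hI : ∀ X Y : ℂ, (X - Y) * Complex.I / 2 = (Y - X) / (2 * Complex.I) := fun X Y => by
      field_simp
      linear_combination (X - Y) * Complex.I_sq
    rw [hI]
    ring
  · rw [hz, hw]
    simp only [Finset.mul_sum, Finset.sum_mul, ← Finset.sum_add_distrib, Finset.sum_div]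
    refine Finset.sum_congr rfl fun J _ => ?_
    change 1 / (M : ℂ) * (E J * _) * _ = _
    have h1 : ((ampCoeff p J).2 : ℂ) * (Real.cos θ : ℝ)
        = (-1) ^ J * (Real.cos ((2 * J + 1) * θ) : ℝ) := by
      rw [← Complex.ofReal_mul, (hamp J).2]; push_cast; rfl
    rw [mul_assoc, mul_assoc (E J), h1, Complex.ofReal_cos, Complex.cos]
    have h2 : Complex.exp (θ * Complex.I) * ((1 / M : ℂ) * (E J * ((-1) ^ J * Complex.exp (2 * J * θ * Complex.I))))
        = (1 / M : ℂ) * (E J) * ((-1) ^ J * Complex.exp (((2 * J + 1) * θ : ℝ) * Complex.I)) := by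
      rw [← hsum]; ring
    have h3 : Complex.exp (-θ * Complex.I) * ((1 / M : ℂ) * (E J * ((-1) ^ J * Complex.exp (2 * J * (-θ : ℝ) * Complex.I))))
        = (1 / M : ℂ) * (E J) * ((-1) ^ J * Complex.exp (-((2 * J + 1) * θ : ℝ) * Complex.I)) := by
      rw [← hsum']; ring
    rw [h2, h3]
    ring

/-- Good and bad bit strings are disjoint, so the two parts contribute without a cross term. -/
theorem norm_sq_ind (Ψ A B : ℂ) (m : ℕ → Bool) :
    ‖A * (Ψ * ind χ m) + B * (Ψ * (1 - ind χ m : ℝ))‖ ^ 2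
      = ‖Ψ‖ ^ 2 * (‖A‖ ^ 2 * ind χ m + ‖B‖ ^ 2 * (1 - ind χ m)) := by
  unfold ind
  split_ifs <;> simp [mul_pow] <;> ring

/-- The distribution of the outcome of amplitude estimation. -/
theorem amplitude_estimation (h0 : ∀ k m, 0 ≤ q k m) (h1 : ∀ k m, q k m ≤ 1) (hRr : R ≤ r)
    (hc : ∀ j < R, ∀ a, r ≤ a → ∀ m b, c j (Function.update m a b) = c j m)
    (hq : ∀ j < R, ∀ a, r ≤ a → ∀ m b, q j (Function.update m a b) = q j m)
    (hχr : ∀ a, r ≤ a → ∀ m b, χ (Function.update m a b) = χ m)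
    (hζ : ∀ m, Clean R r k m → (ζ m = true ↔ ∀ a < R, m a = false))
    (hχ : ∀ m, Clean 0 r k m → expect c q R (ind χ) m = p) {θ : ℝ} (hp : p = Real.sin θ ^ 2)
    {d n : ℕ} (v : (Fin d → Fin n) → ℝ) (P : List (Gate ℕ)) (hP : ∀ Φ, acts v P Φ = fwd c q R Φ)
    (G : ℕ → List (Gate ℕ))
    (hG : ∀ y < 2 ^ k - 1, ∀ Φ,
      acts v (G y) Φ = fwd c q R (phaseFlip (r + (k - 1 - Nat.log 2 (y + 1))) ζ
      (bwd c q R (phaseFlip (r + (k - 1 - Nat.log 2 (y + 1))) χ Φ))))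
    {N : ℕ} (hN : r + k ≤ N) (g : ℕ → ℝ) :
    ∑ s : Fin N → Bool, g (ofDigits (fun l => bit s (r + l)) k) *
      ‖acts v (((List.range k).flatMap fun t => unitL (.rot 1 2) [] (r + t)) ++ (P ++
        ((List.range (2 ^ k - 1)).flatMap G ++ (List.range k).flatMap (fourierStageL r k))))
        (fun m => open Classical in if m = fun _ => false then 1 else 0) (bit s)‖ ^ 2
      = ∑ y ∈ Finset.range (2 ^ k), g y * ((phaseProb (2 ^ k) (θ + Real.pi / 2) y
          + phaseProb (2 ^ k) (-θ + Real.pi / 2) y) / 2) := by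
  set Ψ := fwd c q R (indClean r k) with hΨ
  have hΨr : ∀ t < k, ∀ m b, Ψ (Function.update m (r + t) b) = Ψ m := fun t ht =>
    fwd_update (by omega) (fun j hj => hc j hj _ (by omega)) (fun j hj => hq j hj _ (by omega))
      fun m b => indClean_update ht m b
  have e1 : ∀ m, acts v (((List.range k).flatMap fun t => unitL (.rot 1 2) [] (r + t)) ++ (P ++
        ((List.range (2 ^ k - 1)).flatMap G ++ (List.range k).flatMap (fourierStageL r k))))
        (fun m => open Classical in if m = fun _ => false then 1 else 0) m
      = invSqrtTwo ^ k * ∑ J ∈ Finset.range (2 ^ k),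
        Complex.exp (-(2 * Real.pi * Complex.I) * (J * (ofDigits (fun l => m (r + l)) k : ℕ))
          / 2 ^ k) * (invSqrtTwo ^ k * ((ampCoeff p J).1 : ℂ) * (Ψ m * ind χ m)
            + invSqrtTwo ^ k * ((ampCoeff p J).2 : ℂ) * (Ψ m * (1 - ind χ m : ℝ))) := by
    intro m
    rw [acts_append, acts_hadamards, acts_append, hP,
      fwd_mul R (fun _ => invSqrtTwo ^ k) (fun _ _ _ _ => rfl), acts_append,
      amplification_iterate h0 h1 hRr hζ hχ (invSqrtTwo ^ k) v G _ hG]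
    simp only [iterCount_eq, ← hΨ]
    have := acts_fourier v (r := r) (k := k) (fun J m =>
      invSqrtTwo ^ k * ((ampCoeff p J).1 : ℂ) * (Ψ m * ind χ m)
            + invSqrtTwo ^ k * ((ampCoeff p J).2 : ℂ) * (Ψ m * (1 - ind χ m : ℝ)))
      (fun J t ht m b => by
        simp only [hΨr t ht, ind, hχr (r + t) (by omega)]) k le_rfl m
    rw [this]
    simp only [Nat.sub_self, pow_zero, mul_one, ofDigits, add_zero]
  have hs : invSqrtTwo ^ k * invSqrtTwo ^ k = (1 / (2 ^ k : ℕ) : ℂ) := by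
    rw [← mul_pow, invSqrtTwo_mul_self]
    push_cast
    rw [div_pow, one_pow]
  set A : ℕ → ℂ := fun y => (1 / (2 ^ k : ℕ) : ℂ) * ∑ J ∈ Finset.range (2 ^ k),
    Complex.exp (-(2 * Real.pi * Complex.I) * (J * y) / (2 ^ k : ℕ)) * ((ampCoeff p J).1 : ℂ) with hA
  set B : ℕ → ℂ := fun y => (1 / (2 ^ k : ℕ) : ℂ) * ∑ J ∈ Finset.range (2 ^ k),
    Complex.exp (-(2 * Real.pi * Complex.I) * (J * y) / (2 ^ k : ℕ)) * ((ampCoeff p J).2 : ℂ) with hB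
  have e2 : ∀ m, invSqrtTwo ^ k * ∑ J ∈ Finset.range (2 ^ k),
        Complex.exp (-(2 * Real.pi * Complex.I) * (J * (ofDigits (fun l => m (r + l)) k : ℕ))
          / 2 ^ k) * (invSqrtTwo ^ k * ((ampCoeff p J).1 : ℂ) * (Ψ m * ind χ m)
            + invSqrtTwo ^ k * ((ampCoeff p J).2 : ℂ) * (Ψ m * (1 - ind χ m : ℝ)))
      = A (ofDigits (fun l => m (r + l)) k) * (Ψ m * ind χ m)
        + B (ofDigits (fun l => m (r + l)) k) * (Ψ m * (1 - ind χ m : ℝ)) := by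
    intro m
    simp only [hA, hB, ← hs]
    simp only [Finset.mul_sum, Finset.sum_mul, ← Finset.sum_add_distrib]
    refine Finset.sum_congr rfl fun J _ => ?_
    push_cast
    ring
  set f : (ℕ → Bool) → ℝ := fun m => g (ofDigits (fun l => m (r + l)) k)
    * (‖A (ofDigits (fun l => m (r + l)) k)‖ ^ 2 * ind χ m
      + ‖B (ofDigits (fun l => m (r + l)) k)‖ ^ 2 * (1 - ind χ m)) with hf
  have e3 : ∀ s : Fin N → Bool, g (ofDigits (fun l => bit s (r + l)) k) *
      ‖acts v (((List.range k).flatMap fun t => unitL (.rot 1 2) [] (r + t)) ++ (P ++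
        ((List.range (2 ^ k - 1)).flatMap G ++ (List.range k).flatMap (fourierStageL r k))))
        (fun m => open Classical in if m = fun _ => false then 1 else 0) (bit s)‖ ^ 2
      = ‖Ψ (bit s)‖ ^ 2 * f (bit s) := by
    intro s
    rw [e1, e2, norm_sq_ind]
    ring
  have hinv : ∀ t < R, ∀ (m : ℕ → Bool) b, ofDigits (fun l => Function.update m t b (r + l)) k
      = ofDigits (fun l => m (r + l)) k := fun t ht m b =>
    ofDigits_congr fun l _ => by rw [Function.update_of_ne (by omega)]
  -- Summing over the random bits replaces `ind χ` by its expectation `p`; what remains is a sum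
  -- over the control register.
  rw [Finset.sum_congr rfl fun s _ => e3 s, hΨ, sum_norm_sq_fwd h0 h1 R (by omega)
    (fun a ha m hm => indClean_eq_zero (by omega) m hm), ← sum_indClean hN]
  refine Finset.sum_congr rfl fun s _ => ?_
  by_cases hcl : Clean 0 r k (bit s)
  · congr 1
    have e4 : f = fun m => (g (ofDigits (fun l => m (r + l)) k)
          * ‖A (ofDigits (fun l => m (r + l)) k)‖ ^ 2) * ind χ m
        + (g (ofDigits (fun l => m (r + l)) k) * ‖B (ofDigits (fun l => m (r + l)) k)‖ ^ 2)
          * (1 - ind χ m) := by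
      funext m
      simp only [hf]
      ring
    rw [e4, expect_add, expect_mul R _ (fun t ht m b => by rw [hinv t ht]) (ind χ),
      expect_mul R _ (fun t ht m b => by rw [hinv t ht]) (fun m => 1 - ind χ m)]
    simp only [expect_one_sub, hχ _ hcl]
    rw [← ampCoeff_fourier hp]
    simp only [hA, hB]
    ring
  · have : indClean r k (bit s) = 0 := by unfold indClean; rw [if_neg hcl]
    rw [this]
    simp

end

/-- Amplitude estimation yields `p` up to `τ` with probability at least `0.99`. -/
theorem estimation_accuracy {M : ℕ} (hM : 0 < M) {τ : ℝ} (hτ0 : 0 < τ) (hτ : 256 ≤ M * τ) {p θ : ℝ}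
    (hp : p = Real.sin θ ^ 2) (g : ℕ → ℝ) (hg0 : ∀ y, 0 ≤ g y)
    (hg : ∀ y : ℕ, |1 - Real.sin (Real.pi * (y / M)) ^ 2 - p| ≤ τ → g y = 1) :
    99 / 100 ≤ ∑ y ∈ Finset.range M, g y * ((phaseProb M (θ + Real.pi / 2) y
          + phaseProb M (-θ + Real.pi / 2) y) / 2) := by
  have hsin : ∀ φ : ℝ, Real.sin φ ^ 2 = 1 - p → ∀ y : ℕ,
      |Real.sin (φ - Real.pi * y / M)| ≤ τ → g y = 1 := by
    intro φ hφ y hy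
    refine hg y ?_
    -- This is `sin²φ - sin²x = sin(φ - x) sin(φ + x)` with `sin²φ = 1 - p`. Both phases `±θ + π/2`
    -- have this property, which is why the readout is one minus a squared sine.
    have e : 1 - Real.sin (Real.pi * (y / M)) ^ 2 - p
        = Real.sin (φ - Real.pi * y / M) * Real.sin (φ + Real.pi * y / M) := by
      rw [mul_div_assoc, Real.sin_sub, Real.sin_add]
      have c1 := Real.sin_sq_add_cos_sq φ
      have c2 := Real.sin_sq_add_cos_sq (Real.pi * (y / M))
      linear_combination -(Real.sin φ ^ 2) * c2 + Real.sin (Real.pi * (y / M)) ^ 2 * c1 - hφ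
    rw [e, abs_mul]
    calc _ ≤ τ * 1 := by gcongr; exact Real.abs_sin_le_one _
      _ = τ := mul_one τ
  have half : ∀ φ : ℝ, Real.sin φ ^ 2 = 1 - p →
      159 / 160 ≤ ∑ y ∈ Finset.range M, g y * phaseProb M φ y := by
    intro φ hφ
    have h1 := sum_phaseProb hM φ
    have h2 := sum_phaseProb_bad_le hM hτ0 hτ φ
    have h3 : ∑ y ∈ Finset.range M, phaseProb M φ y ≤ ∑ y ∈ Finset.range M, g y * phaseProb M φ y
        + ∑ y ∈ Finset.range M, (if τ < |Real.sin (φ - Real.pi * y / M)| then phaseProb M φ y else 0) := by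
      rw [← Finset.sum_add_distrib]
      refine Finset.sum_le_sum fun y _ => ?_
      have h4 := phaseProb_nonneg M φ y
      split_ifs with h
      · have := mul_nonneg (hg0 y) h4
        linarith
      · rw [hsin φ hφ y (not_lt.1 h)]
        linarith
    linarith
  have c1 := half (θ + Real.pi / 2) (by rw [Real.sin_add_pi_div_two, Real.cos_sq', hp])
  have c2 := half (-θ + Real.pi / 2) (by rw [Real.sin_add_pi_div_two, Real.cos_neg, Real.cos_sq', hp])
  have e : ∑ y ∈ Finset.range M, g y * ((phaseProb M (θ + Real.pi / 2) y
          + phaseProb M (-θ + Real.pi / 2) y) / 2)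
      = (∑ y ∈ Finset.range M, g y * phaseProb M (θ + Real.pi / 2) y
        + ∑ y ∈ Finset.range M, g y * phaseProb M (-θ + Real.pi / 2) y) / 2 := by
    rw [← Finset.sum_add_distrib, Finset.sum_div]
    exact Finset.sum_congr rfl fun y _ => by ring
  rw [e]
  linarith

/-! ### Programs with loop bounds that only depend on the input -/

instance : Add Expr := ⟨.add⟩
instance : Sub Expr := ⟨.sub⟩
instance : Mul Expr := ⟨.mul⟩
instance : Mod Expr := ⟨.mod⟩
instance (k : ℕ) : OfNat Expr k := ⟨.const k⟩

section
variable (mem : ℕ → ℕ) (env : List ℕ) (e f : Expr)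

theorem Expr.eval_add : (e + f).eval mem env = e.eval mem env + f.eval mem env := rfl

theorem Expr.eval_sub : (e - f).eval mem env = e.eval mem env - f.eval mem env := rfl

theorem Expr.eval_mul : (e * f).eval mem env = e.eval mem env * f.eval mem env := rfl

end

/-- The expression does not refer to loop counters. -/
def Expr.closed : Expr → Bool
  | .const _ => true
  | .var _ => false
  | .mem e => e.closed
  | .add e f => e.closed && f.closed
  | .sub e f => e.closed && f.closed
  | .mul e f => e.closed && f.closed
  | .div e f => e.closed && f.closed
  | .mod e f => e.closed && f.closed
  | .shr e f => e.closed && f.closed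
  | .log e => e.closed
  | .msb e => e.closed

theorem Expr.eval_eq_of_closed {e : Expr} (h : e.closed = true) (mem : ℕ → ℕ) (env env' : List ℕ) :
    e.eval mem env = e.eval mem env' := by
  induction e with
  | const k => rfl
  | var k => simp [closed] at h
  | mem e ih => simp only [eval]; rw [ih h]
  | log e ih => simp only [eval]; rw [ih h]
  | msb e ih => simp only [eval]; rw [ih h]
  | add e f ihe ihf | sub e f ihe ihf | mul e f ihe ihf | div e f ihe ihf | mod e f ihe ihf
  | shr e f ihe ihf =>
    simp only [closed, Bool.and_eq_true] at h
    simp only [eval]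
    rw [ihe h.1, ihf h.2]

/-- The substitution of `b - 1 - var k` for `var k`. -/
def Expr.flipAt (b : Expr) (k : ℕ) : Expr → Expr
  | .const j => .const j
  | .var j => if j = k then b - 1 - .var j else .var j
  | .mem e => .mem (Expr.flipAt b k e)
  | .add e f => .add (Expr.flipAt b k e) (Expr.flipAt b k f)
  | .sub e f => .sub (Expr.flipAt b k e) (Expr.flipAt b k f)
  | .mul e f => .mul (Expr.flipAt b k e) (Expr.flipAt b k f)
  | .div e f => .div (Expr.flipAt b k e) (Expr.flipAt b k f)
  | .mod e f => .mod (Expr.flipAt b k e) (Expr.flipAt b k f)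
  | .shr e f => .shr (Expr.flipAt b k e) (Expr.flipAt b k f)
  | .log e => .log (Expr.flipAt b k e)
  | .msb e => .msb (Expr.flipAt b k e)

theorem Expr.eval_flipAt {b : Expr} (hb : b.closed = true) (mem : ℕ → ℕ) (pre env : List ℕ) (x : ℕ)
    (e : Expr) : (Expr.flipAt b pre.length e).eval mem (pre ++ x :: env)
      = e.eval mem (pre ++ (b.eval mem [] - 1 - x) :: env) := by
  induction e with
  | const k => rfl
  | var j =>
    unfold flipAt
    split_ifs with h
    · subst h
      rw [eval_sub, eval_sub, Expr.eval_eq_of_closed hb mem _ []]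
      simp [eval]
    · simp only [eval]
      rcases lt_or_gt_of_ne h with h1 | h1
      · rw [List.getD_append _ _ _ _ h1, List.getD_append _ _ _ _ h1]
      · rw [List.getD_append_right _ _ _ _ h1.le, List.getD_append_right _ _ _ _ h1.le]
        obtain ⟨c, hc⟩ : ∃ c, j - pre.length = c + 1 := ⟨j - pre.length - 1, by omega⟩
        rw [hc, List.getD_cons_succ, List.getD_cons_succ]
  | mem e ih => simp only [flipAt, eval]; rw [ih]
  | log e ih => simp only [flipAt, eval]; rw [ih]
  | msb e ih => simp only [flipAt, eval]; rw [ih]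
  | add e f ihe ihf | sub e f ihe ihf | mul e f ihe ihf | div e f ihe ihf | mod e f ihe ihf
  | shr e f ihe ihf =>
    simp only [flipAt, eval]
    rw [ihe, ihf]

/-- The loop bounds do not refer to loop counters. -/
def Prog.closedLoops : Prog → Bool
  | .skip => true
  | .gate _ => true
  | .seq P Q => P.closedLoops && Q.closedLoops
  | .ite _ P Q => P.closedLoops && Q.closedLoops
  | .loop e P => e.closed && P.closedLoops

def Prog.flipAt (b : Expr) (k : ℕ) : Prog → Prog
  | .skip => .skip
  | .gate g => .gate (g.map (Expr.flipAt b k))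
  | .seq P Q => .seq (P.flipAt b k) (Q.flipAt b k)
  | .ite e P Q => .ite (Expr.flipAt b k e) (P.flipAt b k) (Q.flipAt b k)
  | .loop e P => .loop e (P.flipAt b (k + 1))

/-- The operations in reverse order. -/
def Prog.reverse : Prog → Prog
  | .skip => .skip
  | .gate g => .gate g
  | .seq P Q => .seq Q.reverse P.reverse
  | .ite e P Q => .ite e P.reverse Q.reverse
  | .loop e P => .loop e (P.reverse.flipAt e 0)

theorem Gate.map_map {A B C : Type} (f : A → B) (g : B → C) (G : Gate A) :
    (G.map f).map g = G.map fun x => g (f x) := by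
  obtain ⟨op, cs, t⟩ := G
  cases op <;> simp [Gate.map, Op.map]

theorem Prog.circuit_flipAt {b : Expr} (hb : b.closed = true) (mem : ℕ → ℕ) (x : ℕ) {P : Prog}
    (hP : P.closedLoops = true) (pre env : List ℕ) :
    (P.flipAt b pre.length).circuit mem (pre ++ x :: env)
      = P.circuit mem (pre ++ (b.eval mem [] - 1 - x) :: env) := by
  induction P generalizing pre with
  | skip => rfl
  | gate g =>
    simp only [flipAt, circuit, Gate.map_map, Expr.eval_flipAt hb]
  | seq P Q ihP ihQ =>
    simp only [closedLoops, Bool.and_eq_true] at hP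
    simp only [flipAt, circuit]
    rw [ihP hP.1, ihQ hP.2]
  | ite e P Q ihP ihQ =>
    simp only [closedLoops, Bool.and_eq_true] at hP
    simp only [flipAt, circuit]
    rw [ihP hP.1, ihQ hP.2, Expr.eval_flipAt hb]
  | loop e P ih =>
    simp only [closedLoops, Bool.and_eq_true] at hP
    simp only [flipAt, circuit]
    rw [Expr.eval_eq_of_closed hP.1 mem _ (pre ++ (b.eval mem [] - 1 - x) :: env)]
    congr 1
    funext k
    exact ih hP.2 (k :: pre)

theorem Prog.closedLoops_flipAt (b : Expr) (k : ℕ) (P : Prog) :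
    (P.flipAt b k).closedLoops = P.closedLoops := by
  induction P generalizing k with
  | skip => rfl
  | gate g => rfl
  | seq P Q ihP ihQ | ite e P Q ihP ihQ => simp only [flipAt, closedLoops, ihP, ihQ]
  | loop e P ih => simp only [flipAt, closedLoops, ih]

theorem Prog.closedLoops_reverse (P : Prog) : P.reverse.closedLoops = P.closedLoops := by
  induction P with
  | skip => rfl
  | gate g => rfl
  | seq P Q ihP ihQ => simp only [reverse, closedLoops, ihP, ihQ, Bool.and_comm]
  | ite e P Q ihP ihQ => simp only [reverse, closedLoops, ihP, ihQ]
  | loop e P ih => simp only [reverse, closedLoops, closedLoops_flipAt, ih]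

theorem reverse_range_eq_map (n : ℕ) :
    (List.range n).reverse = (List.range n).map fun k => n - 1 - k := by
  apply List.ext_getElem <;> simp

theorem Prog.circuit_loop_flipAt {e : Expr} (he : e.closed = true) {P : Prog}
    (hP : P.closedLoops = true) (mem : ℕ → ℕ) (env : List ℕ) :
    (Prog.loop e (P.flipAt e 0)).circuit mem env
      = (List.range (e.eval mem env)).reverse.flatMap fun k => P.circuit mem (k :: env) := by
  rw [reverse_range_eq_map, List.flatMap_map]
  simp only [circuit]
  congr 1
  funext k
  rw [Expr.eval_eq_of_closed he mem env []]
  exact circuit_flipAt he mem k hP [] env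

/-- A loop is reversed by substituting `e - 1 - var` for its counter. Closed bounds keep the numbers
of passes, also of nested loops, unchanged by this substitution. -/
theorem Prog.circuit_reverse {P : Prog} (hP : P.closedLoops = true) (mem : ℕ → ℕ) (env : List ℕ) :
    P.reverse.circuit mem env = (P.circuit mem env).reverse := by
  induction P generalizing env with
  | skip => rfl
  | gate g => rfl
  | seq P Q ihP ihQ =>
    simp only [closedLoops, Bool.and_eq_true] at hP
    simp only [reverse, circuit]
    rw [ihP hP.1, ihQ hP.2, List.reverse_append]
  | ite e P Q ihP ihQ =>
    simp only [closedLoops, Bool.and_eq_true] at hP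
    simp only [reverse, circuit]
    rw [ihP hP.1, ihQ hP.2]
    split_ifs <;> rfl
  | loop e P ih =>
    simp only [closedLoops, Bool.and_eq_true] at hP
    rw [reverse, circuit_loop_flipAt hP.1 (by rw [closedLoops_reverse, hP.2])]
    simp only [circuit, List.reverse_flatMap]
    congr 1
    funext k
    exact ih hP.2 _

/-- A bound for the number of elementary operations and tests. -/
def Prog.iters (mem : ℕ → ℕ) : Prog → ℕ
  | .skip => 1
  | .gate _ => 1
  | .seq P Q => P.iters mem + Q.iters mem
  | .ite _ P Q => P.iters mem + Q.iters mem
  | .loop e P => 1 + e.eval mem [] * P.iters mem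

/-- The size of the text of the program. -/
def Prog.size : Prog → ℕ
  | .skip => 1
  | .gate g => 1 + g.ctrls.length + g.op.exprTime + (g.ctrls.map Expr.time).sum + g.tgt.time
  | .seq P Q => P.size + Q.size
  | .ite e P Q => 1 + e.time + P.size + Q.size
  | .loop e P => 2 + e.time + P.size

theorem Prog.one_le_iters (mem : ℕ → ℕ) (P : Prog) : 1 ≤ P.iters mem := by
  induction P with
  | skip => rfl
  | gate g => rfl
  | seq P Q ihP ihQ | ite e P Q ihP ihQ => simp only [iters]; omega
  | loop e P ih => simp only [iters]; omega

/-- Each part of the text is executed at most `iters` times. Both branches of a test are counted in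
`iters`, so it need not be known which one runs. -/
theorem Prog.time_le {P : Prog} (hP : P.closedLoops = true) (mem : ℕ → ℕ) (env : List ℕ) :
    P.time mem env ≤ P.size * P.iters mem := by
  induction P generalizing env with
  | skip => simp [time, size, iters]
  | gate g => simp [time, size, iters]
  | seq P Q ihP ihQ =>
    simp only [closedLoops, Bool.and_eq_true] at hP
    have h1 := ihP hP.1 env
    have h2 := ihQ hP.2 env
    simp only [time, size, iters]
    nlinarith
  | ite e P Q ihP ihQ =>
    simp only [closedLoops, Bool.and_eq_true] at hP
    have h1 := ihP hP.1 env
    have h2 := ihQ hP.2 env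
    have h3 := P.one_le_iters mem
    have h4 := Q.one_le_iters mem
    simp only [time, size, iters]
    split_ifs <;> nlinarith
  | loop e P ih =>
    simp only [closedLoops, Bool.and_eq_true] at hP
    have h1 : ∑ k ∈ Finset.range (e.eval mem env), (1 + P.time mem (k :: env))
        ≤ ∑ k ∈ Finset.range (e.eval mem env), (1 + P.size) * P.iters mem :=
      Finset.sum_le_sum fun k _ => by
        have h2 := ih hP.2 (k :: env)
        have h3 := P.one_le_iters mem
        nlinarith
    rw [Finset.sum_const, Finset.card_range, smul_eq_mul, Expr.eval_eq_of_closed hP.1 mem env []] at h1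
    simp only [time, size, iters]
    rw [Expr.eval_eq_of_closed hP.1 mem env []]
    nlinarith [Nat.zero_le (e.time * (e.eval mem [] * P.iters mem)),
      Nat.zero_le (e.eval mem [] * P.iters mem)]

theorem Prog.iters_flipAt (mem : ℕ → ℕ) (b : Expr) (k : ℕ) (P : Prog) :
    (P.flipAt b k).iters mem = P.iters mem := by
  induction P generalizing k with
  | skip => rfl
  | gate g => rfl
  | seq P Q ihP ihQ | ite e P Q ihP ihQ => simp only [flipAt, iters, ihP, ihQ]
  | loop e P ih => simp only [flipAt, iters, ih]

theorem Prog.iters_reverse (mem : ℕ → ℕ) (P : Prog) : P.reverse.iters mem = P.iters mem := by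
  induction P with
  | skip => rfl
  | gate g => rfl
  | seq P Q ihP ihQ => simp only [reverse, iters, ihP, ihQ, add_comm]
  | ite e P Q ihP ihQ => simp only [reverse, iters, ihP, ihQ]
  | loop e P ih => simp only [reverse, iters, iters_flipAt, ih]

/-! ### The program -/

namespace Code

def d : Expr := .mem 0
def n : Expr := .mem 1
def i : Expr := .mem 2
def w : Expr := .log n + 1
-- Expressions have no powers; `msb` provides `2 ^ k`. The factor `1024` makes `2 ^ k` exceed
-- `512/ε`, as the accuracy `ε/2` requires.
def M : Expr := .msb (1024 * .mem 3)
def k : Expr := .log (1024 * .mem 3)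
-- The memory consists of `R` random bits (coins, then the code of the starting point), the blocks
-- of the walk, the cells of the membership test, the `R + 1` cells of the zero test from `zero` on,
-- and the control register from `reg` on.
def R : Expr := 2 * d * i + d * w
def base (b : Expr) : Expr := R + b * (6 * w + 4)
def out (b q : Expr) : Expr := base b + (5 * w + 4) + q
def flag (j : Expr) : Expr := base (d + d * i) + j * (2 * w + 3)
def zero : Expr := flag d + 1
def reg : Expr := zero + 1 + R

def cx (cs : List Expr) (t : Expr) : Prog := .gate ⟨.flip, cs, t⟩

/-- Executes `P` if digit `q` of `p` is zero. -/
def unlessBit (p q : Expr) (P : Prog) : Prog := .ite (.shr p q % 2) .skip P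

def chain (len : Expr) (src : Expr → Expr → Expr) (dst : Expr → Expr) (pat : Expr) : Prog :=
  .loop len (.seq
    (cx [dst (.var 1) + .var 0, src (.var 1) (.var 0)] (dst (.var 1) + .var 0 + 1))
    (unlessBit pat (.var 0) (cx [dst (.var 1) + .var 0] (dst (.var 1) + .var 0 + 1))))

def compare (src : Expr → Expr → Expr) (dst : Expr → Expr) (p : Expr → Expr) : Prog :=
  .loop w (.seq
    (cx [src (.var 1) (.var 0), dst (.var 1) + .var 0] (dst (.var 1) + .var 0 + 1))
    (unlessBit (p (.var 1)) (.var 0)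
      (.seq (cx [src (.var 1) (.var 0)] (dst (.var 1) + .var 0 + 1))
        (cx [dst (.var 1) + .var 0] (dst (.var 1) + .var 0 + 1)))))

def sum (src : Expr → Expr → Expr) (b e dst : Expr → Expr) (Y : Expr) : Prog :=
  .loop w (.seq (cx [src (.var 1) (.var 0)] (dst (.var 1) + .var 0))
    (.seq (cx [b (.var 1) + .var 0] (dst (.var 1) + .var 0))
    (.ite (.shr Y (.var 0) % 2) (cx [e (.var 1)] (dst (.var 1) + .var 0)) .skip)))

def move (src : Expr → Expr → Expr) (b : Expr → Expr) (pC pE Y : Expr) : Prog :=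
  .seq (chain w src b pC) (.seq (cx [b (.var 0)] (b (.var 0) + w + 1))
    (.seq (chain w src (fun β => b β + w + 1) pE)
      (sum src b (fun β => b β + w + 1 + w) (fun β => b β + w + 1 + w + 1) Y)))

def init : Prog :=
  .loop d (.loop w (cx [2 * d * i + .var 1 * w + (w - 1 - .var 0)] (out (.var 1) (.var 0))))

def step : Prog :=
  .seq (.seq (.ite (.var 0 % d) (cx [2 * .var 0 - 1] (base (.var 0 + d)))
      (cx [] (base (.var 0 + d)))) (cx [2 * .var 0] (base (.var 0 + d))))
    (.seq (move out (fun β => base (β + d)) (2 * .msb n - 1) (n - 1) n)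
      (.seq (.seq (cx [2 * .var 0] (base (.var 0 + d) + (3 * w + 2)))
          (cx [2 * .var 0 + 1] (base (.var 0 + d) + (3 * w + 2))))
        (move (fun β q => base (β + d) + w + 1 + w + 1 + q)
          (fun β => base (β + d) + (3 * w + 2)) 0 0 (2 * .msb n - n))))

def test : Prog :=
  .seq (cx [] (flag 0)) (.loop d
    (.seq (compare (fun j => out (d * i + j)) (fun j => flag j + 1) (fun j => .mem (4 + 2 * j)))
      (.seq (compare (fun j => out (d * i + j)) (fun j => flag j + (w + 2))
          (fun j => .mem (5 + 2 * j)))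
        (.seq (cx [flag (.var 0), flag (.var 0) + 1 + w] (flag (.var 0 + 1)))
          (cx [flag (.var 0), flag (.var 0) + (w + 2) + w] (flag (.var 0 + 1)))))))

def walk : Prog := .seq init (.seq (.loop (d * i) step) test)

def isZero : Prog := .seq (cx [] zero) (chain R (fun _ q => q) (fun _ => zero) 0)

def unit (op : Op Expr) (cs : List Expr) (t : Expr) : Prog :=
  .seq (.gate ⟨.phase 1 2, cs, t⟩) (.gate ⟨op, cs, t⟩)

/-- The rotation that prepares the random bit `var 0`. -/
def coin : Prog :=
  -- Truncated subtraction tests whether the bit is a coin. The coin with number `r` in its step,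
  -- when its control is set, becomes `1` with probability `(2d-1-r)/(2d-r)`; the last one therefore
  -- stays `0`.
  .ite (2 * d * i - .var 0)
    (.ite (.var 0 % (2 * d))
      (unit (.rot (2 * d - 1 - .var 0 % (2 * d)) (2 * d - .var 0 % (2 * d))) [.var 0 - 1] (.var 0))
      (unit (.rot (2 * d - 1 - .var 0 % (2 * d)) (2 * d - .var 0 % (2 * d))) [] (.var 0)))
    (unit (.load (2 * d * i) (.var 0 - 2 * d * i)) [] (.var 0))

/-- The qubit at offset `k - 1 - l` has weight `2^l` and controls the iterations `y` with `l = ⌊log₂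
(y + 1)⌋`. -/
def control : Expr := reg + (k - 1 - .log (.var 0 + 1))

/-- The iteration of amplitude amplification, controlled by the qubit that belongs to `var 0`. -/
def amplify : Prog :=
  -- Only the two phase gates carry the control; without them the remaining operations cancel in
  -- pairs.
  .seq (.seq walk (.seq (.gate ⟨.phase 1 2, [control], flag d⟩) walk.reverse))
    (.seq (.loop R (coin.flipAt R 0))
      (.seq (.seq isZero (.seq (.gate ⟨.phase 1 2, [control], zero + R⟩) isZero.reverse))
        (.loop R coin)))

def fourierStage : Prog :=
  .seq (.loop k (.ite (.var 1 - .var 0)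
      (.gate ⟨.phase (.shr M (k - (.var 1 + 1) + .var 0) - 1) (.shr M (k - (.var 1 + 1) + .var 0)),
        [reg + .var 0], reg + .var 1⟩) .skip))
    (unit (.rot 1 2) [] (reg + .var 0))

def main : Prog :=
  .seq (.loop k (unit (.rot 1 2) [] (reg + .var 0)))
    (.seq (.loop R coin) (.seq (.loop (M - 1) amplify) (.loop k fourierStage)))

/-- The readout `1 - sin² (π y / M)`. -/
def sine : Readout := .sin (.div (.mul .pi (.bits reg k)) (.int M))

def readout : Readout := .sub (.int 1) (.mul sine sine)

end Code

/-- Amplitude estimation of the probability that the random walk ends in the region. -/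
def algorithm : QAlgorithm := ⟨Code.reg + Code.k, Code.main, Code.readout⟩

/-- The preparation of random bit `t`. -/
def coinL (d i t : ℕ) : List (Gate ℕ) :=
  if 2 * d * i - t ≠ 0 then
    (if t % (2 * d) ≠ 0 then unitL (.rot (2 * d - 1 - t % (2 * d)) (2 * d - t % (2 * d))) [t - 1] t
      else unitL (.rot (2 * d - 1 - t % (2 * d)) (2 * d - t % (2 * d))) [] t)
  else unitL (.load (2 * d * i) (t - 2 * d * i)) [] t

def amplifyL (d n i w : ℕ) (a b : ℕ → ℕ) (c : ℕ) : List (Gate ℕ) :=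
  (walkL d n i w a b ++ (⟨.phase 1 2, [c], flagCell d i w d⟩ :: (walkL d n i w a b).reverse)) ++
  ((List.range (numRandom d i w)).reverse.flatMap (coinL d i) ++
  ((zeroL (numRandom d i w) (flagCell d i w d + 1) ++
    (⟨.phase 1 2, [c], flagCell d i w d + 1 + numRandom d i w⟩ ::
      (zeroL (numRandom d i w) (flagCell d i w d + 1)).reverse)) ++
  (List.range (numRandom d i w)).flatMap (coinL d i)))

/-! ### The gate lists performed by the program -/

namespace Code

variable {mem : ℕ → ℕ} (env : List ℕ)

theorem eval_w : w.eval mem env = Nat.log 2 (mem 1) + 1 := rfl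
theorem eval_k : k.eval mem env = Nat.log 2 (1024 * mem 3) := rfl

theorem eval_M (h : mem 3 ≠ 0) : M.eval mem env = 2 ^ Nat.log 2 (1024 * mem 3) :=
  if_neg (show ¬(1024 * mem 3 = 0) by omega)

theorem eval_msb_n (h : mem 1 ≠ 0) : (Expr.msb n).eval mem env = 2 ^ Nat.log 2 (mem 1) := if_neg h

theorem eval_R : R.eval mem env = numRandom (mem 0) (mem 2) (Nat.log 2 (mem 1) + 1) := rfl

theorem circuit_cx (cs : List Expr) (t : Expr) : (cx cs t).circuit mem env
    = [HeatQ.cx (cs.map fun e => e.eval mem env) (t.eval mem env)] := rfl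

/-- The parameters are expressions in the counter `β` of an enclosing loop. Inside the loop of
`chain` this counter becomes `.var 1`, hence the evaluations at `q :: β :: env`. -/
theorem circuit_chain {len : Expr} {src : Expr → Expr → Expr} {dst : Expr → Expr} {pat : Expr}
    {β : ℕ} {S : ℕ → ℕ} {D p : ℕ}
    (hs : ∀ q, (src (.var 1) (.var 0)).eval mem (q :: β :: env) = S q)
    (hd : ∀ q, (dst (.var 1)).eval mem (q :: β :: env) = D)
    (hp : ∀ q, pat.eval mem (q :: β :: env) = p) :
    (chain len src dst pat).circuit mem (β :: env)
      = chainL (len.eval mem (β :: env)) S D p := by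
  unfold chain chainL unlessBit
  simp only [Prog.circuit, circuit_cx, List.map, Expr.eval, hs, hd, hp, List.getD_cons_zero]
  rfl

theorem circuit_sum {src : Expr → Expr → Expr} {b e dst : Expr → Expr} {Y : Expr}
    {β : ℕ} {S : ℕ → ℕ} {B F D y : ℕ}
    (hs : ∀ q, (src (.var 1) (.var 0)).eval mem (q :: β :: env) = S q)
    (hb : ∀ q, (b (.var 1)).eval mem (q :: β :: env) = B)
    (he : ∀ q, (e (.var 1)).eval mem (q :: β :: env) = F)
    (hd : ∀ q, (dst (.var 1)).eval mem (q :: β :: env) = D)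
    (hY : ∀ q, Y.eval mem (q :: β :: env) = y) :
    (sum src b e dst Y).circuit mem (β :: env)
      = sumL (Nat.log 2 (mem 1) + 1) S B F D y := by
  unfold sum sumL
  simp only [Prog.circuit, circuit_cx, List.map, Expr.eval, hs, hd, hb, he, hY, List.getD_cons_zero, eval_w]
  rfl

theorem circuit_move {src : Expr → Expr → Expr} {b : Expr → Expr} {pC pE Y : Expr}
    {β : ℕ} {S : ℕ → ℕ} {B c e y : ℕ}
    (hs : ∀ q, (src (.var 1) (.var 0)).eval mem (q :: β :: env) = S q)
    (hb : ∀ q, (b (.var 1)).eval mem (q :: β :: env) = B)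
    (hb0 : (b (.var 0)).eval mem (β :: env) = B)
    (hC : ∀ q, pC.eval mem (q :: β :: env) = c)
    (hE : ∀ q, pE.eval mem (q :: β :: env) = e)
    (hY : ∀ q, Y.eval mem (q :: β :: env) = y) :
    (move src b pC pE Y).circuit mem (β :: env)
      = moveL (Nat.log 2 (mem 1) + 1) S B c e y := by
  unfold move moveL
  simp only [Prog.circuit, circuit_cx, List.map, Expr.eval_add, hb0]
  rw [circuit_chain env hs hb hC, circuit_chain env (dst := fun β => b β + w + 1)
    (D := B + (Nat.log 2 (mem 1) + 1) + 1) hs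
    (fun q => congrArg (· + (Nat.log 2 (mem 1) + 1) + 1) (hb q)) hE,
    circuit_sum env (e := fun β => b β + w + 1 + w) (dst := fun β => b β + w + 1 + w + 1) (F := B + (Nat.log 2 (mem 1) + 1) + 1 + (Nat.log 2 (mem 1) + 1))
      (D := B + (Nat.log 2 (mem 1) + 1) + 1 + (Nat.log 2 (mem 1) + 1) + 1) hs hb
      (fun q => congrArg (· + (Nat.log 2 (mem 1) + 1) + 1 + (Nat.log 2 (mem 1) + 1)) (hb q))
      (fun q => congrArg (· + (Nat.log 2 (mem 1) + 1) + 1 + (Nat.log 2 (mem 1) + 1) + 1) (hb q)) hY]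
  rfl

theorem circuit_init : init.circuit mem env
    = initL (mem 0) (mem 2) (Nat.log 2 (mem 1) + 1) := rfl

theorem circuit_step (h : mem 1 ≠ 0) (β : ℕ) : step.circuit mem (β :: env)
    = stepL (mem 0) (mem 1) (mem 2) (Nat.log 2 (mem 1) + 1) β := by
  have hP : ∀ env, (2 * Expr.msb n).eval mem env = 2 ^ (Nat.log 2 (mem 1) + 1) := fun env => by
    rw [Expr.eval_mul, eval_msb_n env h, pow_succ, mul_comm]; rfl
  unfold step stepL
  simp only [Prog.circuit, circuit_cx]
  rw [circuit_move env (S := blockOut (mem 0) (mem 2) (Nat.log 2 (mem 1) + 1) β)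
      (B := blockBase (mem 0) (mem 2) (Nat.log 2 (mem 1) + 1) (β + mem 0))
      (c := 2 ^ (Nat.log 2 (mem 1) + 1) - 1) (e := mem 1 - 1) (y := mem 1)
      (fun q => rfl) (fun q => rfl) rfl (fun q => congrArg (· - 1) (hP _))
      (fun q => rfl) (fun q => rfl),
    circuit_move env (src := fun β q => base (β + d) + w + 1 + w + 1 + q)
      (b := fun β => base (β + d) + (3 * w + 2)) (pC := 0) (pE := 0) (Y := 2 * .msb n - n)
      (S := fun q => blockBase (mem 0) (mem 2) (Nat.log 2 (mem 1) + 1) (β + mem 0)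
        + (Nat.log 2 (mem 1) + 1) + 1 + (Nat.log 2 (mem 1) + 1) + 1 + q)
      (B := blockBase (mem 0) (mem 2) (Nat.log 2 (mem 1) + 1) (β + mem 0)
        + (3 * (Nat.log 2 (mem 1) + 1) + 2))
      (c := 0) (e := 0) (y := 2 ^ (Nat.log 2 (mem 1) + 1) - mem 1)
      (fun q => rfl) (fun q => rfl) rfl (fun q => rfl) (fun q => rfl)
      (fun q => congrArg (· - mem 1) (hP _))]
  rfl

theorem circuit_test : test.circuit mem env
    = flagL (mem 0) (mem 2) (Nat.log 2 (mem 1) + 1) (fun j => mem (4 + 2 * j))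
      fun j => mem (5 + 2 * j) := rfl

theorem circuit_walk (h : mem 1 ≠ 0) : walk.circuit mem env
    = walkL (mem 0) (mem 1) (mem 2) (Nat.log 2 (mem 1) + 1) (fun j => mem (4 + 2 * j))
      fun j => mem (5 + 2 * j) := by
  unfold walk walkL
  simp only [Prog.circuit, circuit_init, circuit_test, circuit_step env h]
  rfl

theorem circuit_isZero (β : ℕ) : isZero.circuit mem (β :: env)
    = zeroL (numRandom (mem 0) (mem 2) (Nat.log 2 (mem 1) + 1))
      (flagCell (mem 0) (mem 2) (Nat.log 2 (mem 1) + 1) (mem 0) + 1) := by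
  unfold isZero zeroL
  simp only [Prog.circuit]
  rw [circuit_chain env (S := fun q => q) (p := 0)
    (D := flagCell (mem 0) (mem 2) (Nat.log 2 (mem 1) + 1) (mem 0) + 1)
    (fun q => rfl) (fun q => rfl) (fun q => rfl)]
  rfl

theorem circuit_coin (t : ℕ) : coin.circuit mem (t :: env) = coinL (mem 0) (mem 2) t := rfl

theorem circuit_fourierStage (h : mem 3 ≠ 0) (t : ℕ) : fourierStage.circuit mem (t :: env)
    = fourierStageL (flagCell (mem 0) (mem 2) (Nat.log 2 (mem 1) + 1) (mem 0) + 1 + 1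
      + numRandom (mem 0) (mem 2) (Nat.log 2 (mem 1) + 1)) (Nat.log 2 (1024 * mem 3)) t := by
  have e : ∀ r, fourierStageL r (Nat.log 2 (1024 * mem 3)) t
      = ((List.range (Nat.log 2 (1024 * mem 3))).flatMap fun s => if t - s ≠ 0 then
    [(⟨.phase (M.eval mem (s :: t :: env) / 2 ^ (Nat.log 2 (1024 * mem 3) - (t + 1) + s) - 1)
      (M.eval mem (s :: t :: env) / 2 ^ (Nat.log 2 (1024 * mem 3) - (t + 1) + s)),
      [r + s], r + t⟩ : Gate ℕ)] else []) ++ unitL (.rot 1 2) [] (r + t) := fun r => by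
    simp only [eval_M _ h]
    rfl
  rw [e]
  rfl

theorem circuit_amplify (h : mem 1 ≠ 0) (y : ℕ) : amplify.circuit mem (y :: env)
    = amplifyL (mem 0) (mem 1) (mem 2) (Nat.log 2 (mem 1) + 1) (fun j => mem (4 + 2 * j))
      (fun j => mem (5 + 2 * j)) (flagCell (mem 0) (mem 2) (Nat.log 2 (mem 1) + 1) (mem 0) + 1 + 1
      + numRandom (mem 0) (mem 2) (Nat.log 2 (mem 1) + 1)
      + (Nat.log 2 (1024 * mem 3) - 1 - Nat.log 2 (y + 1))) := by
  unfold amplify amplifyL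
  have e1 := Prog.circuit_loop_flipAt (e := R) rfl (P := coin) rfl mem (y :: env)
  have e2 := Prog.circuit_reverse (P := walk) rfl mem (y :: env)
  have e3 := Prog.circuit_reverse (P := isZero) rfl mem (y :: env)
  have e4 : ∀ P Q, (Prog.seq P Q).circuit mem (y :: env)
    = P.circuit mem (y :: env) ++ Q.circuit mem (y :: env) := fun _ _ => rfl
  rw [circuit_walk _ h] at e2
  rw [circuit_isZero] at e3
  rw [e4, e4, e4, e4, e4, e4, e4, e1, e2, e3, circuit_walk _ h, circuit_isZero]
  rfl

theorem circuit_main (h1 : mem 1 ≠ 0) (h3 : mem 3 ≠ 0) : main.circuit mem []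
    = ((List.range (Nat.log 2 (1024 * mem 3))).flatMap fun t => unitL (.rot 1 2) []
        (flagCell (mem 0) (mem 2) (Nat.log 2 (mem 1) + 1) (mem 0) + 1 + 1
          + numRandom (mem 0) (mem 2) (Nat.log 2 (mem 1) + 1) + t)) ++
      ((List.range (numRandom (mem 0) (mem 2) (Nat.log 2 (mem 1) + 1))).flatMap
        (coinL (mem 0) (mem 2)) ++
      ((List.range (2 ^ Nat.log 2 (1024 * mem 3) - 1)).flatMap (fun y =>
        amplifyL (mem 0) (mem 1) (mem 2) (Nat.log 2 (mem 1) + 1) (fun j => mem (4 + 2 * j))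
          (fun j => mem (5 + 2 * j))
          (flagCell (mem 0) (mem 2) (Nat.log 2 (mem 1) + 1) (mem 0) + 1 + 1
            + numRandom (mem 0) (mem 2) (Nat.log 2 (mem 1) + 1)
            + (Nat.log 2 (1024 * mem 3) - 1 - Nat.log 2 (y + 1)))) ++
      (List.range (Nat.log 2 (1024 * mem 3))).flatMap (fourierStageL
        (flagCell (mem 0) (mem 2) (Nat.log 2 (mem 1) + 1) (mem 0) + 1 + 1
          + numRandom (mem 0) (mem 2) (Nat.log 2 (mem 1) + 1)) (Nat.log 2 (1024 * mem 3))))) := by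
  unfold main
  simp only [Prog.circuit, circuit_coin, circuit_amplify _ h1, circuit_fourierStage _ h3,
    Expr.eval_sub, eval_M _ h3, eval_k, eval_R]
  rfl

theorem closedLoops_main : main.closedLoops = true := by rfl

end Code

/-! ### The running time -/

/-- The `k²` operations of the Fourier transform are absorbed into the `2^k` iterations. -/
theorem succ_sq_le_two_pow (k : ℕ) : (k + 1) ^ 2 ≤ 4 * 2 ^ k := by
  induction k using Nat.strong_induction_on with
  | _ k ih =>
    rcases k with - | - | - | k
    · norm_num
    · norm_num
    · norm_num
    · have := ih (k + 2) (by omega)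
      rw [pow_succ 2 (k + 2)]
      generalize 2 ^ (k + 2) = X at *
      have h : (k + 1 + 1 + 1 + 1) ^ 2 ≤ 2 * (k + 2 + 1) ^ 2 := by ring_nf; omega
      omega

namespace Code

variable {mem : ℕ → ℕ}

/-- The `d * i` blocks take `O(w)` operations each, initialisation and membership test `O(d * w)`;
the numerical constants are generous. -/
theorem iters_walk_le (hd : 1 ≤ mem 0) :
    walk.iters mem ≤ 60 * (mem 0 * (Nat.log 2 (mem 1) + 1) * (mem 2 + 1)) := by
  have hw : 1 ≤ Nat.log 2 (mem 1) + 1 := by omega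
  have e1 : d.eval mem [] = mem 0 := rfl
  have e2 : w.eval mem [] = Nat.log 2 (mem 1) + 1 := rfl
  have e3 : (d * i).eval mem [] = mem 0 * mem 2 := rfl
  simp only [walk, init, step, test, move, compare, chain, sum, unlessBit, cx, Prog.iters, e1, e2, e3]
  generalize Nat.log 2 (mem 1) + 1 = W at *
  generalize mem 0 = D at *
  generalize mem 2 = J at *
  have h0 : D ≤ D * W := Nat.le_mul_of_pos_right D hw
  have h2 : D * J ≤ D * W * J := Nat.mul_le_mul_right J h0
  have h3 : 1 ≤ D * W := Nat.mul_pos hd hw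
  nlinarith

theorem iters_amplify_le (hd : 1 ≤ mem 0) :
    amplify.iters mem ≤ 200 * (mem 0 * (Nat.log 2 (mem 1) + 1) * (mem 2 + 1)) := by
  have hw : 1 ≤ Nat.log 2 (mem 1) + 1 := by omega
  have h := iters_walk_le hd
  have e1 : R.eval mem [] = 2 * mem 0 * mem 2 + mem 0 * (Nat.log 2 (mem 1) + 1) := rfl
  simp only [amplify, isZero, chain, unlessBit, coin, unit, cx, Prog.iters, Prog.iters_reverse,
    Prog.iters_flipAt, e1]
  generalize Nat.log 2 (mem 1) + 1 = W at *
  generalize mem 0 = D at *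
  generalize mem 2 = J at *
  have h0 : D ≤ D * W := Nat.le_mul_of_pos_right D hw
  have h2 : D * J ≤ D * W * J := Nat.mul_le_mul_right J h0
  have h3 : 1 ≤ D * W := Nat.mul_pos hd hw
  nlinarith

theorem iters_main_le (hd : 1 ≤ mem 0) (h3 : mem 3 ≠ 0) :
    main.iters mem ≤ 1000 * (2 ^ Nat.log 2 (1024 * mem 3) *
      (mem 0 * (Nat.log 2 (mem 1) + 1) * (mem 2 + 1))) := by
  have hw : 1 ≤ Nat.log 2 (mem 1) + 1 := by omega
  have h := iters_amplify_le hd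
  have e1 : R.eval mem [] = 2 * mem 0 * mem 2 + mem 0 * (Nat.log 2 (mem 1) + 1) := rfl
  have e2 : k.eval mem [] = Nat.log 2 (1024 * mem 3) := rfl
  have e3 : (M - 1).eval mem [] = 2 ^ Nat.log 2 (1024 * mem 3) - 1 := by
    rw [Expr.eval_sub, eval_M _ h3]; rfl
  simp only [main, fourierStage, coin, unit, Prog.iters, e1, e2, e3]
  have hk := succ_sq_le_two_pow (Nat.log 2 (1024 * mem 3))
  generalize Nat.log 2 (1024 * mem 3) = K at *
  have hM : 1 ≤ 2 ^ K := Nat.one_le_two_pow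
  generalize 2 ^ K = M at *
  generalize Nat.log 2 (mem 1) + 1 = W at *
  generalize mem 0 = D at *
  generalize mem 2 = J at *
  generalize amplify.iters mem = A at *
  have h0 : D ≤ D * W := Nat.le_mul_of_pos_right D hw
  have h2 : D * J ≤ D * W * J := Nat.mul_le_mul_right J h0
  have h3 : 1 ≤ D * W := Nat.mul_pos hd hw
  have h4 : (M - 1) * A ≤ M * (200 * (D * W * (J + 1))) := Nat.mul_le_mul (by omega) h
  have h5 : 1 ≤ D * W * (J + 1) := by nlinarith
  have h6 : M ≤ M * (D * W * (J + 1)) := Nat.le_mul_of_pos_right M h5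
  have h7 : D * W * (J + 1) ≤ M * (D * W * (J + 1)) := Nat.le_mul_of_pos_left _ hM
  have h8 : D * J + D * W ≤ 2 * (D * W * (J + 1)) := by nlinarith
  nlinarith

end Code

/-- The running time, up to a constant factor. -/
theorem exists_time_le : ∃ c : ℕ, ∀ mem : ℕ → ℕ, 1 ≤ mem 0 → mem 3 ≠ 0 →
    algorithm.time mem ≤ c * (2 ^ Nat.log 2 (1024 * mem 3) *
      (mem 0 * (Nat.log 2 (mem 1) + 1) * (mem 2 + 1))) := by
  obtain ⟨c₁, hc₁⟩ : ∃ c₁, (Code.reg + Code.k).time = c₁ := ⟨_, rfl⟩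
  obtain ⟨c₂, hc₂⟩ : ∃ c₂, ∀ mem, Code.readout.time mem
      = c₂ + 2 * Nat.log 2 (1024 * mem 3) := by
    -- Apart from reading the `k` bits twice, for the square of the sine, the readout takes constant
    -- time; at the zero memory `k` vanishes and this constant is left.
    refine ⟨Code.readout.time (fun _ => 0), fun mem => ?_⟩
    have e : ∀ mem, Code.k.eval mem [] = Nat.log 2 (1024 * mem 3) := fun _ => rfl
    simp only [Code.readout, Code.sine, Readout.time, e, mul_zero, Nat.log_zero_right]
    ring
  refine ⟨c₁ + c₂ + 8 + Code.main.size * 1000, fun mem hd h3 => ?_⟩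
  have h1 := Prog.time_le Code.closedLoops_main mem []
  have h2 := Nat.mul_le_mul_left Code.main.size (Code.iters_main_le hd h3)
  have h4 : algorithm.time mem = c₁ + Code.main.time mem [] + (c₂ + 2 * Nat.log 2 (1024 * mem 3)) := by
    rw [← hc₁, ← hc₂]; rfl
  have hk := succ_sq_le_two_pow (Nat.log 2 (1024 * mem 3))
  have h5 : 2 ^ Nat.log 2 (1024 * mem 3) ≤ 2 ^ Nat.log 2 (1024 * mem 3) *
      (mem 0 * (Nat.log 2 (mem 1) + 1) * (mem 2 + 1)) :=
    Nat.le_mul_of_pos_right _ (Nat.mul_pos (Nat.mul_pos hd (by omega)) (by omega))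
  have hM : 1 ≤ 2 ^ Nat.log 2 (1024 * mem 3) := Nat.one_le_two_pow
  rw [h4]
  generalize Code.main.size = s at *
  generalize Code.main.time mem [] = t at *
  generalize Code.main.iters mem = t' at *
  generalize Nat.log 2 (1024 * mem 3) = K at *
  generalize 2 ^ K = M at *
  generalize M * (mem 0 * (Nat.log 2 (mem 1) + 1) * (mem 2 + 1)) = X at *
  have h6 : c₁ + c₂ ≤ (c₁ + c₂) * X := Nat.le_mul_of_pos_right _ (by omega)
  nlinarith

/-! ### The distribution of the output -/

/-- The control of the rotation that prepares random bit `t`. -/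
def bitCtrl (d i t : ℕ) (m : ℕ → Bool) : Bool :=
  if 2 * d * i - t ≠ 0 then (if t % (2 * d) ≠ 0 then m (t - 1) else true) else true

/-- The probability that the controlled rotation yields one for random bit `t`. -/
def bitProb {d n : ℕ} (v : (Fin d → Fin n) → ℝ) (i t : ℕ) (m : ℕ → Bool) : ℝ :=
  if 2 * d * i - t ≠ 0 then
    max 0 (min 1 (((2 * d - 1 - t % (2 * d) : ℕ) : ℝ) / (2 * d - t % (2 * d) : ℕ)))
  else max 0 (min 1 (regionSum v (Function.update (fun l => m (2 * d * i + l)) (t - 2 * d * i) true)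
      (t - 2 * d * i + 1) / regionSum v (fun l => m (2 * d * i + l)) (t - 2 * d * i)))

section
variable {d n : ℕ} (v : (Fin d → Fin n) → ℝ)

theorem acts_coinL (i t : ℕ) :
    acts v (coinL d i t) = refl t (bitCtrl d i t) (bitProb v i t) := by
  unfold coinL
  split_ifs with h1 h2
  · rw [acts_unitL v _ (fun _ => ((2 * d - 1 - t % (2 * d) : ℕ) : ℝ) / (2 * d - t % (2 * d) : ℕ))
      (fun β => rfl)]
    congr 1
    · funext m; simp [bitCtrl, h1, h2]
    · funext m; unfold bitProb; rw [if_pos h1]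
  · rw [acts_unitL v _ (fun _ => ((2 * d - 1 - t % (2 * d) : ℕ) : ℝ) / (2 * d - t % (2 * d) : ℕ))
      (fun β => rfl)]
    congr 1
    · funext m; simp [bitCtrl, h2]
    · funext m; unfold bitProb; rw [if_pos h1]
  · rw [acts_unitL v _ (fun m => regionSum v
        (Function.update (fun l => m (2 * d * i + l)) (t - 2 * d * i) true)
      (t - 2 * d * i + 1) / regionSum v (fun l => m (2 * d * i + l)) (t - 2 * d * i))
      (fun β => rfl)]
    congr 1
    · funext m; simp [bitCtrl, h1]
    · funext m; unfold bitProb; rw [if_neg h1]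

theorem bitProb_nonneg (i t : ℕ) (m : ℕ → Bool) : 0 ≤ bitProb v i t m := by
  unfold bitProb; split_ifs <;> exact le_max_left _ _

theorem bitProb_le_one (i t : ℕ) (m : ℕ → Bool) : bitProb v i t m ≤ 1 := by
  unfold bitProb; split_ifs <;> exact max_le zero_le_one (min_le_left _ _)

theorem bitCtrl_congr (i : ℕ) {t : ℕ} {m m' : ℕ → Bool} (h : ∀ a ≤ t, m a = m' a) :
    bitCtrl d i t m = bitCtrl d i t m' := by
  unfold bitCtrl
  rw [h (t - 1) (by omega)]

theorem regionSum_congr {β γ : ℕ → Bool} {p : ℕ} (h : ∀ l < p, β l = γ l) :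
    regionSum v β p = regionSum v γ p := by
  unfold regionSum
  refine Finset.sum_congr rfl fun x _ => ?_
  have e : (∀ l < p, codeBit x l = β l) ↔ ∀ l < p, codeBit x l = γ l :=
    forall₂_congr fun l hl => by rw [h l hl]
  by_cases h1 : ∀ l < p, codeBit x l = γ l
  · rw [if_pos h1, if_pos (e.2 h1)]
  · rw [if_neg h1, if_neg (mt e.1 h1)]

/-- The rotation of bit `t` looks only at earlier bits, so sampling proceeds in the order of
addresses and the control register has no influence. -/
theorem bitProb_congr (i : ℕ) {t : ℕ} {m m' : ℕ → Bool} (h : ∀ a < t, m a = m' a) :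
    bitProb v i t m = bitProb v i t m' := by
  unfold bitProb
  by_cases h1 : 2 * d * i - t ≠ 0
  · rw [if_pos h1, if_pos h1]
  · rw [if_neg h1, if_neg h1]
    have e : ∀ l < t - 2 * d * i, m (2 * d * i + l) = m' (2 * d * i + l) := fun l hl =>
      h _ (by omega)
    rw [regionSum_congr v e, regionSum_congr v (γ := Function.update
      (fun l => m' (2 * d * i + l)) (t - 2 * d * i) true) fun l hl => ?_]
    by_cases h2 : l = t - 2 * d * i
    · rw [h2, Function.update_self, Function.update_self]
    · rw [Function.update_of_ne h2, Function.update_of_ne h2, e l (by omega)]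

theorem acts_range_flatMap_eq_fwd {U : ℕ → List (Gate ℕ)} {c : ℕ → (ℕ → Bool) → Bool}
    {q : ℕ → (ℕ → Bool) → ℝ} (hU : ∀ t, acts v (U t) = refl t (c t) (q t)) (R : ℕ)
    (Φ : (ℕ → Bool) → ℂ) : acts v ((List.range R).flatMap U) Φ = fwd c q R Φ := by
  induction R with
  | zero => rfl
  | succ R ih =>
    rw [List.range_succ, List.flatMap_append, List.flatMap_singleton, acts_append, ih, hU, fwd]

theorem acts_reverse_range_flatMap_eq_bwd {U : ℕ → List (Gate ℕ)} {c : ℕ → (ℕ → Bool) → Bool}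
    {q : ℕ → (ℕ → Bool) → ℝ} (hU : ∀ t, acts v (U t) = refl t (c t) (q t)) (R : ℕ)
    (Φ : (ℕ → Bool) → ℂ) : acts v ((List.range R).reverse.flatMap U) Φ = bwd c q R Φ := by
  induction R generalizing Φ with
  | zero => rfl
  | succ R ih =>
    rw [List.range_succ, List.reverse_append, List.reverse_singleton, List.flatMap_append,
      List.flatMap_singleton, acts_append, ih, hU, bwd]

theorem acts_oracle_eq_phaseFlip {V : List (Gate ℕ)} {lo hi : ℕ} (hV : FlipsIn V lo hi) {c o : ℕ}
    (ho : o < hi) (hc : hi ≤ c) (Φ : (ℕ → Bool) → ℂ) :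
    acts v (V ++ (⟨.phase 1 2, [c], o⟩ :: V.reverse)) Φ
      = phaseFlip c (fun m => execs V m o) Φ := by
  funext m
  rw [acts_oracle v V (fun g hg => (hV g hg).1) (by omega), phaseFlip, hV.execs_eq m (Or.inr hc)]

/-- The result of the membership test at the end of the walk. -/
def walkEnds (d n i w : ℕ) (a b : ℕ → ℕ) (m : ℕ → Bool) : Bool :=
  execs (walkL d n i w a b) m (flagCell d i w d)

theorem numRandom_le_flagCell (d i w j : ℕ) : numRandom d i w ≤ flagCell d i w j := by
  unfold flagCell blockBase; omega

theorem amplitude_estimation_walk {i w k : ℕ} {a b : ℕ → ℕ} (hn0 : 0 < n) (hn : n < 2 ^ w)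
    (ha : ∀ j < d, a j < 2 ^ w) (hb : ∀ j < d, b j < 2 ^ w) (hab : ∀ j < d, a j ≤ b j)
    {p θ : ℝ} (hp : p = Real.sin θ ^ 2) {r : ℕ}
    (hr : r = flagCell d i w d + 1 + 1 + numRandom d i w)
    (hχ : ∀ m, Clean 0 r k m → expect (bitCtrl d i) (bitProb v i) (numRandom d i w)
      (ind (walkEnds d n i w a b)) m = p) (g : ℕ → ℝ) :
    ∑ s : Fin (r + k) → Bool, g (ofDigits (fun l => bit s (r + l)) k) *
      ‖acts v (((List.range k).flatMap fun t => unitL (.rot 1 2) [] (r + t)) ++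
        ((List.range (numRandom d i w)).flatMap (coinL d i) ++
        ((List.range (2 ^ k - 1)).flatMap (fun y => amplifyL d n i w a b
          (r + (k - 1 - Nat.log 2 (y + 1)))) ++ (List.range k).flatMap (fourierStageL r k))))
        (fun m => open Classical in if m = fun _ => false then 1 else 0) (bit s)‖ ^ 2
      = ∑ y ∈ Finset.range (2 ^ k), g y * ((phaseProb (2 ^ k) (θ + Real.pi / 2) y
          + phaseProb (2 ^ k) (-θ + Real.pi / 2) y) / 2) := by
  have hV := (computes_walkL d n i w a b hn0 hn ha hb hab).2.1
  have hRF := numRandom_le_flagCell d i w d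
  have hZ := computes_zeroL (R := numRandom d i w) (E := flagCell d i w d + 1) (by omega)
  refine amplitude_estimation (R := numRandom d i w) (χ := walkEnds d n i w a b)
    (ζ := fun m => execs (zeroL (numRandom d i w) (flagCell d i w d + 1)) m
      (flagCell d i w d + 1 + numRandom d i w)) (c := bitCtrl d i) (q := bitProb v i)
    (bitProb_nonneg v i) (bitProb_le_one v i) (by omega) ?_ ?_ ?_ ?_ hχ hp v _
    (acts_range_flatMap_eq_fwd v (acts_coinL v i) _) _ ?_ le_rfl g
  · intro j hj a ha m b
    exact bitCtrl_congr i fun c hc => Function.update_of_ne (by omega) _ _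
  · intro j hj a ha m b
    exact bitProb_congr v i fun c hc => Function.update_of_ne (by omega) _ _
  · intro a ha m b
    exact hV.execs_congr (fun c hc => Function.update_of_ne (by omega) _ _) _ (by omega)
  · intro m hm
    refine Iff.trans (hZ.2.2 m (fun c h1 h2 => hm c (by omega) (by omega)) _ fun c _ => rfl) ?_
    refine forall₂_congr fun q hq => ?_
    rw [hZ.2.1.execs_eq m (Or.inl (by omega))]
  · intro y _ Φ
    unfold amplifyL
    rw [acts_append, acts_append, acts_append, acts_oracle_eq_phaseFlip v hV (by omega) (by omega),
      acts_reverse_range_flatMap_eq_bwd v (acts_coinL v i), 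
      acts_oracle_eq_phaseFlip v hZ.2.1 (by omega) (by omega),
      acts_range_flatMap_eq_fwd v (acts_coinL v i)]
    rfl

theorem tgt_lt_of_mem_unitL {op : Op ℕ} {cs : List ℕ} {t : ℕ} {g : Gate ℕ}
    (h : g ∈ unitL op cs t) : g.tgt = t := by
  simp only [unitL, List.mem_cons, List.not_mem_nil, or_false] at h
  rcases h with rfl | rfl <;> rfl

theorem tgt_of_mem_coinL {i t : ℕ} {g : Gate ℕ} (h : g ∈ coinL d i t) : g.tgt = t := by
  unfold coinL at h
  split_ifs at h <;> exact tgt_lt_of_mem_unitL h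

theorem tgt_lt_of_mem_fourierStageL {r k t : ℕ} (ht : t < k) {g : Gate ℕ}
    (h : g ∈ fourierStageL r k t) : g.tgt < r + k := by
  unfold fourierStageL at h
  rcases List.mem_append.1 h with h | h
  · obtain ⟨s, _, hs⟩ := List.mem_flatMap.1 h
    split_ifs at hs
    · rw [List.mem_singleton.1 hs]
      simpa using ht
    · simp at hs
  · rw [tgt_lt_of_mem_unitL h]
    omega

theorem tgt_lt_of_mem_oracle {V : List (Gate ℕ)} {lo hi N c o : ℕ} (hV : FlipsIn V lo hi)
    (hN : hi ≤ N) (ho : o < N) {g : Gate ℕ} (h : g ∈ V ++ (⟨.phase 1 2, [c], o⟩ :: V.reverse)) :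
    g.tgt < N := by
  rcases List.mem_append.1 h with h | h
  · exact (hV g h).2.2.1.trans_le hN
  · rcases List.mem_cons.1 h with rfl | h
    · exact ho
    · exact (hV g (List.mem_reverse.1 h)).2.2.1.trans_le hN

end

theorem inputMem_corners (d n i e : ℕ) (a b : Fin d → ℕ) (j : Fin d) :
    inputMem d n i e a b (4 + 2 * j) = a j ∧ inputMem d n i e a b (5 + 2 * j) = b j := by
  have h1 : 4 + 2 * (j : ℕ) = 2 * j + 4 := by ring
  have h2 : 5 + 2 * (j : ℕ) = 2 * j + 1 + 4 := by ring
  rw [h1, h2]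
  have h3 : (2 * (j : ℕ) + 1) / 2 = j := by omega
  have h4 : (2 * (j : ℕ) + 1) % 2 = 1 := by omega
  constructor <;> simp [inputMem, h3, h4]

/-- The algorithm outputs `p`, up to an error `τ`, if `p` is the probability that the walk ends in
the region. -/
theorem algorithm_prob_ge {d n i e w k : ℕ} {a b : Fin d → ℕ} (v : (Fin d → Fin n) → ℝ)
    (hn0 : 0 < n) (he : e ≠ 0) (hw : w = Nat.log 2 n + 1) (hk : k = Nat.log 2 (1024 * e))
    (ha : ∀ j, a j < 2 ^ w) (hb : ∀ j, b j < 2 ^ w) (hab : ∀ j, a j ≤ b j)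
    {p τ : ℝ} (hp0 : 0 ≤ p) (hp1 : p ≤ 1) {r : ℕ}
    (hr : r = flagCell d i w d + 1 + 1 + numRandom d i w)
    (hχ : ∀ m, Clean 0 r k m → expect (bitCtrl d i) (bitProb v i) (numRandom d i w)
      (ind (walkEnds d n i w (fun j => inputMem d n i e a b (4 + 2 * j))
        fun j => inputMem d n i e a b (5 + 2 * j))) m = p)
    (hτ0 : 0 < τ) (hτ : 256 ≤ 2 ^ k * τ) {E : ℝ → Prop} (hE : ∀ x, |x - p| ≤ τ → E x) :
    99 / 100 ≤ algorithm.prob (inputMem d n i e a b) v E := by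
  have hmem := inputMem_corners d n i e a b
  have hn : n < 2 ^ w := hw ▸ Nat.lt_pow_succ_log_self one_lt_two n
  have ha' : ∀ j < d, inputMem d n i e a b (4 + 2 * j) < 2 ^ w := fun j hj =>
    (hmem ⟨j, hj⟩).1.symm ▸ ha ⟨j, hj⟩
  have hb' : ∀ j < d, inputMem d n i e a b (5 + 2 * j) < 2 ^ w := fun j hj =>
    (hmem ⟨j, hj⟩).2.symm ▸ hb ⟨j, hj⟩
  have hab' : ∀ j < d, inputMem d n i e a b (4 + 2 * j) ≤ inputMem d n i e a b (5 + 2 * j) :=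
    fun j hj => (hmem ⟨j, hj⟩).1.symm ▸ (hmem ⟨j, hj⟩).2.symm ▸ hab ⟨j, hj⟩
  -- The angle of amplitude amplification is `θ = arcsin √p`.
  have hθ : p = Real.sin (Real.arcsin √p) ^ 2 := by
    rw [Real.sin_arcsin (by linarith [Real.sqrt_nonneg p]) (Real.sqrt_le_one.2 hp1), Real.sq_sqrt hp0]
  have hV := (computes_walkL d n i w _ _ hn0 hn ha' hb' hab').2.1
  have hZ := (computes_zeroL (R := numRandom d i w) (E := flagCell d i w d + 1)
    (by have := numRandom_le_flagCell d i w d; omega)).2.1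
  set mem := inputMem d n i e a b with hmem_def
  have hcode : Code.main.circuit mem [] = ((List.range k).flatMap fun t => unitL (.rot 1 2) [] (r + t)) ++
        ((List.range (numRandom d i w)).flatMap (coinL d i) ++
        ((List.range (2 ^ k - 1)).flatMap (fun y => amplifyL d n i w (fun j => mem (4 + 2 * j))
          (fun j => mem (5 + 2 * j)) (r + (k - 1 - Nat.log 2 (y + 1)))) ++
        (List.range k).flatMap (fourierStageL r k))) := by
    rw [hr, hk, hw]
    exact Code.circuit_main (mem := mem) hn0.ne' he
  have hN : (Code.reg + Code.k).eval mem [] = r + k := by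
    rw [hr, hk, hw]; rfl
  have hM : Code.M.eval mem [] = 2 ^ k := by
    rw [Code.eval_M _ he, hk]; rfl
  have hreg : Code.reg.eval mem [] = r := by rw [hr, hw]; rfl
  have hkk : Code.k.eval mem [] = k := by rw [hk]; rfl
  have htgt : ∀ g ∈ Code.main.circuit mem [], g.tgt < r + k := by
    intro g hg
    have hRF := numRandom_le_flagCell d i w d
    have hcoin : ∀ j < numRandom d i w, g ∈ coinL d i j → g.tgt < r + k := fun j hj h => by
      rw [tgt_of_mem_coinL h]; omega
    rw [hcode] at hg
    simp only [List.mem_append, List.mem_flatMap, List.mem_range] at hg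
    rcases hg with ⟨t, ht, h⟩ | ⟨j, hj, h⟩ | ⟨y, hy, h⟩ | ⟨t, ht, h⟩
    · rw [tgt_lt_of_mem_unitL h]; omega
    · exact hcoin j hj h
    · unfold amplifyL at h
      rcases List.mem_append.1 h with h | h
      · exact tgt_lt_of_mem_oracle hV (by omega) (by omega) h
      rcases List.mem_append.1 h with h | h
      · obtain ⟨j, hj, h⟩ := List.mem_flatMap.1 h
        exact hcoin j (by simpa using hj) h
      rcases List.mem_append.1 h with h | h
      · exact tgt_lt_of_mem_oracle hZ (by omega) (by omega) h
      · obtain ⟨j, hj, h⟩ := List.mem_flatMap.1 h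
        exact hcoin j (by simpa using hj) h
    · exact tgt_lt_of_mem_fourierStageL ht h
  have hM0 : 0 < 2 ^ k := Nat.two_pow_pos k
  set g : ℕ → ℝ := fun y => open Classical in
    if E (1 - Real.sin (Real.pi * (y / (2 ^ k : ℕ))) ^ 2) then 1 else 0 with hg
  have key := estimation_accuracy hM0 hτ0 (by push_cast; exact hτ) hθ g
    (fun y => by simp only [hg]; split_ifs <;> norm_num)
    (fun y hy => by simp only [hg]; rw [if_pos (hE _ hy)])
  rw [← amplitude_estimation_walk v hn0 hn ha' hb' hab' hθ hr hχ g] at key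
  have hout : ∀ s : Fin (r + k) → Bool, Code.readout.eval mem s
      = 1 - Real.sin (Real.pi * ((ofDigits (fun l => bit s (r + l)) k : ℕ) / (2 ^ k : ℕ))) ^ 2 := by
    intro s
    have e1 : (Readout.bits Code.reg Code.k).eval mem s
        = (ofDigits (fun l => bit s (r + l)) k : ℕ) := by
      rw [Readout.eval, hreg, hkk, ofDigits_eq_sum]
      push_cast
      refine Finset.sum_congr rfl fun l _ => ?_
      cases bit s (r + l) <;> simp
    have e2 : Code.sine.eval mem s
        = Real.sin (Real.pi * (Readout.bits Code.reg Code.k).eval mem s / (Code.M.eval mem [] : ℕ)) := rfl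
    have e3 : Code.readout.eval mem s = (1 : ℕ) - Code.sine.eval mem s * Code.sine.eval mem s := rfl
    rw [e3, e2, e1, hM, mul_div_assoc, Nat.cast_one, sq]
  -- A variable `N` allows the equality of qubit numbers to be substituted in the type `Fin N →
  -- Bool`.
  have hfin : ∀ N, N = r + k → 99 / 100 ≤ (open Classical in ∑ s : Fin N → Bool,
      if E (Code.readout.eval mem s) then ‖finalState v N (Code.main.circuit mem []) s‖ ^ 2 else 0) := by
    rintro N rfl
    refine key.trans_eq (Finset.sum_congr rfl fun s _ => ?_)
    rw [hout s, finalState_eq_acts v _ htgt, hcode]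
    by_cases h : E (1 - Real.sin (Real.pi * ((ofDigits (fun l => bit s (r + l)) k : ℕ) / (2 ^ k : ℕ))) ^ 2)
    · simp only [hg]; rw [if_pos h, if_pos h, one_mul]
    · simp only [hg]; rw [if_neg h, if_neg h, zero_mul]
  exact hfin _ hN

/-! ### The random walk -/

/-- The conditional expectation over bit `t`. -/
def sample (c : ℕ → (ℕ → Bool) → Bool) (q : ℕ → (ℕ → Bool) → ℝ) (t : ℕ) (f : (ℕ → Bool) → ℝ)
    (m : ℕ → Bool) : ℝ :=
  (1 - prob1 t (c t) (q t) m) * f (Function.update m t false)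
    + prob1 t (c t) (q t) m * f (Function.update m t true)

/-- The conditional expectation over the bits `s, …, s + k - 1`. -/
def expectFrom (c : ℕ → (ℕ → Bool) → Bool) (q : ℕ → (ℕ → Bool) → ℝ) (s : ℕ) :
    ℕ → ((ℕ → Bool) → ℝ) → (ℕ → Bool) → ℝ
  | 0, f => f
  | k + 1, f => expectFrom c q s k (sample c q (s + k) f)

section
variable {c : ℕ → (ℕ → Bool) → Bool} {q : ℕ → (ℕ → Bool) → ℝ}

theorem expect_eq_expect_expectFrom (s k : ℕ) (f : (ℕ → Bool) → ℝ) :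
    expect c q (s + k) f = expect c q s (expectFrom c q s k f) := by
  induction k generalizing f with
  | zero => rfl
  | succ k ih => exact ih (sample c q (s + k) f)

theorem expect_sum {ι : Type*} (A : Finset ι) (k : ℕ) (z : ι → ℝ) (f : ι → (ℕ → Bool) → ℝ)
    (m : ℕ → Bool) :
    expect c q k (fun m => ∑ x ∈ A, z x * f x m) m = ∑ x ∈ A, z x * expect c q k (f x) m := by
  classical
  induction A using Finset.induction_on with
  | empty =>
    have := expect_mul (c := c) (q := q) k (fun _ => 0) (fun _ _ _ _ => rfl) (fun _ => 0)
    simpa using congrFun this m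
  | insert x A hx ih =>
    simp only [Finset.sum_insert hx]
    rw [expect_add, ih, expect_mul k (fun _ => z x) (fun _ _ _ _ => rfl)]

end

section
variable {d n : ℕ}

/-- The average over the neighbours of a grid point. -/
def avg [NeZero n] (F : (Fin d → Fin n) → ℝ) (x : Fin d → Fin n) : ℝ :=
  (∑ j, (F (x + Pi.single j 1) + F (x - Pi.single j 1))) / (2 * d)

/-- The memory with the coins of a step replaced by the ones that select move `ρ`. -/
def setCoins (d B ρ : ℕ) (m : ℕ → Bool) (a : ℕ) : Bool :=
  if B ≤ a ∧ a < B + 2 * d then decide (a - B < ρ) else m a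

theorem setCoins_update {B ρ r : ℕ} (hr : r < 2 * d) (m : ℕ → Bool) (b : Bool) :
    setCoins d B ρ (Function.update m (B + r) b) = setCoins d B ρ m := by
  funext a
  unfold setCoins
  split_ifs with h
  · rfl
  · rw [Function.update_of_ne (by omega)]

/-- The coins of a step select each of the `2d` moves with the same probability. -/
theorem expectFrom_coins (v : (Fin d → Fin n) → ℝ) {i s : ℕ} (hs : s < i)
    (f : (ℕ → Bool) → ℝ) (m : ℕ → Bool) :
    2 * d * expectFrom (bitCtrl d i) (bitProb v i) (2 * d * s) (2 * d) f m
      = ∑ ρ ∈ Finset.range (2 * d), f (setCoins d (2 * d * s) ρ m) := by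
  have hB : ∀ r < 2 * d, 2 * d * s + r < 2 * d * i := fun r hr => by
    calc 2 * d * s + r < 2 * d * (s + 1) := by rw [mul_add, mul_one]; omega
      _ ≤ 2 * d * i := Nat.mul_le_mul_left _ hs
  have hmod : ∀ r < 2 * d, (2 * d * s + r) % (2 * d) = r := fun r hr => by
    rw [Nat.mul_add_mod, Nat.mod_eq_of_lt hr]
  -- Backward induction: `F` is `f` with the coins from `r` on averaged out. Either the remaining
  -- coins are all `1` and `F` is the mean over the moves `ρ ≥ r`, or the pattern `1…10…0` has
  -- already fixed a move `ρ < r`. The conditional probabilities telescope to `1/(2d)`.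
  have key : ∀ r ≤ 2 * d, ∀ F : (ℕ → Bool) → ℝ,
      (∀ m, (∀ l < r, m (2 * d * s + l) = true) → ((2 * d - r : ℕ) : ℝ) * F m
        = ∑ ρ ∈ Finset.Ico r (2 * d), f (setCoins d (2 * d * s) ρ m)) →
      (∀ ρ < r, ∀ m, (∀ l < r, m (2 * d * s + l) = decide (l < ρ)) →
        F m = f (setCoins d (2 * d * s) ρ m)) →
      2 * d * expectFrom (bitCtrl d i) (bitProb v i) (2 * d * s) r F m
      = ∑ ρ ∈ Finset.range (2 * d), f (setCoins d (2 * d * s) ρ m) := by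
    intro r
    induction r with
    | zero =>
      intro _ F h1 _
      have := h1 m (by simp)
      rw [Nat.sub_zero, Nat.Ico_zero_eq_range] at this
      rw [← this, expectFrom]
      push_cast
      rfl
    | succ r ih =>
      intro hr F h1 h2
      have hr' : r < 2 * d := hr
      refine ih (by omega) _ (fun m hm => ?_) (fun ρ hρ m hm => ?_)
      · have hctrl : bitCtrl d i (2 * d * s + r) (Function.update m (2 * d * s + r) false) = true := by
          unfold bitCtrl
          rw [if_pos (by have := hB r hr'; omega), hmod r hr']
          split_ifs with h0
          · rw [Function.update_of_ne (by omega),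
              show 2 * d * s + r - 1 = 2 * d * s + (r - 1) by omega]
            exact hm (r - 1) (by omega)
          · rfl
        have hprob : prob1 (2 * d * s + r) (bitCtrl d i (2 * d * s + r)) (bitProb v i (2 * d * s + r)) m
            = ((2 * d - (r + 1) : ℕ) : ℝ) / (2 * d - r : ℕ) := by
          unfold prob1
          rw [if_pos hctrl]
          unfold bitProb
          rw [if_pos (by have := hB r hr'; omega), hmod r hr',
            show 2 * d - 1 - r = 2 * d - (r + 1) by omega,
            min_eq_right, max_eq_right (by positivity)]
          exact div_le_one_of_le₀ (by exact_mod_cast (by omega)) (by positivity)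
        have e0 := h2 r (by omega) (Function.update m (2 * d * s + r) false) fun l hl => by
          rcases Nat.lt_succ_iff_lt_or_eq.1 hl with h | rfl
          · rw [Function.update_of_ne (by omega), hm l h, decide_eq_true h]
          · simp
        have e1 := h1 (Function.update m (2 * d * s + r) true) fun l hl => by
          rcases Nat.lt_succ_iff_lt_or_eq.1 hl with h | rfl
          · rw [Function.update_of_ne (by omega), hm l h]
          · simp
        simp only [setCoins_update hr'] at e0 e1
        rw [sample, hprob, e0, Finset.sum_eq_sum_Ico_succ_bot hr', ← e1]
        have e3 : ((2 * d - r : ℕ) : ℝ) = (2 * d - (r + 1) : ℕ) + 1 := by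
          exact_mod_cast (by omega : 2 * d - r = 2 * d - (r + 1) + 1)
        rw [e3]
        have e4 : ((2 * d - (r + 1) : ℕ) : ℝ) + 1 ≠ 0 := by positivity
        field_simp
        ring
      · have hctrl : bitCtrl d i (2 * d * s + r) (Function.update m (2 * d * s + r) false) = false := by
          unfold bitCtrl
          rw [if_pos (by have := hB r hr'; omega), hmod r hr', if_pos (by omega),
            Function.update_of_ne (by omega),
            show 2 * d * s + r - 1 = 2 * d * s + (r - 1) by omega, hm (r - 1) (by omega)]
          exact decide_eq_false (by omega)
        have hprob : prob1 (2 * d * s + r) (bitCtrl d i (2 * d * s + r))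
            (bitProb v i (2 * d * s + r)) m = 0 := by
          unfold prob1
          rw [hctrl]
          rfl
        rw [sample, hprob, h2 ρ (by omega) (Function.update m (2 * d * s + r) false) fun l hl => ?_,
          setCoins_update hr']
        · ring
        · rcases Nat.lt_succ_iff_lt_or_eq.1 hl with h | rfl
          · rw [Function.update_of_ne (by omega), hm l h]
          · rw [Function.update_self]
            exact (decide_eq_false (by omega)).symm
  refine key (2 * d) le_rfl f (fun m _ => by simp) fun ρ hρ m hm => ?_
  congr 1
  funext a
  unfold setCoins
  split_ifs with h
  · rw [← hm (a - 2 * d * s) (by omega), show 2 * d * s + (a - 2 * d * s) = a by omega]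
  · rfl

theorem walkPos_congr {j : ℕ} (hj : j < d) {G H : ℕ → Bool} {x s : ℕ}
    (h : ∀ a < 2 * d * s, G a = H a) : walkPos d n j G x s = walkPos d n j H x s := by
  induction s with
  | zero => rfl
  | succ s ih =>
    have hlt : 2 * (s * d + j) + 1 < 2 * d * (s + 1) := by nlinarith
    have e : ∀ a < 2 * d * (s + 1), sel d G a = sel d H a := fun a ha => by
      unfold sel
      rw [h a ha, h (a - 1) (by omega)]
    rw [walkPos, walkPos, ih fun a ha => h a (by nlinarith), e _ (by omega), e _ hlt]

/-- The position after `s` steps of the walk that starts in `x`. -/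
def walkPoint (G : ℕ → Bool) (x : Fin d → Fin n) (s : ℕ) : Fin d → Fin n := fun j =>
  ⟨walkPos d n j G (x j) s, walkPos_lt (x j).2 s⟩

/-- Move `ρ` is coded by ones before coin `ρ` and zeros from it on, so consecutive coins differ
exactly at `ρ`. The virtual coin before the first one counts as `1`. -/
theorem sel_setCoins {s ρ r : ℕ} (hr : r < 2 * d) (m : ℕ → Bool) :
    sel d (setCoins d (2 * d * s) ρ m) (2 * d * s + r) = decide (r = ρ) := by
  have hmod : (2 * d * s + r) % (2 * d) = r := by rw [Nat.mul_add_mod, Nat.mod_eq_of_lt hr]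
  unfold sel setCoins
  rw [hmod, if_pos (by omega : 2 * d * s ≤ 2 * d * s + r ∧ 2 * d * s + r < 2 * d * s + 2 * d),
    Nat.add_sub_cancel_left]
  by_cases h0 : r = 0
  · subst h0
    rw [if_pos rfl, Bool.eq_iff_iff]
    simp
    omega
  · rw [if_neg h0, if_pos (by omega), Bool.eq_iff_iff,
      show 2 * d * s + r - 1 - 2 * d * s = r - 1 by omega]
    simp
    omega

theorem walkPoint_setCoins [NeZero n] {s : ℕ} (m : ℕ → Bool) (x : Fin d → Fin n) (j : Fin d) :
    walkPoint (setCoins d (2 * d * s) (2 * j) m) x (s + 1) = walkPoint m x s + Pi.single j 1 ∧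
    walkPoint (setCoins d (2 * d * s) (2 * j + 1) m) x (s + 1) = walkPoint m x s - Pi.single j 1 := by
  have h1 : ∀ ρ (l : Fin d), walkPos d n l (setCoins d (2 * d * s) ρ m) (x l) s
      = walkPos d n l m (x l) s := fun ρ l => walkPos_congr l.2 fun a ha => by
    unfold setCoins
    rw [if_neg (by omega)]
  have h2 : ∀ ρ (l : Fin d), sel d (setCoins d (2 * d * s) ρ m) (2 * (s * d + l))
      = decide (2 * (l : ℕ) = ρ) := fun ρ l => by
    rw [show 2 * (s * d + l) = 2 * d * s + 2 * l by ring]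
    exact sel_setCoins (by omega) m
  have h3 : ∀ ρ (l : Fin d), sel d (setCoins d (2 * d * s) ρ m) (2 * (s * d + l) + 1)
      = decide (2 * (l : ℕ) + 1 = ρ) := fun ρ l => by
    rw [show 2 * (s * d + l) + 1 = 2 * d * s + (2 * l + 1) by ring]
    exact sel_setCoins (by omega) m
  constructor
  · funext l
    apply Fin.ext
    rw [Pi.add_apply, Fin.val_add]
    simp only [walkPoint, walkPos, h1, h2, h3]
    by_cases hl : l = j
    · subst hl
      rw [decide_eq_true rfl, decide_eq_false (by omega), Pi.single_eq_same, Fin.val_one']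
      simp
    · have hl' : (l : ℕ) ≠ j := fun h => hl (Fin.ext h)
      rw [decide_eq_false (by omega), decide_eq_false (by omega), Pi.single_eq_of_ne hl]
      simp
  · funext l
    apply Fin.ext
    rw [Pi.sub_apply, Fin.val_sub]
    simp only [walkPoint, walkPos, h1, h2, h3]
    by_cases hl : l = j
    · subst hl
      rw [decide_eq_true rfl, decide_eq_false (by omega), Pi.single_eq_same, Fin.val_one']
      have hn := NeZero.pos n
      rcases Nat.lt_or_ge 1 n with h | h
      · simp [Nat.mod_eq_of_lt h, add_comm]
      · obtain rfl : n = 1 := by omega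
        simp [Nat.mod_one]
    · have hl' : (l : ℕ) ≠ j := fun h => hl (Fin.ext h)
      rw [decide_eq_false (by omega), decide_eq_false (by omega), Pi.single_eq_of_ne hl]
      simp

/-- The expectation of a function of the position after `s` steps. -/
theorem expect_walkPoint [NeZero n] (hd : 0 < d) (v : (Fin d → Fin n) → ℝ) {i s : ℕ} (hs : s ≤ i)
    (F : (Fin d → Fin n) → ℝ) (x : Fin d → Fin n) (m : ℕ → Bool) :
    expect (bitCtrl d i) (bitProb v i) (2 * d * s) (fun m => F (walkPoint m x s)) m
      = avg^[s] F x := by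
  induction s generalizing F with
  | zero => rfl
  | succ s ih =>
    -- Averaging over the coins of the last step turns `F` into `avg F`, to which the induction
    -- hypothesis applies.
    rw [Function.iterate_succ_apply, ← ih (by omega), mul_add, mul_one, expect_eq_expect_expectFrom]
    congr 1
    funext m
    have h := expectFrom_coins v (show s < i by omega) (fun m => F (walkPoint m x (s + 1))) m
    have hd' : (0 : ℝ) < 2 * d := by positivity
    rw [sum_range_two_mul, ← Fin.sum_univ_eq_sum_range (fun j => _ + _)] at h
    simp only [walkPoint_setCoins] at h
    rw [avg, eq_div_iff hd'.ne', mul_comm, h]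

/-- The memory with the code of the grid point `x` in the cells from `T` on. -/
def writeCode (T w : ℕ) (x : Fin d → Fin n) (m : ℕ → Bool) (a : ℕ) : Bool :=
  if T ≤ a ∧ a < T + d * w then codeBit x (a - T) else m a

theorem writeCode_update {T w p : ℕ} (hp : p < d * w) (x : Fin d → Fin n) (m : ℕ → Bool) (b : Bool) :
    writeCode T w x (Function.update m (T + p) b) = writeCode T w x m := by
  funext a
  unfold writeCode
  split_ifs with h
  · rfl
  · rw [Function.update_of_ne (by omega)]

theorem regionSum_split (v : (Fin d → Fin n) → ℝ) (β : ℕ → Bool) (p : ℕ) :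
    regionSum v β p = regionSum v (Function.update β p false) (p + 1)
      + regionSum v (Function.update β p true) (p + 1) := by
  have h : ∀ (x : Fin d → Fin n) b, (∀ l < p + 1, codeBit x l = Function.update β p b l)
      ↔ (∀ l < p, codeBit x l = β l) ∧ codeBit x p = b := by
    intro x b
    constructor
    · intro h
      refine ⟨fun l hl => ?_, ?_⟩
      · rw [h l (by omega), Function.update_of_ne (by omega)]
      · rw [h p (by omega), Function.update_self]
    · rintro ⟨h1, h2⟩ l hl
      rcases Nat.lt_succ_iff_lt_or_eq.1 hl with h | rfl
      · rw [Function.update_of_ne (by omega), h1 l h]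
      · rw [Function.update_self, h2]
  unfold regionSum
  rw [← Finset.sum_add_distrib]
  refine Finset.sum_congr rfl fun x _ => ?_
  simp only [h]
  by_cases h1 : ∀ l < p, codeBit x l = β l
  · cases codeBit x p <;> simp
  · simp [h1]

theorem regionSum_nonneg {v : (Fin d → Fin n) → ℝ} (hv : ∀ x, 0 ≤ v x) (β : ℕ → Bool) (p : ℕ) :
    0 ≤ regionSum v β p :=
  Finset.sum_nonneg fun x _ => by split_ifs; exacts [hv x, le_rfl]

/-- The code bits describe a random grid point with the distribution given by `v`. -/
theorem expectFrom_code {v : (Fin d → Fin n) → ℝ} (hv : ∀ x, 0 ≤ v x) (i w : ℕ)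
    (f : (ℕ → Bool) → ℝ) (m : ℕ → Bool) :
    (∑ x, v x) * expectFrom (bitCtrl d i) (bitProb v i) (2 * d * i) (d * w) f m
      = ∑ x, v x * f (writeCode (2 * d * i) w x m) := by
  set T := 2 * d * i with hT
  -- Backward induction: given the first `p` code bits, `F` times the weight of their region is the
  -- integral of `f` over that region. The fractions `θ` are conditional probabilities, so their
  -- products telescope.
  have key : ∀ p ≤ d * w, ∀ F : (ℕ → Bool) → ℝ,
      (∀ m, regionSum v (fun l => m (T + l)) p * F m
        = regionSum (fun x => v x * f (writeCode T w x m)) (fun l => m (T + l)) p) →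
      ∀ m, (∑ x, v x) * expectFrom (bitCtrl d i) (bitProb v i) T p F m
      = ∑ x, v x * f (writeCode T w x m) := by
    intro p
    induction p with
    | zero =>
      intro _ F hF m
      have := hF m
      simpa [regionSum, expectFrom] using this
    | succ p ih =>
      intro hp F hF
      refine ih (by omega) _ fun m => ?_
      have hu : ∀ b, (fun l => Function.update m (T + p) b (T + l))
          = Function.update (fun l => m (T + l)) p b := fun b => by
        funext l
        by_cases h : l = p
        · rw [h, Function.update_self, Function.update_self]
        · rw [Function.update_of_ne h, Function.update_of_ne (by omega)]
      have h0 := hF (Function.update m (T + p) false)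
      have h1 := hF (Function.update m (T + p) true)
      simp only [writeCode_update (show p < d * w by omega), hu] at h0 h1
      have hq : prob1 (T + p) (bitCtrl d i (T + p)) (bitProb v i (T + p)) m
          = max 0 (min 1 (regionSum v (Function.update (fun l => m (T + l)) p true) (p + 1)
            / regionSum v (fun l => m (T + l)) p)) := by
        unfold prob1
        have e1 : bitCtrl d i (T + p) (Function.update m (T + p) false) = true := by
          unfold bitCtrl
          rw [if_neg (by omega)]
        rw [if_pos e1, bitProb_congr v i (m' := m) fun a ha => Function.update_of_ne (by omega) _ _]
        unfold bitProb
        rw [if_neg (by omega), ← hT, Nat.add_sub_cancel_left]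
      have hs := regionSum_split v (fun l => m (T + l)) p
      have hs' := regionSum_split (fun x => v x * f (writeCode T w x m)) (fun l => m (T + l)) p
      have n0 := regionSum_nonneg hv (Function.update (fun l => m (T + l)) p false) (p + 1)
      have n1 := regionSum_nonneg hv (Function.update (fun l => m (T + l)) p true) (p + 1)
      rw [sample, hq, hs', ← h0, ← h1]
      -- In a region without weight the quotient takes the value `0` of a division by zero, but then
      -- all three weights vanish.
      by_cases hz : regionSum v (fun l => m (T + l)) p = 0
      · rw [hz] at hs ⊢
        have z0 : regionSum v (Function.update (fun l => m (T + l)) p false) (p + 1) = 0 := by linarith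
        have z1 : regionSum v (Function.update (fun l => m (T + l)) p true) (p + 1) = 0 := by linarith
        rw [z0, z1]
        ring
      · have hpos : 0 < regionSum v (fun l => m (T + l)) p :=
          lt_of_le_of_ne (by rw [hs]; positivity) (Ne.symm hz)
        rw [min_eq_right (div_le_one_of_le₀ (by linarith) hpos.le), max_eq_right (by positivity)]
        field_simp
        rw [hs]
        ring
  refine key (d * w) le_rfl f (fun m => ?_) m
  rw [mul_comm]
  unfold regionSum
  rw [Finset.mul_sum]
  refine Finset.sum_congr rfl fun x _ => ?_
  split_ifs with h
  · have : writeCode T w x m = m := by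
      funext a
      unfold writeCode
      split_ifs with h1
      · rw [h (a - T) (by omega)]
        show m (T + (a - T)) = m a
        rw [show T + (a - T) = a by omega]
      · rfl
    show f m * v x = v x * f (writeCode T w x m)
    rw [this, mul_comm]
  · rw [mul_zero]

/-- The probability that the walk ends in the region. -/
theorem expect_walkEnds [NeZero n] (hd : 0 < d) {v : (Fin d → Fin n) → ℝ} (hv : ∀ x, 0 ≤ v x)
    (hV : 0 < ∑ x, v x) {i w : ℕ} {a b : ℕ → ℕ} (hw : w = Nat.size n)
    (ha : ∀ j < d, a j < 2 ^ w) (hb : ∀ j < d, b j < 2 ^ w) (hab : ∀ j < d, a j ≤ b j) {m : ℕ → Bool}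
    (hm : ∀ c, numRandom d i w ≤ c → c < flagCell d i w d + 1 → m c = false) :
    expect (bitCtrl d i) (bitProb v i) (numRandom d i w) (ind (walkEnds d n i w a b)) m
      = (∑ x, v x * avg^[i] (fun y => open Classical in
          if ∀ j : Fin d, a j < y j ∧ (y j : ℕ) ≤ b j then 1 else 0) x) / ∑ x, v x := by
  have hn0 : 0 < n := NeZero.pos n
  have hn : n < 2 ^ w := hw ▸ Nat.lt_size_self n
  have hC := computes_walkL d n i w a b hn0 hn ha hb hab
  set F : (Fin d → Fin n) → ℝ := fun y => open Classical in
    if ∀ j : Fin d, a j < y j ∧ (y j : ℕ) ≤ b j then 1 else 0 with hF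
  have e1 : ∀ (x : Fin d → Fin n) (m : ℕ → Bool),
      (∀ c, numRandom d i w ≤ c → c < flagCell d i w d + 1 → m c = false) →
      ind (walkEnds d n i w a b) (writeCode (2 * d * i) w x m) = F (walkPoint m x i) := by
    intro x m hm
    have hG := hC.2.2 (writeCode (2 * d * i) w x m) (fun c h1 h2 => by
      unfold numRandom at h1
      unfold writeCode
      rw [if_neg (by omega)]
      exact hm c h1 h2) _ fun c _ => rfl
    set G := execs (walkL d n i w a b) (writeCode (2 * d * i) w x m) with hGdef
    have g1 : ∀ c < numRandom d i w, G c = writeCode (2 * d * i) w x m c := fun c hc =>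
      hC.2.1.execs_eq _ (Or.inl hc)
    have g2 : ∀ c < 2 * d * i, G c = m c := fun c hc => by
      rw [g1 c (by unfold numRandom; omega), writeCode, if_neg (by omega)]
    have g3 : ∀ j (hj : j < d), codeVal d i w G j = x ⟨j, hj⟩ := by
      intro j hj
      unfold codeVal
      rw [ofDigits_congr (c := (x ⟨j, hj⟩ : ℕ).testBit) fun q hq => ?_, ofDigits_testBit,
        Nat.mod_eq_of_lt ((x ⟨j, hj⟩).2.trans hn)]
      have h1 : j * w + (w - 1 - q) < d * w := by
        calc j * w + (w - 1 - q) < (j + 1) * w := by rw [add_mul, one_mul]; omega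
          _ ≤ d * w := Nat.mul_le_mul_right w hj
      have h2 : (j * w + (w - 1 - q)) / w = j := by
        rw [mul_comm, Nat.mul_add_div (by omega), Nat.div_eq_of_lt (by omega), add_zero]
      have h3 : (j * w + (w - 1 - q)) % w = w - 1 - q := by
        rw [mul_comm, Nat.mul_add_mod, Nat.mod_eq_of_lt (by omega)]
      rw [g1 _ (by unfold numRandom; omega), writeCode, if_pos (by omega), codeBit, ← hw,
        show 2 * d * i + j * w + (w - 1 - q) - 2 * d * i = j * w + (w - 1 - q) by omega]
      simp only [h2, h3]
      rw [dif_pos hj, show w - 1 - (w - 1 - q) = q by omega]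
    have hG' := hG fun j hj => by rw [g3 j hj]; exact (x ⟨j, hj⟩).2
    have e2 : walkEnds d n i w a b (writeCode (2 * d * i) w x m) = true
        ↔ ∀ j : Fin d, a j < walkPoint m x i j ∧ (walkPoint m x i j : ℕ) ≤ b j := by
      refine Iff.trans hG' ⟨fun h j => ?_, fun h j hj => ?_⟩
      · have := h j j.2
        rwa [g3 j j.2, walkPos_congr j.2 g2] at this
      · rw [g3 j hj, walkPos_congr hj g2]
        exact h ⟨j, hj⟩
    unfold ind
    simp only [hF]
    by_cases h : walkEnds d n i w a b (writeCode (2 * d * i) w x m) = true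
    · rw [if_pos h, if_pos (e2.1 h)]
    · rw [if_neg h, if_neg (mt e2.2 h)]
  -- The code bits come after the coins, so the starting point is averaged out for fixed coins; the
  -- coins then produce `avg^[i]`.
  have e3 : ∀ m' : ℕ → Bool, (∀ c, 2 * d * i ≤ c → m' c = m c) →
      expectFrom (bitCtrl d i) (bitProb v i) (2 * d * i) (d * w) (ind (walkEnds d n i w a b)) m'
        = ∑ x, (v x / ∑ x, v x) * F (walkPoint m' x i) := by
    intro m' hm'
    have h := expectFrom_code hv i w (ind (walkEnds d n i w a b)) m'
    rw [mul_comm, ← eq_div_iff hV.ne'] at h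
    rw [h, Finset.sum_div]
    refine Finset.sum_congr rfl fun x _ => ?_
    rw [e1 x m' fun c h1 h2 => by rw [hm' c (by unfold numRandom at h1; omega)]; exact hm c h1 h2]
    ring
  unfold numRandom
  rw [expect_eq_expect_expectFrom, expect_congr _ e3, expect_sum, Finset.sum_div]
  refine Finset.sum_congr rfl fun x _ => ?_
  rw [expect_walkPoint hd v le_rfl]
  ring

end

/-! ### Differences of functions on the line -/

theorem abs_le_of_abs_deriv_le {f f' : ℝ → ℝ} (h0 : f 0 = 0) (hf : ∀ x, HasDerivAt f (f' x) x)
    {C : ℝ} {k : ℕ} (hC : ∀ x, 0 ≤ x → |f' x| ≤ C * x ^ k) {x : ℝ} (hx : 0 ≤ x) :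
    |f x| ≤ C / (k + 1) * x ^ (k + 1) := by
  have hk : (k : ℝ) + 1 ≠ 0 := by positivity
  have hB : ∀ y, HasDerivAt (fun y : ℝ => C / (k + 1) * y ^ (k + 1)) (C * y ^ k) y := fun y => by
    refine ((hasDerivAt_pow (k + 1) y).const_mul (C / (k + 1))).congr_deriv ?_
    push_cast
    field_simp
  refine image_norm_le_of_norm_deriv_right_le_deriv_boundary (a := 0) (b := x)
    (fun y _ => (hf y).continuousAt.continuousWithinAt) (fun y _ => (hf y).hasDerivWithinAt)
    (by simp [h0]) hB (fun y hy => hC y hy.1) ⟨hx, le_rfl⟩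

theorem hasDerivAt_neg_arg {f f' : ℝ → ℝ} (hf : ∀ x, HasDerivAt f (f' x) x) (x : ℝ) :
    HasDerivAt (fun x => f (-x)) (-f' (-x)) x := by
  exact ((hf (-x)).scomp x (hasDerivAt_neg x)).congr_deriv (by simp)

/-- Symmetrisation: the derivative of `g x + g (-x)` is `g₁ x - g₁ (-x)`, whose derivative is
bounded by `2 * B`. Two integrations from `0` give the claim. -/
theorem abs_second_difference_le {g g₁ g₂ : ℝ → ℝ} (h₁ : ∀ x, HasDerivAt g (g₁ x) x)
    (h₂ : ∀ x, HasDerivAt g₁ (g₂ x) x) {B : ℝ} (hB : ∀ x, |g₂ x| ≤ B) {x : ℝ} (hx : 0 ≤ x) :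
    |g x + g (-x) - 2 * g 0| ≤ B * x ^ 2 := by
  have e1 : ∀ y, 0 ≤ y → |g₁ y - g₁ (-y)| ≤ 2 * B * y ^ 1 := fun y hy => by
    have := abs_le_of_abs_deriv_le (f := fun y => g₁ y - g₁ (-y)) (f' := fun y => g₂ y + g₂ (-y))
      (C := 2 * B) (k := 0) (by simp)
      (fun y => ((h₂ y).sub (hasDerivAt_neg_arg h₂ y)).congr_deriv (by ring))
      (fun y _ => by
        rw [pow_zero, mul_one]
        exact (abs_add_le _ _).trans (by linarith [hB y, hB (-y)])) hy
    simpa using this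
  have := abs_le_of_abs_deriv_le (f := fun y => g y + g (-y) - 2 * g 0)
    (f' := fun y => g₁ y - g₁ (-y)) (by simp; ring)
    (fun y => (((h₁ y).add (hasDerivAt_neg_arg h₁ y)).sub_const (2 * g 0)).congr_deriv (by ring))
    e1 hx
  refine this.trans_eq ?_
  push_cast
  ring

/-- The previous estimate for `g₂` is integrated twice more, which yields the constants `B/3` and
`B/12`; odd terms cancel by symmetry. -/
theorem abs_second_difference_sub_le {g g₁ g₂ g₃ g₄ : ℝ → ℝ} (h₁ : ∀ x, HasDerivAt g (g₁ x) x)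
    (h₂ : ∀ x, HasDerivAt g₁ (g₂ x) x) (h₃ : ∀ x, HasDerivAt g₂ (g₃ x) x)
    (h₄ : ∀ x, HasDerivAt g₃ (g₄ x) x) {B : ℝ} (hB : ∀ x, |g₄ x| ≤ B) {x : ℝ} (hx : 0 ≤ x) :
    |g x + g (-x) - 2 * g 0 - x ^ 2 * g₂ 0| ≤ B / 12 * x ^ 4 := by
  have e2 : ∀ y, 0 ≤ y → |g₂ y + g₂ (-y) - 2 * g₂ 0| ≤ B * y ^ 2 := fun y hy =>
    abs_second_difference_le h₃ h₄ hB hy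
  have e1 : ∀ y, 0 ≤ y → |g₁ y - g₁ (-y) - 2 * y * g₂ 0| ≤ B / 3 * y ^ 3 := fun y hy => by
    have := abs_le_of_abs_deriv_le (f := fun y => g₁ y - g₁ (-y) - 2 * y * g₂ 0)
      (f' := fun y => g₂ y + g₂ (-y) - 2 * g₂ 0) (by simp)
      (fun y => by
        refine HasDerivAt.congr_deriv (((h₂ y).sub (hasDerivAt_neg_arg h₂ y)).sub
          (((hasDerivAt_id y).const_mul 2).mul_const (g₂ 0))) ?_
        ring) e2 hy
    refine this.trans_eq ?_
    push_cast
    ring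
  have := abs_le_of_abs_deriv_le (f := fun y => g y + g (-y) - 2 * g 0 - y ^ 2 * g₂ 0)
    (f' := fun y => g₁ y - g₁ (-y) - 2 * y * g₂ 0) (by simp; ring)
    (fun y => by
      refine HasDerivAt.congr_deriv ((((h₁ y).add (hasDerivAt_neg_arg h₁ y)).sub_const (2 * g 0)).sub
        ((hasDerivAt_pow 2 y).mul_const (g₂ 0))) ?_
      push_cast
      ring) e1 hx
  refine this.trans_eq ?_
  push_cast
  ring

theorem second_deriv_nonpos_of_forall_le {g g₁ : ℝ → ℝ} {c : ℝ} (h₁ : ∀ x, HasDerivAt g (g₁ x) x)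
    (h₂ : HasDerivAt g₁ c 0) (hmax : ∀ x, g x ≤ g 0) : c ≤ 0 := by
  by_contra! hc
  have h0 : g₁ 0 = 0 := IsLocalMax.hasDerivAt_eq_zero (Filter.Eventually.of_forall hmax) (h₁ 0)
  have h3 := (hasDerivAt_iff_tendsto_slope.1 h₂).eventually_const_lt hc
  obtain ⟨δ, hδ, hpos⟩ := Metric.mem_nhdsWithin_iff.1 h3
  have hg1 : ∀ x ∈ Set.Ioo 0 (δ / 2), 0 < g₁ x := by
    intro x hx
    have : 0 < slope g₁ 0 x := hpos ⟨by
      rw [Metric.mem_ball, Real.dist_eq, sub_zero, abs_of_pos hx.1]; linarith [hx.2], hx.1.ne'⟩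
    rw [slope_def_field, h0, sub_zero, sub_zero] at this
    exact (div_pos_iff_of_pos_right hx.1).1 this
  have hmono : StrictMonoOn g (Set.Icc 0 (δ / 2)) :=
    strictMonoOn_of_deriv_pos (convex_Icc _ _)
      (fun x _ => (h₁ x).continuousAt.continuousWithinAt) fun x hx => by
        rw [interior_Icc] at hx
        rw [(h₁ x).deriv]
        exact hg1 x hx
  exact absurd (hmono ⟨le_rfl, by linarith⟩ ⟨by linarith, le_rfl⟩ (by linarith)) (not_lt.2 (hmax _))

/-- Slopes to earlier times are nonnegative at a maximum. Approaching from the left also covers the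
end point `s = S`. -/
theorem deriv_nonneg_of_forall_le {g : ℝ → ℝ} {c s S : ℝ} (hs : 0 < s) (hsS : s ≤ S)
    (hg : HasDerivWithinAt g c (Set.Icc 0 S) s) (hmax : ∀ r ∈ Set.Icc 0 S, g r ≤ g s) : 0 ≤ c := by
  have h1 : HasDerivWithinAt g c (Set.Ico 0 s) s :=
    hg.mono fun r hr => ⟨hr.1, hr.2.le.trans hsS⟩
  have h2 := (hasDerivWithinAt_iff_tendsto_slope' (by simp)).1 h1
  have : (nhdsWithin s (Set.Ico 0 s)).NeBot := by
    rw [← mem_closure_iff_nhdsWithin_neBot, closure_Ico hs.ne]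
    exact ⟨hs.le, le_rfl⟩
  refine ge_of_tendsto h2 ?_
  filter_upwards [self_mem_nhdsWithin] with r hr
  rw [slope_def_field]
  exact div_nonneg_of_nonpos (sub_nonpos.2 (hmax r ⟨hr.1, hr.2.le.trans hsS⟩)) (by linarith [hr.2])

/-! ### Partial derivatives of periodic functions -/

section
variable {d : ℕ} {f : (Fin d → ℝ) → ℝ}

theorem hasDerivAt_pd (hf : Differentiable ℝ f) (j : Fin d) (x : Fin d → ℝ) (s : ℝ) :
    HasDerivAt (fun s : ℝ => f (x + s • Pi.single j 1)) (pd j f (x + s • Pi.single j 1)) s := by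
  have h1 : HasDerivAt (fun s : ℝ => x + s • (Pi.single j 1 : Fin d → ℝ)) (Pi.single j 1) s := by
    simpa using ((hasDerivAt_id s).smul_const (Pi.single j 1 : Fin d → ℝ)).const_add x
  rw [pd, (hf _).lineDeriv_eq_fderiv]
  exact (hf _).hasFDerivAt.comp_hasDerivAt s h1

theorem contDiff_pd {m : ℕ} (hf : ContDiff ℝ (m + 1 : ℕ) f) (j : Fin d) :
    ContDiff ℝ m (pd j f) := by
  have e : pd j f = fun x => fderiv ℝ f x (Pi.single j 1) := by
    funext x
    exact ((hf.differentiable (by simp)) x).lineDeriv_eq_fderiv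
  rw [e]
  exact (hf.fderiv_right (m := (m : ℕ)) (by norm_cast)).clm_apply contDiff_const

/-- `f` is periodic with period `L` in every coordinate. -/
def IsPeriodic (L : ℝ) (f : (Fin d → ℝ) → ℝ) : Prop := ∀ x j, f (x + Pi.single j L) = f x

theorem IsPeriodic.pd {L : ℝ} (hf : IsPeriodic L f) (j : Fin d) : IsPeriodic L (pd j f) := by
  intro x k
  unfold HeatQ.pd lineDeriv
  congr 1
  funext s
  rw [add_right_comm, hf]

/-- Every coordinate is reduced modulo `L`. The bounds assumed on the cube thereby hold on all of
space. -/
theorem IsPeriodic.exists_mem_cube {L : ℝ} (hL : 0 < L) (hf : IsPeriodic L f) (x : Fin d → ℝ) :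
    ∃ y ∈ cube d L, f y = f x ∧ ∀ g : (Fin d → ℝ) → ℝ, IsPeriodic L g → g y = g x := by
  have key : ∀ g : (Fin d → ℝ) → ℝ, IsPeriodic L g →
      g (fun j => toIcoMod hL 0 (x j)) = g x := by
    intro g hg
    have hstep : ∀ (z : Fin d → ℝ) j (m : ℤ), g (z + Pi.single j (m * L)) = g z := by
      intro z j m
      have hper : Function.Periodic (fun s : ℝ => g (z + Pi.single j s)) L := fun s => by
        show g (z + Pi.single j (s + L)) = g (z + Pi.single j s)
        rw [Pi.single_add, ← add_assoc, hg]
      have := hper.int_mul m 0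
      simpa using this
    have : ∀ A : Finset (Fin d), g (x + ∑ j ∈ A, Pi.single j ((-toIcoDiv hL 0 (x j) : ℤ) * L)) = g x := by
      intro A
      induction A using Finset.induction_on with
      | empty => simp
      | insert j A hj ih => rw [Finset.sum_insert hj, add_comm (Pi.single j _), ← add_assoc, hstep, ih]
    rw [← this Finset.univ]
    congr 1
    funext j
    rw [Finset.univ_sum_single]
    simp only [Pi.add_apply, toIcoMod, zsmul_eq_mul]
    push_cast
    ring
  refine ⟨_, ⟨fun j => ?_, fun j => ?_⟩, key f hf, key⟩
  · exact left_le_toIcoMod hL 0 (x j)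
  · have := (toIcoMod_lt_right hL 0 (x j)).le
    simpa using this

theorem IsPeriodic.abs_le {L B : ℝ} (hL : 0 < L) (hf : IsPeriodic L f)
    (hB : ∀ x ∈ cube d L, |f x| ≤ B) (x : Fin d → ℝ) : |f x| ≤ B := by
  obtain ⟨y, hy, e, _⟩ := hf.exists_mem_cube hL x
  exact e ▸ hB y hy

end

/-- The Laplace operator. -/
def laplace {d : ℕ} (f : (Fin d → ℝ) → ℝ) (x : Fin d → ℝ) : ℝ := ∑ j, pd j (pd j f) x

section
variable {d : ℕ} {L T α ζ : ℝ} {u : (Fin d → ℝ) → ℝ → ℝ}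

theorem IsHeatSolution.contDiff_pd_pd (hu : IsHeatSolution d L T α u) {t : ℝ} (ht : t ∈ Set.Icc 0 T)
    (j : Fin d) : ContDiff ℝ 2 (pd j (pd j fun y => u y t)) :=
  contDiff_pd (m := 2) (contDiff_pd (m := 3) (hu.smooth t ht) j) j

theorem IsHeatSolution.isPeriodic (hu : IsHeatSolution d L T α u) {t : ℝ} (ht : t ∈ Set.Icc 0 T) :
    IsPeriodic L (fun y => u y t) := hu.periodic t ht

theorem abs_pd_pd_le (hL : 0 < L) (hu : IsHeatSolution d L T α u) (hb : HasSmoothnessBound d L T ζ u)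
    {t : ℝ} (ht : t ∈ Set.Icc 0 T) (j : Fin d) (x : Fin d → ℝ) :
    |pd j (pd j fun y => u y t) x| ≤ ζ / L ^ ((d : ℤ) - 2) :=
  (((hu.isPeriodic ht).pd j).pd j).abs_le hL (fun x hx => hb.second t ht x hx j) x

theorem abs_pd_four_le (hL : 0 < L) (hu : IsHeatSolution d L T α u)
    (hb : HasSmoothnessBound d L T ζ u)
    {t : ℝ} (ht : t ∈ Set.Icc 0 T) (j k : Fin d) (x : Fin d → ℝ) :
    |pd j (pd j (pd k (pd k fun y => u y t))) x| ≤ ζ / L ^ d :=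
  (((((hu.isPeriodic ht).pd k).pd k).pd j).pd j).abs_le hL (fun x hx => hb.fourth t ht x hx j k) x

/-- The second difference quotient approximates the second derivative. -/
theorem abs_second_difference_sub_pd_le (hL : 0 < L) (hu : IsHeatSolution d L T α u)
    (hb : HasSmoothnessBound d L T ζ u) {t : ℝ} (ht : t ∈ Set.Icc 0 T) (j : Fin d) (x : Fin d → ℝ)
    {h : ℝ} (hh : 0 ≤ h) :
    |u (x + Pi.single j h) t + u (x - Pi.single j h) t - 2 * u x t
      - h ^ 2 * pd j (pd j fun y => u y t) x| ≤ ζ / L ^ d / 12 * h ^ 4 := by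
  have c4 := hu.smooth t ht
  have c3 := contDiff_pd (m := 3) c4 j
  have c2 := contDiff_pd (m := 2) c3 j
  have c1 := contDiff_pd (m := 1) c2 j
  have key := abs_second_difference_sub_le
    (hasDerivAt_pd (c4.differentiable (by simp)) j x) (hasDerivAt_pd (c3.differentiable (by simp)) j x)
    (hasDerivAt_pd (c2.differentiable (by simp)) j x) (hasDerivAt_pd (c1.differentiable (by simp)) j x)
    (fun s => abs_pd_four_le hL hu hb ht j j _) hh
  have e1 : h • (Pi.single j 1 : Fin d → ℝ) = Pi.single j h := by
    rw [← Pi.single_smul, smul_eq_mul, mul_one]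
  simpa [neg_smul, e1, ← sub_eq_add_neg] using key

theorem abs_second_difference_le_of_mem (hL : 0 < L) (hu : IsHeatSolution d L T α u)
    (hb : HasSmoothnessBound d L T ζ u) {t : ℝ} (ht : t ∈ Set.Icc 0 T) (j : Fin d) (x : Fin d → ℝ)
    {h : ℝ} (hh : 0 ≤ h) :
    |u (x + Pi.single j h) t + u (x - Pi.single j h) t - 2 * u x t|
      ≤ ζ / L ^ ((d : ℤ) - 2) * h ^ 2 := by
  have c4 := hu.smooth t ht
  have c3 := contDiff_pd (m := 3) c4 j
  have key := abs_second_difference_le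
    (hasDerivAt_pd (c4.differentiable (by simp)) j x) (hasDerivAt_pd (c3.differentiable (by simp)) j x)
    (fun s => abs_pd_pd_le hL hu hb ht j _) hh
  have e1 : h • (Pi.single j 1 : Fin d → ℝ) = Pi.single j h := by
    rw [← Pi.single_smul, smul_eq_mul, mul_one]
  simpa [neg_smul, e1, ← sub_eq_add_neg] using key

end

/-! ### The error of a time step -/

section
variable {d : ℕ} {L T α ζ : ℝ} {u : (Fin d → ℝ) → ℝ → ℝ}

/-- Maximum principle: by periodicity a maximum exists on a compact set. At a positive time it has
nonnegative time derivative, contrary to `hder`, so it lies at time `0`. -/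
theorem forall_le_zero_of_max {z : (Fin d → ℝ) → ℝ → ℝ} {S : ℝ} (hL : 0 < L)
    (hper : ∀ s ∈ Set.Icc 0 S, IsPeriodic L fun x => z x s)
    (hcont : ContinuousOn (fun p : (Fin d → ℝ) × ℝ => z p.1 p.2) (Set.univ ×ˢ Set.Icc 0 S))
    (h0 : ∀ x, z x 0 ≤ 0)
    (hder : ∀ s ∈ Set.Icc 0 S, ∀ x, (∀ y, z y s ≤ z x s) →
      ∃ c < 0, HasDerivWithinAt (fun s => z x s) c (Set.Icc 0 S) s) :
    ∀ s ∈ Set.Icc 0 S, ∀ x, z x s ≤ 0 := by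
  intro s hs x
  have hne : (cube d L ×ˢ Set.Icc 0 S).Nonempty :=
    ⟨(0, s), ⟨⟨le_rfl, fun _ => hL.le⟩, hs⟩⟩
  obtain ⟨⟨x₀, s₀⟩, ⟨hx₀, hs₀⟩, hmax⟩ := (isCompact_Icc.prod isCompact_Icc).exists_isMaxOn hne
    (hcont.mono (Set.prod_mono (Set.subset_univ _) le_rfl))
  have hmax' : ∀ r ∈ Set.Icc 0 S, ∀ y, z y r ≤ z x₀ s₀ := by
    intro r hr y
    obtain ⟨y', hy', e, _⟩ := (hper r hr).exists_mem_cube hL y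
    exact e ▸ hmax (show (y', r) ∈ _ from ⟨hy', hr⟩)
  refine (hmax' s hs x).trans ?_
  rcases hs₀.1.eq_or_lt with h | h
  · rw [show s₀ = 0 from h.symm]
    exact h0 x₀
  · obtain ⟨c, hc, hder⟩ := hder s₀ hs₀ x₀ fun y => hmax' s₀ hs₀ y
    exact absurd (deriv_nonneg_of_forall_le h hs₀.2 hder fun r hr => hmax' r hr x₀) (not_le.2 hc)

/-- By the heat equation and the bound on second derivatives, `u` is Lipschitz in time uniformly in
`x`; with continuity in `x` this gives joint continuity. -/
theorem IsHeatSolution.continuousOn (hL : 0 < L) (hα : 0 < α) (hu : IsHeatSolution d L T α u)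
    (hb : HasSmoothnessBound d L T ζ u) :
    ContinuousOn (fun p : (Fin d → ℝ) × ℝ => u p.1 p.2) (Set.univ ×ˢ Set.Icc 0 T) := by
  refine continuousOn_prod_of_continuousOn_lipschitzOnWith' _
    (Real.toNNReal (α * (d * (ζ / L ^ ((d : ℤ) - 2))))) (fun x _ => ?_) fun t ht => ?_
  · refine (convex_Icc 0 T).lipschitzOnWith_of_nnnorm_hasDerivWithin_le
      (fun t ht => hu.heat t ht x) fun t ht => ?_
    rw [← NNReal.coe_le_coe, coe_nnnorm]
    refine le_trans ?_ (Real.le_coe_toNNReal _)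
    rw [Real.norm_eq_abs, abs_mul, abs_of_pos hα]
    gcongr
    refine (Finset.abs_sum_le_sum_abs _ _).trans ?_
    refine (Finset.sum_le_sum fun j _ => abs_pd_pd_le hL hu hb ht j x).trans ?_
    simp
  · exact (hu.smooth t ht).continuous.continuousOn

theorem abs_sum_pd_four_le (hL : 0 < L) (hu : IsHeatSolution d L T α u)
    (hb : HasSmoothnessBound d L T ζ u)
    {t : ℝ} (ht : t ∈ Set.Icc 0 T) (x : Fin d → ℝ) :
    |∑ j, ∑ k, pd j (pd j (pd k (pd k fun y => u y t))) x| ≤ d ^ 2 * (ζ / L ^ d) := by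
  calc _ ≤ ∑ j : Fin d, ∑ k : Fin d, ζ / L ^ d :=
        (Finset.abs_sum_le_sum_abs _ _).trans (Finset.sum_le_sum fun j _ =>
          (Finset.abs_sum_le_sum_abs _ _).trans (Finset.sum_le_sum fun k _ =>
            abs_pd_four_le hL hu hb ht j k x))
    _ = _ := by simp; ring

/-- A second time derivative is not assumed to exist, so Taylor's formula in time is replaced by the
maximum principle for the remainder minus a quadratic barrier. At a spatial maximum the second
derivatives are nonpositive, so the heat equation bounds the time derivative of the remainder by `σ
r α² Δ²u(·,t) ≤ r α² A`, the derivative of the barrier. Only fourth derivatives at the fixed time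
`t` enter. -/
theorem signed_time_step_le (hL : 0 < L) (hα : 0 < α) (hu : IsHeatSolution d L T α u)
    (hb : HasSmoothnessBound d L T ζ u) {σ : ℝ} (hσ : |σ| = 1) {t s : ℝ} (ht : 0 ≤ t) (hs : 0 ≤ s)
    (hst : t + s ≤ T) (x : Fin d → ℝ) :
    σ * (u x (t + s) - u x t - s * α * laplace (fun y => u y t) x)
      ≤ s ^ 2 * α ^ 2 * (d ^ 2 * (ζ / L ^ d)) / 2 := by
  set A := d ^ 2 * (ζ / L ^ d) with hA
  have htT : t ∈ Set.Icc 0 T := ⟨ht, by linarith⟩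
  have hmem : ∀ r ∈ Set.Icc 0 (T - t), t + r ∈ Set.Icc 0 T := fun r hr =>
    ⟨by linarith [hr.1], by linarith [hr.2]⟩
  have hlap : Continuous (laplace fun y => u y t) :=
    continuous_finsetSum _ fun j _ => (hu.contDiff_pd_pd htT j).continuous
  have hlapper : IsPeriodic L (laplace fun y => u y t) := fun x k =>
    Finset.sum_congr rfl fun j _ => (((hu.isPeriodic htT).pd j).pd j) x k
  -- The term `δ * r` makes the time derivative at the maximum strictly negative; it is removed at
  -- the end by letting `δ` tend to zero.
  have key : ∀ δ > 0, ∀ r ∈ Set.Icc 0 (T - t), ∀ x,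
      σ * (u x (t + r) - u x t - r * α * laplace (fun y => u y t) x)
        - r ^ 2 * α ^ 2 * A / 2 - δ * r ≤ 0 := by
    intro δ hδ
    refine forall_le_zero_of_max hL (fun r hr => ?_) ?_ (fun x => ?_) fun r hr x hmax => ?_
    · intro x k
      have e1 := hu.isPeriodic (hmem r hr) x k
      have e2 := hu.isPeriodic htT x k
      have e3 := hlapper x k
      simp only at e1 e2 ⊢
      rw [e1, e2, e3]
    · have c1 : ContinuousOn (fun p : (Fin d → ℝ) × ℝ => u p.1 (t + p.2))
          (Set.univ ×ˢ Set.Icc 0 (T - t)) :=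
        (hu.continuousOn hL hα hb).comp (f := fun p : (Fin d → ℝ) × ℝ => (p.1, t + p.2))
          (by fun_prop) fun p hp => ⟨trivial, hmem p.2 hp.2⟩
      have c2 : Continuous fun p : (Fin d → ℝ) × ℝ => u p.1 t :=
        (hu.smooth t htT).continuous.comp continuous_fst
      have c3 : Continuous fun p : (Fin d → ℝ) × ℝ => laplace (fun y => u y t) p.1 :=
        hlap.comp continuous_fst
      have c2' := c2.continuousOn (s := Set.univ ×ˢ Set.Icc 0 (T - t))
      have c3' := c3.continuousOn (s := Set.univ ×ˢ Set.Icc 0 (T - t))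
      refine ((continuousOn_const.mul ((c1.sub c2').sub
        ((continuous_snd.mul continuous_const).continuousOn.mul c3'))).sub ?_).sub ?_
      · exact Continuous.continuousOn (by fun_prop)
      · exact Continuous.continuousOn (by fun_prop)
    · simp
    · have c4 := hu.smooth (t + r) (hmem r hr)
      have c3 := fun j => contDiff_pd (m := 3) c4 j
      have b4 := hu.smooth t htT
      have b3 := fun j => contDiff_pd (m := 3) b4 j
      have b2 := fun j => hu.contDiff_pd_pd htT j
      have b1 := fun j k => contDiff_pd (m := 1) (b2 k) j
      have hj : ∀ j, σ * (pd j (pd j fun y => u y (t + r)) x - pd j (pd j fun y => u y t) x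
          - r * α * ∑ k, pd j (pd j (pd k (pd k fun y => u y t))) x) ≤ 0 := by
        intro j
        have d1 := fun s => ((((hasDerivAt_pd (c4.differentiable (by simp)) j x s).sub
          (hasDerivAt_pd (b4.differentiable (by simp)) j x s)).sub
          ((HasDerivAt.fun_sum (u := Finset.univ) fun k _ =>
            hasDerivAt_pd ((b2 k).differentiable (by simp)) j x s).const_mul (r * α))).const_mul σ).sub_const
              (r ^ 2 * α ^ 2 * A / 2 + δ * r)
        have d2 := ((((hasDerivAt_pd ((c3 j).differentiable (by simp)) j x 0).sub
          (hasDerivAt_pd ((b3 j).differentiable (by simp)) j x 0)).sub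
          ((HasDerivAt.fun_sum (u := Finset.univ) fun k _ =>
            hasDerivAt_pd ((b1 j k).differentiable (by simp)) j x 0).const_mul (r * α))).const_mul σ)
        have := second_deriv_nonpos_of_forall_le d1 d2 fun s => by
          have := hmax (x + s • Pi.single j 1)
          simp only [zero_smul, add_zero, Pi.sub_apply]
          unfold laplace at this
          linarith
        simpa using this
      have hsum : σ * (laplace (fun y => u y (t + r)) x - laplace (fun y => u y t) x
          - r * α * ∑ j, ∑ k, pd j (pd j (pd k (pd k fun y => u y t))) x) ≤ 0 := by
        have := Finset.sum_nonpos fun j (_ : j ∈ Finset.univ) => hj j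
        rwa [← Finset.mul_sum, Finset.sum_sub_distrib, Finset.sum_sub_distrib, ← Finset.mul_sum] at this
      have h4 : σ * ∑ j, ∑ k, pd j (pd j (pd k (pd k fun y => u y t))) x ≤ A := by
        refine (le_abs_self _).trans ?_
        rw [abs_mul, hσ, one_mul]
        exact abs_sum_pd_four_le hL hu hb htT x
      refine ⟨σ * (α * laplace (fun y => u y (t + r)) x - α * laplace (fun y => u y t) x)
        - r * α ^ 2 * A - δ, ?_, ?_⟩
      · have h5 : r * α ^ 2 * (σ * ∑ j, ∑ k, pd j (pd j (pd k (pd k fun y => u y t))) x)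
            ≤ r * α ^ 2 * A := mul_le_mul_of_nonneg_left h4 (mul_nonneg hr.1 (sq_nonneg α))
        have h6 := mul_le_mul_of_nonneg_left hsum hα.le
        nlinarith
      · have g1 : HasDerivWithinAt (fun r => u x (t + r)) (α * laplace (fun y => u y (t + r)) x)
            (Set.Icc 0 (T - t)) r := by
          have := (hu.heat (t + r) (hmem r hr) x).scomp r
            (((hasDerivAt_id r).const_add t).hasDerivWithinAt (s := Set.Icc 0 (T - t)))
            fun r hr => hmem r hr
          exact this.congr_deriv (by simp [laplace])
        have g2 := (((g1.sub_const (u x t)).sub (((hasDerivAt_id r).mul_const α).mul_const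
          (laplace (fun y => u y t) x)).hasDerivWithinAt).const_mul σ).sub
          ((((hasDerivAt_pow 2 r).mul_const (α ^ 2)).mul_const A).div_const 2).hasDerivWithinAt
        refine (g2.sub ((hasDerivAt_id r).const_mul δ).hasDerivWithinAt).congr_deriv ?_
        push_cast
        ring
  have hs' : s ∈ Set.Icc 0 (T - t) := ⟨hs, by linarith⟩
  refine le_of_forall_pos_le_add fun η hη => ?_
  have := key (η / (s + 1)) (by positivity) s hs' x
  have h2 : η / (s + 1) * s ≤ η := by
    rw [div_mul_eq_mul_div, div_le_iff₀ (by positivity)]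
    nlinarith
  linarith

/-- The error of an explicit Euler step in time. -/
theorem abs_time_step_le (hL : 0 < L) (hα : 0 < α) (hu : IsHeatSolution d L T α u)
    (hb : HasSmoothnessBound d L T ζ u) {t s : ℝ} (ht : 0 ≤ t) (hs : 0 ≤ s)
    (hst : t + s ≤ T) (x : Fin d → ℝ) :
    |u x (t + s) - u x t - s * α * laplace (fun y => u y t) x|
      ≤ s ^ 2 * α ^ 2 * (d ^ 2 * (ζ / L ^ d)) / 2 := by
  have h1 := signed_time_step_le hL hα hu hb (σ := 1) (by simp) ht hs hst x
  have h2 := signed_time_step_le hL hα hu hb (σ := -1) (by simp) ht hs hst x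
  exact abs_le.2 ⟨by linarith, by linarith⟩

/-- The error of an averaging step. -/
theorem abs_sub_average_le (hd : 0 < d) (hL : 0 < L) (hα : 0 < α) (hu : IsHeatSolution d L T α u)
    (hb : HasSmoothnessBound d L T ζ u) {t h : ℝ} (ht : 0 ≤ t) (hh : 0 ≤ h)
    (hst : t + h ^ 2 / (2 * d * α) ≤ T) (x : Fin d → ℝ) :
    |u x (t + h ^ 2 / (2 * d * α))
      - (∑ j, (u (x + Pi.single j h) t + u (x - Pi.single j h) t)) / (2 * d)|
      ≤ h ^ 4 * ζ / (6 * L ^ d) := by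
  have hd' : (0 : ℝ) < d := by exact_mod_cast hd
  have hs : 0 ≤ h ^ 2 / (2 * d * α) := by positivity
  have htT : t ∈ Set.Icc 0 T := ⟨ht, by linarith⟩
  have h1 := abs_time_step_le hL hα hu hb ht hs hst x
  have h2 : |∑ j, (u (x + Pi.single j h) t + u (x - Pi.single j h) t - 2 * u x t
      - h ^ 2 * pd j (pd j fun y => u y t) x)| ≤ d * (ζ / L ^ d / 12 * h ^ 4) := by
    refine (Finset.abs_sum_le_sum_abs _ _).trans ((Finset.sum_le_sum fun j _ =>
      abs_second_difference_sub_pd_le hL hu hb htT j x hh).trans_eq ?_)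
    simp
  have h3 : ∑ j, (u (x + Pi.single j h) t + u (x - Pi.single j h) t - 2 * u x t
      - h ^ 2 * pd j (pd j fun y => u y t) x)
      = ∑ j, (u (x + Pi.single j h) t + u (x - Pi.single j h) t) - d * (2 * u x t)
        - h ^ 2 * laplace (fun y => u y t) x := by
    rw [Finset.sum_sub_distrib, Finset.sum_sub_distrib, laplace, Finset.mul_sum]
    simp
  rw [h3] at h2
  generalize laplace (fun y => u y t) x = Δ at *
  generalize ∑ j, (u (x + Pi.single j h) t + u (x - Pi.single j h) t) = Y at *
  -- For this time step the terms with `u x t` cancel and the Euler step is the mean over the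
  -- neighbours.
  have e : u x (t + h ^ 2 / (2 * d * α)) - Y / (2 * d)
      = (u x (t + h ^ 2 / (2 * d * α)) - u x t - h ^ 2 / (2 * d * α) * α * Δ)
        - (Y - d * (2 * u x t) - h ^ 2 * Δ) / (2 * d) := by
    field_simp
    ring
  rw [e]
  refine (abs_sub _ _).trans ?_
  rw [abs_div, abs_of_pos (by positivity : (0 : ℝ) < 2 * d)]
  have h4 := div_le_div_of_nonneg_right h2 (by positivity : (0 : ℝ) ≤ 2 * d)
  -- In units of `h⁴ζ/L^d` the time error is `1/8` and the space error `1/24`, together `1/6`.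
  refine (add_le_add h1 h4).trans_eq ?_
  field_simp
  ring

end

/-! ### The walk on the grid -/

/-- The position of a grid point. -/
def gridPoint {d n : ℕ} (h : ℝ) (x : Fin d → Fin n) : Fin d → ℝ := fun j => ((x j : ℕ) : ℝ) * h

section
variable {d n : ℕ} [NeZero n]

theorem IsPeriodic.gridPoint_add {L h : ℝ} {F : (Fin d → ℝ) → ℝ} (hF : IsPeriodic L F)
    (hn : n * h = L) (x : Fin d → Fin n) (j : Fin d) :
    F (gridPoint h (x + Pi.single j 1)) = F (gridPoint h x + Pi.single j h) := by
  have hv : ((x j + 1 : Fin n) : ℕ) = (x j + 1) % n := by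
    rw [Fin.val_add, Fin.coe_ofNat_eq_mod, Nat.add_mod_mod]
  rcases Nat.lt_or_ge (x j + 1) n with hlt | hge
  · congr 1
    funext k
    by_cases hk : k = j
    · subst hk
      simp only [gridPoint, Pi.add_apply, Pi.single_eq_same, hv, Nat.mod_eq_of_lt hlt]
      push_cast
      ring
    · simp [gridPoint, Pi.single_eq_of_ne hk]
  -- The step wraps around, and the positions differ by the period `L`.
  · have he : (x j : ℕ) + 1 = n := le_antisymm (x j).isLt hge
    rw [← hF _ j]
    congr 1
    funext k
    by_cases hk : k = j
    · subst hk
      simp only [gridPoint, Pi.add_apply, Pi.single_eq_same, hv, he, Nat.mod_self]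
      have he' : ((x k : ℕ) : ℝ) + 1 = n := by exact_mod_cast he
      rw [← hn, ← he']
      push_cast
      ring
    · simp [gridPoint, Pi.single_eq_of_ne hk]

theorem IsPeriodic.gridPoint_sub {L h : ℝ} {F : (Fin d → ℝ) → ℝ} (hF : IsPeriodic L F)
    (hn : n * h = L) (x : Fin d → Fin n) (j : Fin d) :
    F (gridPoint h (x - Pi.single j 1)) = F (gridPoint h x - Pi.single j h) := by
  have hG : IsPeriodic L (fun z => F (z - Pi.single j h)) := fun z k => by
    show F (z + Pi.single k L - Pi.single j h) = _
    rw [add_sub_right_comm, hF]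
  have := hG.gridPoint_add hn (x - Pi.single j 1) j
  simpa using this.symm

theorem avg_gridPoint {L h : ℝ} {F : (Fin d → ℝ) → ℝ} (hF : IsPeriodic L F)
    (hn : n * h = L) (x : Fin d → Fin n) :
    avg (fun y => F (gridPoint h y)) x
      = (∑ j, (F (gridPoint h x + Pi.single j h) + F (gridPoint h x - Pi.single j h))) / (2 * d) := by
  simp only [avg, hF.gridPoint_add hn, hF.gridPoint_sub hn]

/-- The averaging operator is self-adjoint. -/
theorem sum_avg_mul (F G : (Fin d → Fin n) → ℝ) : ∑ x, avg F x * G x = ∑ x, F x * avg G x := by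
  have h1 : ∀ (F G : (Fin d → Fin n) → ℝ) e, ∑ x, F (x + e) * G x = ∑ x, F x * G (x - e) := by
    intro F G e
    rw [← Equiv.sum_comp (Equiv.addRight e) fun x => F x * G (x - e)]
    simp
  simp only [avg, div_mul_eq_mul_div, mul_div_assoc', ← Finset.sum_div, Finset.sum_mul, Finset.mul_sum]
  congr 1
  rw [Finset.sum_comm, Finset.sum_comm (s := Finset.univ (α := Fin d → Fin n))]
  refine Finset.sum_congr rfl fun j _ => ?_
  simp only [add_mul, mul_add, Finset.sum_add_distrib]
  rw [h1, add_comm]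
  congr 1
  simpa [sub_eq_add_neg] using h1 F G (-Pi.single j 1)

theorem avg_mem_Icc (hd : 0 < d) {F : (Fin d → Fin n) → ℝ} {p q : ℝ} (hF : ∀ x, F x ∈ Set.Icc p q)
    (x : Fin d → Fin n) : avg F x ∈ Set.Icc p q := by
  have hd' : (0 : ℝ) < 2 * d := by positivity
  refine ⟨(le_div_iff₀ hd').2 ?_, (div_le_iff₀ hd').2 ?_⟩
  · refine le_trans (le_of_eq ?_) (Finset.sum_le_sum fun j _ =>
      add_le_add (hF (x + Pi.single j 1)).1 (hF (x - Pi.single j 1)).1)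
    simp
    ring
  · refine (Finset.sum_le_sum fun j _ =>
      add_le_add (hF (x + Pi.single j 1)).2 (hF (x - Pi.single j 1)).2).trans_eq ?_
    simp
    ring

theorem avg_iterate_mem_Icc (hd : 0 < d) {F : (Fin d → Fin n) → ℝ} {p q : ℝ}
    (hF : ∀ x, F x ∈ Set.Icc p q) (k : ℕ) : ∀ x, avg^[k] F x ∈ Set.Icc p q := by
  induction k with
  | zero => exact hF
  | succ k ih => rw [Function.iterate_succ_apply']; exact avg_mem_Icc hd ih

/-- The random walk approximates the solution of the heat equation, tested against `G`. -/
theorem abs_sum_walk_sub_le (hd : 0 < d) {L T α ζ h : ℝ} {u : (Fin d → ℝ) → ℝ → ℝ}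
    (hL : 0 < L) (hα : 0 < α) (hu : IsHeatSolution d L T α u) (hb : HasSmoothnessBound d L T ζ u)
    (hn : n * h = L) (hh : 0 ≤ h) (k : ℕ) :
    ∀ G : (Fin d → Fin n) → ℝ, (∀ x, G x ∈ Set.Icc 0 1) → k * (h ^ 2 / (2 * d * α)) ≤ T →
      |∑ x, u (gridPoint h x) (k * (h ^ 2 / (2 * d * α))) * G x
        - ∑ x, u (gridPoint h x) 0 * avg^[k] G x| ≤ k * ((n : ℝ) ^ d * (h ^ 4 * ζ / (6 * L ^ d))) := by
  have hΔ : 0 ≤ h ^ 2 / (2 * d * α) := by positivity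
  set Δ := h ^ 2 / (2 * d * α) with hΔdef
  induction k with
  | zero => intro G _ _; simp
  | succ k ih =>
    intro G hG hk
    push_cast at hk ⊢
    have hk' : k * Δ + Δ ≤ T := by linarith
    -- The last step is moved onto the test function by self-adjointness; hence the induction runs
    -- over all `G` with values in `[0,1]`.
    have h1 := ih (avg G) (avg_mem_Icc hd hG) (by linarith)
    have hkt : (k : ℝ) * Δ ∈ Set.Icc 0 T := ⟨by positivity, by linarith⟩
    rw [Function.iterate_succ_apply]
    have h2 : |∑ x, (u (gridPoint h x) (k * Δ + Δ)
        - avg (fun y : Fin d → Fin n => u (gridPoint h y) (k * Δ)) x) * G x|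
        ≤ (n : ℝ) ^ d * (h ^ 4 * ζ / (6 * L ^ d)) := by
      refine (Finset.abs_sum_le_sum_abs _ _).trans ?_
      have : ∀ x ∈ (Finset.univ : Finset (Fin d → Fin n)), |(u (gridPoint h x) (k * Δ + Δ)
        - avg (fun y : Fin d → Fin n => u (gridPoint h y) (k * Δ)) x) * G x|
          ≤ h ^ 4 * ζ / (6 * L ^ d) := by
        intro x _
        have h3 := abs_sub_average_le hd hL hα hu hb hkt.1 hh hk' (gridPoint h x)
        rw [avg_gridPoint (hu.isPeriodic hkt) hn, abs_mul]
        refine (mul_le_of_le_one_right (abs_nonneg _) ?_).trans h3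
        exact abs_le.2 ⟨by linarith [(hG x).1], (hG x).2⟩
      refine (Finset.sum_le_sum this).trans_eq ?_
      simp
    have h4 := sum_avg_mul (fun y : Fin d → Fin n => u (gridPoint h y) (k * Δ)) G
    simp only [sub_mul, Finset.sum_sub_distrib, h4] at h2
    rw [show ((k : ℝ) + 1) * Δ = k * Δ + Δ by ring, abs_le] at *
    constructor <;> linarith [h1.1, h1.2, h2.1, h2.2]

end

/-! ### The midpoint rule -/

section
variable {d : ℕ}

open MeasureTheory

/-- Reflection of a coordinate preserves the volume. -/
theorem measurePreserving_reflect (j : Fin d) (s : ℝ) :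
    MeasurePreserving (fun y : Fin d → ℝ => Function.update y j (s - y j)) volume volume := by
  have h := volume_preserving_pi (f := fun k : Fin d => if k = j then fun r : ℝ => s - r else id)
    (fun k => by
      by_cases hk : k = j
      · simp only [hk, if_true]; exact Measure.measurePreserving_sub_left volume s
      · simp only [hk, if_false]; exact MeasurePreserving.id _)
  have e : (fun y : Fin d → ℝ => Function.update y j (s - y j))
      = fun y k => (if k = j then fun r : ℝ => s - r else id) (y k) := by
    funext y k
    by_cases hk : k = j
    · subst hk; simp
    · simp [hk]
  rw [e]
  exact h

/-- The coordinates are released from the centre one at a time, `A` being the set of free ones.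
Averaging over the reflection in coordinate `j` turns the change of the integrand into half a second
difference at distance at most `h/2`, so each coordinate costs `B * h² / 8` per unit volume. -/
theorem abs_setIntegral_cell_sub_le {f : (Fin d → ℝ) → ℝ} (hf : Continuous f) {B h : ℝ} (hh : 0 ≤ h)
    (hB : ∀ x j s, 0 ≤ s → |f (x + Pi.single j s) + f (x - Pi.single j s) - 2 * f x| ≤ B * s ^ 2)
    (hB0 : 0 ≤ B) (c : Fin d → ℝ) :
    |(∫ x in Set.Icc (fun j => c j - h / 2) (fun j => c j + h / 2), f x) - h ^ d * f c|
      ≤ h ^ d * (d * (B * h ^ 2 / 8)) := by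
  classical
  set I : Set (Fin d → ℝ) := Set.Icc (fun j => c j - h / 2) (fun j => c j + h / 2) with hI
  have hvol : (volume I).toReal = h ^ d := by
    rw [hI, Real.volume_Icc_pi_toReal (fun j => by show c j - h/2 ≤ c j + h/2; linarith)]
    simp [show ∀ j, c j + h / 2 - (c j - h / 2) = h from fun j => by ring]
  have hfin : volume I < ⊤ := isCompact_Icc.measure_lt_top
  have hmeas : MeasurableSet I := measurableSet_Icc
  set g : Finset (Fin d) → (Fin d → ℝ) → ℝ := fun A y => f (fun k => if k ∈ A then y k else c k) with hg
  have hgc : ∀ A, Continuous (g A) := fun A => hf.comp (continuous_pi fun k => by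
    by_cases hk : k ∈ A
    · simp only [hk, if_true]; exact continuous_apply k
    · simp only [hk, if_false]; exact continuous_const)
  have hint : ∀ A, IntegrableOn (g A) I := fun A => (hgc A).continuousOn.integrableOn_compact isCompact_Icc
  have key : ∀ A : Finset (Fin d), |(∫ x in I, g A x) - h ^ d * f c| ≤ h ^ d * (A.card * (B * h ^ 2 / 8)) := by
    intro A
    induction A using Finset.induction_on with
    | empty => simp [hg, measureReal_def, hvol]
    | insert j A hj ih =>
      have hrefl := measurePreserving_reflect j (2 * c j)
      set ρ := fun y : Fin d → ℝ => Function.update y j (2 * c j - y j) with hρ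
      have hinv : Function.Involutive ρ := fun y => by
        funext k
        by_cases hk : k = j
        · subst hk; simp [hρ]
        · simp [hρ, hk]
      have hmap : ∀ y ∈ I, ρ y ∈ I := by
        intro y hy
        have key : ∀ k, c k - h / 2 ≤ ρ y k ∧ ρ y k ≤ c k + h / 2 := by
          intro k
          have h1 := hy.1 k
          have h2 := hy.2 k
          simp only at h1 h2
          by_cases hk : k = j
          · subst hk
            simp only [hρ, Function.update_self]
            constructor <;> linarith
          · simp only [hρ, Function.update_of_ne hk]
            exact ⟨h1, h2⟩
        exact ⟨fun k => (key k).1, fun k => (key k).2⟩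
      have hpre : ρ ⁻¹' I = I := by
        refine Set.Subset.antisymm (fun y hy => ?_) hmap
        simpa [hinv y] using hmap _ hy
      have hemb : MeasurableEmbedding ρ :=
        (MeasurableEquiv.mk hinv.toPerm hrefl.measurable hrefl.measurable).measurableEmbedding
      have e1 : ∫ x in I, g (insert j A) (ρ x) = ∫ x in I, g (insert j A) x := by
        have := hrefl.setIntegral_preimage_emb hemb (g (insert j A)) I
        rwa [hpre] at this
      have hint' : IntegrableOn (fun x => g (insert j A) (ρ x)) I := by
        refine ((hgc _).comp (continuous_pi fun k => ?_)).continuousOn.integrableOn_compact isCompact_Icc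
        by_cases hk : k = j
        · subst hk; simp only [hρ, Function.update_self]; fun_prop
        · simp only [hρ, Function.update_of_ne hk]; fun_prop
      have e2 : 2 * ((∫ x in I, g (insert j A) x) - ∫ x in I, g A x)
          = ∫ x in I, (g (insert j A) x + g (insert j A) (ρ x) - 2 * g A x) := by
        rw [integral_sub (f := fun x => g (insert j A) x + g (insert j A) (ρ x)) ((hint _).add hint')
          ((hint _).const_mul 2), integral_add (hint _) hint', e1, integral_const_mul]
        ring
      have e3 : ∀ x ∈ I, ‖g (insert j A) x + g (insert j A) (ρ x) - 2 * g A x‖ ≤ B * (h / 2) ^ 2 := by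
        intro x hx
        set z : Fin d → ℝ := fun k => if k ∈ A then x k else c k with hz
        have z1 : ∀ s, (fun k => if k ∈ insert j A then Function.update x j (c j + s) k else c k)
            = z + Pi.single j s := by
          intro s
          funext k
          by_cases hk : k = j
          · subst hk; simp [hz, hj]
          · simp [hz, hk]
        have g1 : g (insert j A) x = f (z + Pi.single j (x j - c j)) := by
          rw [← z1]; simp [hg]
        have g2 : g (insert j A) (ρ x) = f (z + Pi.single j (-(x j - c j))) := by
          rw [← z1]
          simp only [hg, hρ]
          rw [show 2 * c j - x j = c j + -(x j - c j) by ring]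
        have habs : |x j - c j| ≤ h / 2 := by
          have h1 := hx.1 j
          have h2 := hx.2 j
          simp only at h1 h2
          exact abs_le.2 ⟨by linarith, by linarith⟩
        have hsq : (x j - c j) ^ 2 ≤ (h / 2) ^ 2 := sq_le_sq' (by linarith [(abs_le.1 habs).1]) (abs_le.1 habs).2
        rw [g1, g2, Real.norm_eq_abs]
        refine le_trans ?_ (mul_le_mul_of_nonneg_left hsq hB0)
        rcases le_total 0 (x j - c j) with hs | hs
        · simpa [sub_eq_add_neg, ← Pi.single_neg] using hB z j _ hs
        · have := hB z j (-(x j - c j)) (by linarith)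
          rw [sub_eq_add_neg z, ← Pi.single_neg, neg_neg, neg_sq, add_comm (f _)] at this
          exact this
      have e4 := norm_setIntegral_le_of_norm_le_const hfin e3
      rw [← e2, Real.norm_eq_abs, measureReal_def, hvol, abs_mul, abs_two] at e4
      rw [Finset.card_insert_of_notMem hj]
      push_cast
      have e5 := abs_add_le ((∫ x in I, g (insert j A) x) - ∫ x in I, g A x) ((∫ x in I, g A x) - h ^ d * f c)
      rw [sub_add_sub_cancel] at e5
      nlinarith
  have := key Finset.univ
  simpa [hg] using this

theorem setIntegral_Icc_eq_Ioc (f : (Fin d → ℝ) → ℝ) (p q : Fin d → ℝ) :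
    ∫ x in Set.Icc p q, f x = ∫ x in Set.univ.pi fun j => Set.Ioc (p j) (q j), f x :=
  setIntegral_congr_set Measure.univ_pi_Ioc_ae_eq_Icc.symm

/-- A box is cut into the cells around its grid points. -/
theorem setIntegral_box_eq_sum {n : ℕ} {f : (Fin d → ℝ) → ℝ} (hf : Continuous f) {h : ℝ} (hh : 0 < h)
    {a b : Fin d → ℕ} (hb : ∀ j, b j < n) :
    ∫ x in Set.Icc (fun j => ((a j : ℝ) + 1 / 2) * h) (fun j => ((b j : ℝ) + 1 / 2) * h), f x
      = ∑ x : Fin d → Fin n, open Classical in (if ∀ j, a j < x j ∧ (x j : ℕ) ≤ b j then 1 else 0)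
        * ∫ y in Set.Icc (fun j => gridPoint h x j - h / 2) (fun j => gridPoint h x j + h / 2), f y := by
  classical
  simp only [ite_mul, one_mul, zero_mul, ← Finset.sum_filter]
  set t : Finset (Fin d → Fin n) := Finset.univ.filter fun x => ∀ j, a j < x j ∧ (x j : ℕ) ≤ b j with ht
  simp only [setIntegral_Icc_eq_Ioc]
  rw [← integral_biUnion_finset]
  · congr 2
    ext y
    simp only [Set.mem_pi, Set.mem_univ, forall_true_left, Set.mem_Ioc, Set.mem_iUnion, exists_prop, ht,
      Finset.mem_filter, Finset.mem_univ, true_and, gridPoint]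
    constructor
    · intro hy
      -- This is the index of the half-open cell that contains `y j`.
      have key : ∀ j, a j < ⌈y j / h - 1 / 2⌉₊ ∧ ⌈y j / h - 1 / 2⌉₊ ≤ b j := by
        intro j
        have h1 := (lt_div_iff₀ hh).2 (hy j).1
        have h2 := (div_le_iff₀ hh).2 (hy j).2
        exact ⟨Nat.lt_ceil.2 (by linarith), Nat.ceil_le.2 (by linarith)⟩
      refine ⟨fun j => ⟨⌈y j / h - 1 / 2⌉₊, (key j).2.trans_lt (hb j)⟩, key, fun j => ?_⟩
      have h1 := (lt_div_iff₀ hh).2 (hy j).1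
      have h0 : 0 ≤ y j / h - 1 / 2 := by linarith [(a j).cast_nonneg (α := ℝ)]
      have h2 := Nat.le_ceil (y j / h - 1 / 2)
      have h3 := Nat.ceil_lt_add_one h0
      have e : y j = y j / h * h := by field_simp
      constructor
      · rw [e]; nlinarith
      · rw [e]; nlinarith
    · rintro ⟨x, hx, hy⟩ j
      have h1 : (a j : ℝ) + 1 ≤ (x j : ℕ) := by exact_mod_cast (hx j).1
      have h2 : ((x j : ℕ) : ℝ) ≤ b j := by exact_mod_cast (hx j).2
      have h3 := hy j
      constructor <;> nlinarith
  · exact fun x _ => MeasurableSet.univ_pi fun j => measurableSet_Ioc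
  · intro x _ x' _ hne
    refine Set.disjoint_left.2 fun y hy hy' => hne ?_
    funext j
    have h1 := hy j trivial
    have h2 := hy' j trivial
    simp only [gridPoint, Set.mem_Ioc] at h1 h2
    have h3 : ((x j : ℕ) : ℝ) < (x' j : ℕ) + 1 := by
      refine lt_of_mul_lt_mul_right (a := h) ?_ hh.le
      linarith
    have h4 : ((x' j : ℕ) : ℝ) < (x j : ℕ) + 1 := by
      refine lt_of_mul_lt_mul_right (a := h) ?_ hh.le
      linarith
    norm_cast at h3 h4
    exact Fin.ext (by omega)
  · intro x _
    exact (hf.continuousOn.integrableOn_compact isCompact_Icc).mono_set fun y hy =>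
      ⟨fun j => (hy j trivial).1.le, fun j => (hy j trivial).2⟩

end

/-! ### The accuracy of the walk -/

section
variable {d n : ℕ} {L T α ζ ε : ℝ} {u : (Fin d → ℝ) → ℝ → ℝ}

/-- The midpoint rule contributes `dx² d ζ L² / 8` and the walk `dx² ζ / 6` times `i dx² ≤ 2dαT`;
both fit under the common factor `1/3`. -/
theorem abs_walk_sub_integral_le [NeZero n] (hd : 0 < d) (hL : 0 < L) (hα : 0 < α)
    (hζ : 0 ≤ ζ) (hu : IsHeatSolution d L T α u) (hb : HasSmoothnessBound d L T ζ u) {i : ℕ}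
    {a b : Fin d → ℕ} (hbn : ∀ j, b j < n) (hi : i * dt d L α n ≤ T) :
    |dx L n ^ d * ∑ x, gridInit L n u x * avg^[i] (fun y : Fin d → Fin n => open Classical in
        if ∀ j, a j < y j ∧ (y j : ℕ) ≤ b j then 1 else 0) x
      - ∫ x in shiftedBox L n a b, u x (i * dt d L α n)|
      ≤ dx L n ^ 2 * (d * ζ * (α * T + L ^ 2)) / 3 := by
  have hn0 : (0 : ℝ) < n := by exact_mod_cast NeZero.pos n
  have hd' : (0 : ℝ) < d := by exact_mod_cast hd
  have hh : 0 < dx L n := div_pos hL hn0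
  have hnh : n * dx L n = L := by rw [dx]; field_simp
  have hdt : 0 ≤ dt d L α n := by rw [dt]; positivity
  have htT : i * dt d L α n ∈ Set.Icc 0 T := ⟨by positivity, hi⟩
  have hc : Continuous fun x => u x (i * dt d L α n) := (hu.smooth _ htT).continuous
  set g : (Fin d → Fin n) → ℝ := fun y => open Classical in
    if ∀ j, a j < y j ∧ (y j : ℕ) ≤ b j then 1 else 0 with hg
  have hg01 : ∀ x, g x ∈ Set.Icc 0 1 := fun x => by
    by_cases hx : ∀ j, a j < x j ∧ (x j : ℕ) ≤ b j
    · simp only [hg, if_pos hx]; norm_num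
    · simp only [hg, if_neg hx]; norm_num
  have h1 := abs_sum_walk_sub_le hd hL hα hu hb hnh hh.le i g hg01 hi
  rw [shiftedBox, setIntegral_box_eq_sum hc hh hbn]
  have hB0 : 0 ≤ ζ / L ^ ((d : ℤ) - 2) := by positivity
  have hzp : L ^ ((d : ℤ) - 2) * L ^ 2 = L ^ d := by
    rw [← zpow_natCast L 2, ← zpow_add₀ hL.ne']
    simp
  change |_ - _| ≤ _ at h1
  set U : (Fin d → ℝ) → ℝ := fun x => u x (i * dt d L α n) with hU
  have h2 : |∑ x, g x * (∫ y in Set.Icc (fun j => gridPoint (dx L n) x j - dx L n / 2)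
        (fun j => gridPoint (dx L n) x j + dx L n / 2), U y)
      - dx L n ^ d * ∑ x, U (gridPoint (dx L n) x) * g x|
      ≤ (n : ℝ) ^ d * (dx L n ^ d * (d * (ζ / L ^ ((d : ℤ) - 2) * dx L n ^ 2 / 8))) := by
    rw [Finset.mul_sum, ← Finset.sum_sub_distrib]
    refine (Finset.abs_sum_le_sum_abs _ _).trans ?_
    refine (Finset.sum_le_sum (g := fun _ => dx L n ^ d * (d * (ζ / L ^ ((d : ℤ) - 2) * dx L n ^ 2 / 8)))
      fun x _ => ?_).trans_eq (by simp)
    have h3 := abs_setIntegral_cell_sub_le hc hh.le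
      (fun x j s hs => abs_second_difference_le_of_mem hL hu hb htT j x hs) hB0 (gridPoint (dx L n) x)
    rw [show ∀ A B : ℝ, g x * A - dx L n ^ d * (B * g x) = g x * (A - dx L n ^ d * B) from
      fun A B => by ring, abs_mul, abs_of_nonneg (hg01 x).1]
    exact (mul_le_of_le_one_left (abs_nonneg _) (hg01 x).2).trans h3
  have h4 : |dx L n ^ d * ∑ x, U (gridPoint (dx L n) x) * g x
      - dx L n ^ d * ∑ x, gridInit L n u x * avg^[i] g x|
      ≤ dx L n ^ d * (i * ((n : ℝ) ^ d * (dx L n ^ 4 * ζ / (6 * L ^ d)))) := by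
    rw [← mul_sub, abs_mul, abs_of_pos (pow_pos hh d)]
    exact mul_le_mul_of_nonneg_left h1 (by positivity)
  have e2 : (n : ℝ) ^ d * (dx L n ^ d * (d * (ζ / L ^ ((d : ℤ) - 2) * dx L n ^ 2 / 8)))
      = dx L n ^ 2 * (d * ζ * L ^ 2) / 8 := by
    rw [← mul_assoc, ← mul_pow, hnh, ← hzp]
    field_simp
  have e4 : dx L n ^ d * (i * ((n : ℝ) ^ d * (dx L n ^ 4 * ζ / (6 * L ^ d))))
      = dx L n ^ 2 * ζ / 6 * (i * dx L n ^ 2) := by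
    rw [show ∀ A B C D : ℝ, A * (B * (C * D)) = (C * A) * (B * D) from fun _ _ _ _ => by ring, ← mul_pow,
      hnh]
    field_simp
  have e5 : i * dx L n ^ 2 ≤ 2 * d * α * T := by
    rw [dt, ← mul_div_assoc, div_le_iff₀ (by positivity)] at hi
    linarith
  have e6 := mul_le_mul_of_nonneg_left e5 (by positivity : 0 ≤ dx L n ^ 2 * ζ / 6)
  rw [e2] at h2
  rw [e4] at h4
  have h7 : 0 ≤ dx L n ^ 2 * (d * ζ * L ^ 2) := by positivity
  rw [abs_le] at h2 h4 ⊢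
  constructor <;> nlinarith [h2.1, h2.2, h4.1, h4.2]

/-- A grid of the prescribed size is fine enough. -/
theorem dx_sq_mul_le (hn : 0 < n) (hL : 0 < L) (hε : 0 < ε)
    (hX : gridScale d L T α ζ ε ≤ n) : dx L n ^ 2 * (d * ζ * (α * T + L ^ 2)) ≤ ε := by
  have hn' : (0 : ℝ) < n := by exact_mod_cast hn
  have h1 : √(d * ζ * (α * T + L ^ 2) / ε) ≤ n / L := by
    rw [le_div_iff₀ hL, mul_comm]; exact hX
  have h2 := (Real.sqrt_le_iff.1 h1).2
  rw [div_le_iff₀ hε] at h2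
  have h3 := mul_le_mul_of_nonneg_left h2 (sq_nonneg (dx L n))
  refine h3.trans_eq ?_
  rw [dx]
  field_simp

theorem lt_of_shiftedBox_subset (hn : 0 < n) (hL : 0 < L) {a b : Fin d → ℕ} (hab : ∀ j, a j ≤ b j)
    (hS : shiftedBox L n a b ⊆ cube d L) (j : Fin d) : b j < n := by
  have hn' : (0 : ℝ) < n := by exact_mod_cast hn
  have hh : 0 < dx L n := div_pos hL hn'
  have hmem : (fun j => ((b j : ℝ) + 1 / 2) * dx L n) ∈ shiftedBox L n a b := by
    refine ⟨fun j => ?_, le_rfl⟩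
    have : (a j : ℝ) ≤ b j := by exact_mod_cast hab j
    exact mul_le_mul_of_nonneg_right (by linarith) hh.le
  have h1 : ((b j : ℝ) + 1 / 2) * dx L n ≤ L := (hS hmem).2 j
  rw [dx, mul_div_assoc', div_le_iff₀ hn', mul_comm L, mul_le_mul_iff_left₀ hL] at h1
  exact_mod_cast (by linarith : (b j : ℝ) < n)

/-! ### The running time -/

theorem size_eq_log_succ {n : ℕ} (hn : 0 < n) : Nat.size n = Nat.log 2 n + 1 :=
  le_antisymm (Nat.size_le.2 (Nat.lt_pow_succ_log_self one_lt_two n))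
    (Nat.lt_size.2 (Nat.pow_log_le_self 2 hn.ne'))

/-- Since `log X ≥ log 2`, the additive constants from `log K` and the rounding are absorbed into a
multiple of `log X`. -/
theorem log_succ_le {n : ℕ} {K X : ℝ} (hn : 0 < n) (hK : 0 < K) (hX : 2 ≤ X) (hnX : n ≤ K * X) :
    (Nat.log 2 n : ℝ) + 1 ≤ (|Real.log K| / Real.log 2 + 2) / Real.log 2 * Real.log X := by
  have h2 : 0 < Real.log 2 := Real.log_pos one_lt_two
  have hn' : (0 : ℝ) < n := by exact_mod_cast hn
  have h1 : (Nat.log 2 n : ℝ) ≤ Real.log n / Real.log 2 := by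
    simpa [Real.logb] using Real.natLog_le_logb n 2
  have h3 : Real.log n ≤ Real.log K + Real.log X := by
    rw [← Real.log_mul hK.ne' (by linarith)]
    exact Real.log_le_log hn' hnX
  have h4 : Real.log 2 ≤ Real.log X := Real.log_le_log two_pos hX
  have h5 : 1 ≤ Real.log X / Real.log 2 := (one_le_div h2).2 h4
  have h6 : Real.log K ≤ |Real.log K| * (Real.log X / Real.log 2) :=
    (le_abs_self _).trans (le_mul_of_one_le_right (abs_nonneg _) h5)
  have h7 : Real.log n / Real.log 2
      ≤ (|Real.log K| * (Real.log X / Real.log 2) + Real.log X) / Real.log 2 :=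
    div_le_div_of_nonneg_right (by linarith) h2.le
  have e : (|Real.log K| / Real.log 2 + 2) / Real.log 2 * Real.log X
      = (|Real.log K| * (Real.log X / Real.log 2) + Real.log X) / Real.log 2
        + Real.log X / Real.log 2 := by
    field_simp
    ring
  linarith

theorem two_pow_log_le {ε : ℝ} (hε : 0 < ε) (hε1 : ε < 1) :
    (2 : ℝ) ^ Nat.log 2 (1024 * ⌈1 / ε⌉₊) ≤ 2048 / ε := by
  have h1 : (2 : ℝ) ^ Nat.log 2 (1024 * ⌈1 / ε⌉₊) ≤ 1024 * ⌈1 / ε⌉₊ := by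
    exact_mod_cast Nat.pow_log_le_self 2 (by positivity)
  have h2 := Nat.ceil_lt_add_one (by positivity : 0 ≤ 1 / ε)
  have h3 : 1 ≤ 1 / ε := (one_le_div hε).2 hε1.le
  rw [show 2048 / ε = 2048 * (1 / ε) by ring]
  linarith

theorem le_two_pow_log_mul {ε : ℝ} (hε : 0 < ε) :
    256 ≤ (2 : ℝ) ^ Nat.log 2 (1024 * ⌈1 / ε⌉₊) * (ε / 2) := by
  have h1 : (1024 * ⌈1 / ε⌉₊ : ℝ) < 2 ^ (Nat.log 2 (1024 * ⌈1 / ε⌉₊) + 1) := by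
    exact_mod_cast Nat.lt_pow_succ_log_self one_lt_two _
  have h2 := Nat.le_ceil (1 / ε)
  have h3 : 512 * (1 / ε) ≤ (2 : ℝ) ^ Nat.log 2 (1024 * ⌈1 / ε⌉₊) := by
    rw [pow_succ] at h1
    linarith
  have h4 := mul_le_mul_of_nonneg_right h3 (by positivity : 0 ≤ ε / 2)
  refine le_trans (le_of_eq ?_) h4
  field_simp
  norm_num

/-- The number of time steps is of the order `T α d² ζ (α T + L²) / ε`. -/
theorem steps_add_one_le (hd : 0 < d) (hn : 0 < n) (hL : 0 < L) (hα : 0 < α)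
    (hT : 0 < T) {K : ℝ} (hM : 0 ≤ d * ζ * (α * T + L ^ 2) / ε)
    (hM1 : 1 ≤ T * α * d ^ 2 * ζ * (α * T + L ^ 2) / ε)
    (hnX : n ≤ K * gridScale d L T α ζ ε) {i : ℕ} (hi : i * dt d L α n ≤ T) :
    (i : ℝ) + 1 ≤ (2 * K ^ 2 + 1) * (T * α * d ^ 2 * ζ * (α * T + L ^ 2) / ε) := by
  have hn' : (0 : ℝ) < n := by exact_mod_cast hn
  have hd' : (0 : ℝ) < d := by exact_mod_cast hd
  have h1 : (n : ℝ) ^ 2 ≤ K ^ 2 * (L ^ 2 * (d * ζ * (α * T + L ^ 2) / ε)) := by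
    have := pow_le_pow_left₀ hn'.le hnX 2
    rwa [mul_pow, gridScale, mul_pow, Real.sq_sqrt hM] at this
  rw [dt, dx, div_pow, ← mul_div_assoc, div_le_iff₀ (by positivity), ← mul_div_assoc,
    div_le_iff₀ (by positivity)] at hi
  -- Here `i ≤ T/Δt = 2dαTn²/L²` is combined with `n² ≤ K²X²`; the factor `L²` of `X²` cancels.
  have h2 : (i : ℝ) * L ^ 2 ≤ T * (2 * d * α) * (K ^ 2 * (L ^ 2 * (d * ζ * (α * T + L ^ 2) / ε))) :=
    hi.trans (mul_le_mul_of_nonneg_left h1 (by positivity))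
  have h3 : (i : ℝ) ≤ 2 * K ^ 2 * (T * α * d ^ 2 * ζ * (α * T + L ^ 2) / ε) := by
    refine le_of_mul_le_mul_right (h2.trans_eq ?_) (by positivity : 0 < L ^ 2)
    ring
  linarith

end

end HeatQ

end

/-! ### Assembly of accuracy and running time -/

theorem mainTheorem2 :
    ∃ (Q : HeatQ.QAlgorithm) (c₀ : ℝ), 0 < c₀ ∧ ∀ K : ℝ, ∃ C : ℝ,
      ∀ (d n i : ℕ) (L T α ζ ε : ℝ) (u : (Fin d → ℝ) → ℝ → ℝ) (a b : Fin d → ℕ),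
        0 < L → 0 < T → 0 < α → 0 < ε → ε < 1 →
        HeatQ.IsHeatSolution d L T α u →
        HeatQ.HasSmoothnessBound d L T ζ u →
        1 ≤ T * α * d ^ 2 * ζ * (α * T + L ^ 2) / ε →
        2 ≤ HeatQ.gridScale d L T α ζ ε →
        c₀ * HeatQ.gridScale d L T α ζ ε ≤ n →
        n ≤ K * HeatQ.gridScale d L T α ζ ε →
        HeatQ.IsNormalised L n u →
        i * HeatQ.dt d L α n ≤ T →
        (∀ j, a j ≤ b j) →
        HeatQ.shiftedBox L n a b ⊆ HeatQ.cube d L →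
        99 / 100 ≤ Q.prob (HeatQ.inputMem d n i ⌈1 / ε⌉₊ a b) (HeatQ.gridInit L n u)
            (fun H => |H - ∫ x in HeatQ.shiftedBox L n a b, u x (i * HeatQ.dt d L α n)| ≤ ε) ∧
        (Q.time (HeatQ.inputMem d n i ⌈1 / ε⌉₊ a b) : ℝ) ≤
          C * ((T * α * d ^ 3 * ζ * (α * T + L ^ 2) / ε ^ 2) *
            Real.log (L * √(d * ζ * (α * T + L ^ 2) / ε))) := by
  obtain ⟨c, hc⟩ := HeatQ.exists_time_le
  refine ⟨HeatQ.algorithm, 1, one_pos, fun K => ⟨c * 2048 * (2 * K ^ 2 + 1)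
    * ((|Real.log K| / Real.log 2 + 2) / Real.log 2), ?_⟩⟩
  intro d n i L T α ζ ε u a b hL hT hα hε hε1 hu hb hM1 hX2 hnX hnK hnorm hi hab hS
  rw [one_mul] at hnX
  have hd : 0 < d := by
    rcases Nat.eq_zero_or_pos d with rfl | h
    · norm_num at hM1
    · exact h
  have hζ : 0 < ζ := by
    by_contra h
    have h1 : T * α * d ^ 2 * ζ * (α * T + L ^ 2) ≤ 0 :=
      mul_nonpos_of_nonpos_of_nonneg (mul_nonpos_of_nonneg_of_nonpos (by positivity) (not_lt.1 h))
        (by positivity)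
    linarith [div_nonpos_of_nonpos_of_nonneg h1 hε.le]
  have hn : 0 < n := by
    have : (0 : ℝ) < n := by linarith
    exact_mod_cast this
  have : NeZero n := ⟨hn.ne'⟩
  have hn' : (0 : ℝ) < n := by exact_mod_cast hn
  have hM : 0 ≤ d * ζ * (α * T + L ^ 2) / ε := by positivity
  have he : ⌈1 / ε⌉₊ ≠ 0 := (Nat.ceil_pos.2 (by positivity)).ne'
  constructor
  · have hh : 0 < HeatQ.dx L n := div_pos hL hn'
    have hsize := HeatQ.size_eq_log_succ hn
    have hbn := HeatQ.lt_of_shiftedBox_subset hn hL hab hS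
    have hlt : ∀ j, b j < 2 ^ (Nat.log 2 n + 1) := fun j =>
      (hbn j).trans (Nat.lt_pow_succ_log_self one_lt_two n)
    have hlt' : ∀ j, a j < 2 ^ (Nat.log 2 n + 1) := fun j => (hab j).trans_lt (hlt j)
    set g : (Fin d → Fin n) → ℝ := fun y => open Classical in
      if ∀ j, a j < y j ∧ (y j : ℕ) ≤ b j then 1 else 0 with hg
    have hg01 : ∀ x, g x ∈ Set.Icc 0 1 := fun x => by
      by_cases hx : ∀ j, a j < x j ∧ (x j : ℕ) ≤ b j
      · simp only [hg, if_pos hx]; norm_num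
      · simp only [hg, if_neg hx]; norm_num
    have hv : ∀ x, 0 ≤ HeatQ.gridInit L n u x := fun x => hu.nonneg _
    have hV : 0 < ∑ x : Fin d → Fin n, HeatQ.gridInit L n u x := by
      rw [hnorm]; positivity
    have hw01 := HeatQ.avg_iterate_mem_Icc hd hg01 i
    have hp0 : 0 ≤ HeatQ.dx L n ^ d * ∑ x, HeatQ.gridInit L n u x * HeatQ.avg^[i] g x :=
      mul_nonneg (by positivity) (Finset.sum_nonneg fun x _ => mul_nonneg (hv x) (hw01 x).1)
    have hp1 : HeatQ.dx L n ^ d * ∑ x, HeatQ.gridInit L n u x * HeatQ.avg^[i] g x ≤ 1 := by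
      have h1 : ∑ x, HeatQ.gridInit L n u x * HeatQ.avg^[i] g x ≤ (HeatQ.dx L n ^ d)⁻¹ :=
        hnorm ▸ Finset.sum_le_sum fun x _ => mul_le_of_le_one_right (hv x) (hw01 x).2
      exact (mul_le_mul_of_nonneg_left h1 (by positivity)).trans_eq (mul_inv_cancel₀ (by positivity))
    have hcor := HeatQ.inputMem_corners d n i ⌈1 / ε⌉₊ a b
    refine HeatQ.algorithm_prob_ge (HeatQ.gridInit L n u) hn he rfl rfl hlt' hlt hab hp0 hp1 rfl
      (fun m hm => ?_) (half_pos hε) (HeatQ.le_two_pow_log_mul hε) fun x hx => ?_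
    -- By the normalisation, division by the total weight `∑ u₀` is multiplication by `Δx^d`.
    · rw [HeatQ.expect_walkEnds hd hv hV hsize.symm (fun j hj => (hcor ⟨j, hj⟩).1.symm ▸ hlt' ⟨j, hj⟩)
        (fun j hj => (hcor ⟨j, hj⟩).2.symm ▸ hlt ⟨j, hj⟩)
        (fun j hj => (hcor ⟨j, hj⟩).1.symm ▸ (hcor ⟨j, hj⟩).2.symm ▸ hab ⟨j, hj⟩)
        (fun c h1 h2 => ?_)]
      · simp only [(hcor _).1, (hcor _).2]
        rw [hnorm, div_inv_eq_mul, mul_comm]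
      · have := HeatQ.numRandom_le_flagCell d i (Nat.log 2 n + 1) d
        exact hm c (Nat.zero_le c) (by omega)
    · have h1 := HeatQ.abs_walk_sub_integral_le (a := a) hd hL hα hζ.le hu hb hbn hi
      have h2 := HeatQ.dx_sq_mul_le hn hL hε hnX
      have h3 := abs_add_le (x - HeatQ.dx L n ^ d * ∑ x, HeatQ.gridInit L n u x * HeatQ.avg^[i] g x)
        (HeatQ.dx L n ^ d * ∑ x, HeatQ.gridInit L n u x * HeatQ.avg^[i] g x
          - ∫ x in HeatQ.shiftedBox L n a b, u x (i * HeatQ.dt d L α n))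
      rw [sub_add_sub_cancel] at h3
      -- Estimation contributes `ε/2`, discretisation at most `ε/3`.
      linarith
  · have hK : 0 < K := by
      by_contra h
      have := mul_nonpos_of_nonpos_of_nonneg (not_lt.1 h) (zero_le_two.trans hX2)
      linarith
    have h1 := hc (HeatQ.inputMem d n i ⌈1 / ε⌉₊ a b) hd he
    have h1' : (HeatQ.algorithm.time (HeatQ.inputMem d n i ⌈1 / ε⌉₊ a b) : ℝ)
        ≤ c * (2 ^ Nat.log 2 (1024 * ⌈1 / ε⌉₊) * (d * (Nat.log 2 n + 1) * (i + 1))) := by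
      exact_mod_cast h1
    have h2 := HeatQ.two_pow_log_le hε hε1
    have h3 := HeatQ.log_succ_le hn hK hX2 hnK
    have h4 := HeatQ.steps_add_one_le hd hn hL hα hT hM hM1 hnK hi
    have hlog : 0 ≤ Real.log (HeatQ.gridScale d L T α ζ ε) := Real.log_nonneg (by linarith)
    have h2' : 0 < Real.log 2 := Real.log_pos one_lt_two
    refine h1'.trans ?_
    -- The three factors are the number of iterations, the size of a coordinate register and the
    -- number of time steps.
    have h5 : (2 : ℝ) ^ Nat.log 2 (1024 * ⌈1 / ε⌉₊) * (d * (Nat.log 2 n + 1) * (i + 1))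
        ≤ 2048 / ε * (d * ((|Real.log K| / Real.log 2 + 2) / Real.log 2
          * Real.log (HeatQ.gridScale d L T α ζ ε))
          * ((2 * K ^ 2 + 1) * (T * α * d ^ 2 * ζ * (α * T + L ^ 2) / ε))) := by
      gcongr
    refine (mul_le_mul_of_nonneg_left h5 (Nat.cast_nonneg c)).trans_eq ?_
    rw [HeatQ.gridScale]
    field_simp
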